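/- **Setting.** Let $(X,\sigma)$ be a first countable Hausdorff space, $T>0$, $x_o\in X$. Let $\mathsf d,\delta:X\times X\to[0,\infty]$ be lower semicontinuous with $\mathsf d(x,x)=\delta(x,x)=0$, $\mathsf d(x_o,x)<\infty$, $\mathsf d(x,z)\le \mathsf d(x,y)+\mathsf d(y,z)$ ($\mathsf d$ need not be symmetric or separate points), and put $\mathsf D=\mathsf d+\delta$. Let $\mathcal E,\mathcal P:[0,T]\times X\to\mathbb R$, $F_o\ge 0$, and $\mathcal F(t,x)=\mathcal E(t,x)+\mathsf d(x_o,x)+F_o$. A point $(t,x)\in[0,T]\times X$ is $(\mathsf D,Q)$-quasi-stable ($Q\ge0$) if $\mathcal E(t,x)\le\mathcal E(t,y)+\mathsf D(x,y)+Q$ for all $y\in X$, and $\mathsf D$-stable, written $x\in\mathscr S_{\mathsf D}(t)$, if this holds with $Q=0$. Let $\mathcal R(t,x)=\sup_{y}\{\mathcal E(t,x)-\mathcal E(t,y)-\mathsf D(x,y)\}\ge0$. **Assumptions.** (A) Every sublevel $\{\mathcal F\le C\}\subset[0,T]\times X$ is sequentially compact, and on it $\mathcal E$ is lower and $\mathcal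 P$ is upper semicontinuous. For all $(t,x)$, $$\liminf_{s\uparrow t}\frac{\mathcal E(t,x)-\mathcal E(s,x)}{t-s}\ge\mathcal P(t,x)\ge\limsup_{s\downarrow t}\frac{\mathcal E(s,x)-\mathcal E(t,x)}{s-t}$$ (the left inequality for $t>0$, the right one for $t<T$), and $|\mathcal P(t,x)|\le C_P\mathcal F(t,x)$ for a constant $C_P>0$. (B) (B1) $\mathsf d(x,y)=0$ implies $\delta(z,y)\le\delta(z,x)$ and $\delta(x,z)\le\delta(y,z)$ for all $z$. (B2) If $\sup_n\mathcal F(0,x_n)<\infty$, $x_n\to x$ in $\sigma$ and $\mathsf d(x_n,x)\to0$, then $\delta(x_n,x)\to0$. (B3) For all $t\in[0,T]$, $x\in\mathscr S_{\mathsf D}(t)$ and $M>1$ there are $\eta>0$ and a neighbourhood $U$ of $x$ with $\mathcal E(s,y)\le\mathcal E(s,x)+M\,\mathsf d(y,x)$ whenever $s\in(t-\eta,t]\cap[0,T]$, $y\in U\cap\mathscr S_{\mathsf D}(s)$, $\mathsf d(y,x)\le\eta$. (C) (C1) For all $Q\ge0$ and $C$ the set of $(\mathsf D,Q)$-quasi-stable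 points in $\{\mathcal F\le C\}$ is closed. (C2) If $x,y\in\mathscr S_{\mathsf D}(t)$ and $\mathsf d(x,y)=0$, then $x=y$. **Curves.** For $E\subset\mathbb R$, $\mathrm{Var}(u,E)$ is the supremum of $\sum_j\mathsf d(u(t_{j-1}),u(t_j))$ over finite sets $t_0<\dots<t_M$ in $E$. A curve $u:[a,b]\to X$ is $(\sigma,\mathsf d)$-regulated if it has one-sided $\sigma$-limits $u(t\pm)$ everywhere (with $u(a-):=u(a)$, $u(b+):=u(b)$), $\mathsf d(u(s),u(t-))\to0$ as $s\uparrow t$, $\mathsf d(u(t+),u(s))\to0$ as $s\downarrow t$, and $\mathsf d(u(t-),u(t))=0\Rightarrow u(t-)=u(t)$, $\mathsf d(u(t),u(t+))=0\Rightarrow u(t)=u(t+)$. It belongs to $BV_{\sigma,\mathsf d}([a,b];X)$ if moreover $\mathrm{Var}(u,[a,b])<\infty$. Its jump set is $J_u=\{t:u(t-)\ne u(t)\text{ or }u(t)\ne u(t+)\}$. **Jump cost.** For $t\in[0,T]$ and $u_\pm\in X$ let $\mathsf c(t,u_-,u_+)$ be the infimum of $$\mathrm{Var}(\vartheta,E)+\sum_{I}\delta(\vartheta(I^-),\vartheta(I^+))+\sum_{s\in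 E\setminus\{\max E\}}\mathcal R(t,\vartheta(s))$$ over all nonempty compact $E\subset\mathbb R$ and all $\sigma$-continuous $\vartheta:E\to X$ with $\vartheta(\min E)=u_-$, $\vartheta(\max E)=u_+$, $\sup_{s\in E}\mathcal E(t,\vartheta(s))<\infty$, and such that for every $\varepsilon>0$ there is $\eta>0$ with $\mathsf d(\vartheta(s_0),\vartheta(s_1))\le\varepsilon$ if $s_0,s_1\in E$, $s_0\le s_1\le s_0+\eta$. Here $I=(I^-,I^+)$ runs over the connected components of $[\min E,\max E]\setminus E$. With $\Delta_{\mathsf c}=\mathsf c-\mathsf d$ the augmented variation is $\mathrm{Var}_{\mathsf d,\mathsf c}(u,[a,a])=0$ and, for $a<b$, $$\mathrm{Var}_{\mathsf d,\mathsf c}(u,[a,b])=\mathrm{Var}(u,[a,b])+\Delta_{\mathsf c}(a,u(a),u(a+))+\Delta_{\mathsf c}(b,u(b-),u(b))+\sum_{t\in J_u\cap(a,b)}\big[\Delta_{\mathsf c}(t,u(t-),u(t))+\Delta_{\mathsf c}(t,u(t),u(t+))\big].$$ **Visco-Energetic solutions.** A $(\sigma,\mathsf d)$-regulated curve $u:[0,T]\to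 X$ is a Visco-Energetic (VE) solution if $u(t)\in\mathscr S_{\mathsf D}(t)$ for all $t\in[0,T]\setminus J_u$, the function $s\mapsto\mathcal P(s,u(s))$ is integrable on $[0,T]$, and for all $t\in[0,T]$ the augmented variation below is finite and $$\mathcal E(t,u(t))+\mathrm{Var}_{\mathsf d,\mathsf c}(u,[0,t])=\mathcal E(0,u(0))+\int_0^t\mathcal P(s,u(s))\,ds .$$ **Scheme.** For a partition $\tau=\{0=t^0_\tau<\dots<t^N_\tau=T\}$ with mesh $|\tau|=\max_n(t^n_\tau-t^{n-1}_\tau)$, a discrete solution starting from $U^0_\tau\in X$ consists of $U^1_\tau,\dots,U^N_\tau$ such that $U^n_\tau$ minimizes $U\mapsto\mathsf D(U^{n-1}_\tau,U)+\mathcal E(t^n_\tau,U)$ over $X$; its interpolant is $\overline U_\tau(0)=U^0_\tau$, $\overline U_\tau(t)=U^n_\tau$ for $t\in(t^{n-1}_\tau,t^n_\tau]$. **Theorem 3.8.** Assume (A), (B), (C). Let $u_0\in X$ be such that $v\in\mathscr S_{\mathsf D}(0)$ and $\mathsf d(u_0,v)=0$ imply $v=u_0$ (this holds in particular if $u_0\in\mathscr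 S_{\mathsf D}(0)$, or if $\mathsf d$ separates the points of $X$). (i) Let $\tau(k)$ be partitions of $[0,T]$ with $|\tau(k)|\to0$, with discrete solutions such that $\sup_k\mathsf d(x_o,U^0_{\tau(k)})<\infty$, $U^0_{\tau(k)}\to u_0$ in $\sigma$ and $\mathcal E(0,U^0_{\tau(k)})\to\mathcal E(0,u_0)$. Then there are a (not relabeled) subsequence and a curve $u\in BV_{\sigma,\mathsf d}([0,T];X)$ with $u(0)=u_0$ such that, for every $t\in[0,T]$, $\overline U_{\tau(k)}(t)\to u(t)$ in $\sigma$ and $\mathcal E(t,\overline U_{\tau(k)}(t))\to\mathcal E(t,u(t))$, and $u$ is a Visco-Energetic solution. (ii) In particular there exists a Visco-Energetic solution $u\in BV_{\sigma,\mathsf d}([0,T];X)$ with $u(0)=u_0$. -/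

import Mathlib

open Set Filter Topology MeasureTheory
open scoped ENNReal NNReal

noncomputable section

/-! ### Curves with values in a space with an asymmetric quasi-distance -/

/-- Pointwise total variation of `u` on `E` with respect to an asymmetric quasi-distance `d`:
the supremum of the sums `∑ d (u (t j)) (u (t (j+1)))` over finite ordered families of points of `E`
(repeated points contribute `d x x = 0`; the variation on the empty set is `0`). -/
def pointwiseVar {X : Type*} (d : X → X → ℝ≥0∞) (u : ℝ → X) (E : Set ℝ) : ℝ≥0∞ :=
  ⨆ p : ℕ × {t : ℕ → ℝ // Monotone t ∧ ∀ i, t i ∈ E},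
    ∑ j ∈ Finset.range p.1, d (u (p.2.1 j)) (u (p.2.1 (j + 1)))

open Classical in
/-- The left limit `u(t-)` of a curve defined on an interval with left end point `a`, with the
convention `u(a-) = u(a)`. (The value is `u t` as well if there is no left limit; this does not
occur for regulated curves.) -/
def leftLimit {X : Type*} [TopologicalSpace X] (a : ℝ) (u : ℝ → X) (t : ℝ) : X :=
  if h : a < t ∧ ∃ y, Tendsto u (𝓝[<] t) (𝓝 y) then h.2.choose else u t

open Classical in
/-- The right limit `u(t+)` of a curve defined on an interval with right end point `b`, with the
convention `u(b+) = u(b)`. -/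
def rightLimit {X : Type*} [TopologicalSpace X] (b : ℝ) (u : ℝ → X) (t : ℝ) : X :=
  if h : t < b ∧ ∃ y, Tendsto u (𝓝[>] t) (𝓝 y) then h.2.choose else u t

/-- `(σ, d)`-regulated curves on `[a, b]`; `σ` is the topology of `X`. Only the values of `u` on
`[a, b]` matter. -/
structure IsRegulated {X : Type*} [TopologicalSpace X] (d : X → X → ℝ≥0∞) (a b : ℝ)
    (u : ℝ → X) : Prop where
  tendsto_left : ∀ t ∈ Ioc a b, Tendsto u (𝓝[<] t) (𝓝 (leftLimit a u t))
  dist_left : ∀ t ∈ Ioc a b, Tendsto (fun s => d (u s) (leftLimit a u t)) (𝓝[<] t) (𝓝 0)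
  tendsto_right : ∀ t ∈ Ico a b, Tendsto u (𝓝[>] t) (𝓝 (rightLimit b u t))
  dist_right : ∀ t ∈ Ico a b, Tendsto (fun s => d (rightLimit b u t) (u s)) (𝓝[>] t) (𝓝 0)
  eq_left : ∀ t ∈ Icc a b, d (leftLimit a u t) (u t) = 0 → leftLimit a u t = u t
  eq_right : ∀ t ∈ Icc a b, d (u t) (rightLimit b u t) = 0 → u t = rightLimit b u t

/-- The space `BV_{σ,d}([a,b]; X)` of regulated curves with finite `d`-variation. -/
def IsRegulatedBV {X : Type*} [TopologicalSpace X] (d : X → X → ℝ≥0∞) (a b : ℝ)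
    (u : ℝ → X) : Prop :=
  IsRegulated d a b u ∧ pointwiseVar d u (Icc a b) ≠ ⊤

/-- The jump set of a curve on `[a, b]`. -/
def jumpSet {X : Type*} [TopologicalSpace X] (a b : ℝ) (u : ℝ → X) : Set ℝ :=
  {t | t ∈ Icc a b ∧ (leftLimit a u t ≠ u t ∨ u t ≠ rightLimit b u t)}

/-- The incremental jump variation of `u` on `[a, b]` induced by `Δ = e - d`, where the cost
`e t x y` is at least `d x y`. The one-sided limits are those of the restriction of `u` to `[a, b]`;
on a degenerate interval `[a, a]` both are `u a`. -/
def jumpVar {X : Type*} [TopologicalSpace X] (d : X → X → ℝ≥0∞) (e : ℝ → X → X → ℝ≥0∞)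
    (u : ℝ → X) (a b : ℝ) : ℝ≥0∞ :=
  (e a (u a) (rightLimit b u a) - d (u a) (rightLimit b u a))
    + (e b (leftLimit a u b) (u b) - d (leftLimit a u b) (u b))
    + ∑' t : ↥(jumpSet a b u ∩ Ioo a b),
        ((e t (leftLimit a u t) (u t) - d (leftLimit a u t) (u t))
          + (e t (u t) (rightLimit b u t) - d (u t) (rightLimit b u t)))

/-- The augmented total variation `mVar_{d,e}(u, [a, b])`. -/
def augmentedVar {X : Type*} [TopologicalSpace X] (d : X → X → ℝ≥0∞) (e : ℝ → X → X → ℝ≥0∞)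
    (u : ℝ → X) (a b : ℝ) : ℝ≥0∞ :=
  pointwiseVar d u (Icc a b) + jumpVar d e u a b

/-! ### Rate-independent systems with a viscous correction -/

/-- The data `(X, ℰ, d, δ)` on a time interval `[0, T]`, with the power `𝒫`, a reference point and
the constant `F_o` of the perturbed energy. The maps `energy` and `power` are only used for times
in `[0, T]`. -/
structure RateIndependentSystem (X : Type*) [TopologicalSpace X] where
  T : ℝ
  T_pos : 0 < T
  xo : X
  Fo : ℝ
  Fo_nonneg : 0 ≤ Fo
  d : X → X → ℝ≥0∞
  d_lsc : LowerSemicontinuous (fun p : X × X => d p.1 p.2)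
  d_self : ∀ x, d x x = 0
  d_finite : ∀ x, d xo x ≠ ⊤
  d_triangle : ∀ x y z, d x z ≤ d x y + d y z
  energy : ℝ → X → ℝ
  power : ℝ → X → ℝ
  δ : X → X → ℝ≥0∞
  δ_lsc : LowerSemicontinuous (fun p : X × X => δ p.1 p.2)
  δ_self : ∀ x, δ x x = 0

namespace RateIndependentSystem

variable {X : Type*} [TopologicalSpace X] (S : RateIndependentSystem X)

/-- The modified dissipation `D = d + δ`. -/
def D (x y : X) : ℝ≥0∞ := S.d x y + S.δ x y

/-- The perturbed energy `ℱ(t, x) = ℰ(t, x) + d(x_o, x) + F_o`. -/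
def F (t : ℝ) (x : X) : ℝ := S.energy t x + (S.d S.xo x).toReal + S.Fo

/-- The sublevels of `ℱ` in `[0, T] × X`. -/
def sublevel (C : ℝ) : Set (ℝ × X) := {p | p.1 ∈ Icc 0 S.T ∧ S.F p.1 p.2 ≤ C}

/-- `(t, x)` is a `(D, Q)`-quasi-stable point. -/
def QuasiStable (Q : ℝ≥0) (t : ℝ) (x : X) : Prop :=
  ∀ y, (S.energy t x : EReal) ≤ (S.energy t y : EReal) + (S.D x y : EReal) + ((Q : ℝ) : EReal)

/-- `(t, x)` is `D`-stable. -/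
def Stable (t : ℝ) (x : X) : Prop :=
  ∀ y, (S.energy t x : EReal) ≤ (S.energy t y : EReal) + (S.D x y : EReal)

/-- The residual stability function `ℛ(t, x) = sup_y (ℰ(t, x) - ℰ(t, y) - D(x, y))`. The supremum is
nonnegative (take `y = x`), so every term may be replaced by its positive part, which is the
truncated difference in `[0, ∞]`. -/
def residual (t : ℝ) (x : X) : ℝ≥0∞ :=
  ⨆ y, (ENNReal.ofReal (S.energy t x - S.energy t y) - S.D x y)

/-! ### The assumptions -/

/-- Energy and power. The one-sided difference quotients are taken within `[0, T]`, so that the left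
(right) condition is void at `t = 0` (at `t = T`). -/
structure AssumptionA : Prop where
  sublevel_compact : ∀ C : ℝ, IsSeqCompact (S.sublevel C)
  energy_lsc : ∀ C : ℝ,
    LowerSemicontinuousOn (fun p : ℝ × X => S.energy p.1 p.2) (S.sublevel C)
  power_usc : ∀ C : ℝ,
    UpperSemicontinuousOn (fun p : ℝ × X => S.power p.1 p.2) (S.sublevel C)
  power_left : ∀ t ∈ Icc 0 S.T, ∀ x,
    (S.power t x : EReal) ≤
      liminf (fun s => (((S.energy t x - S.energy s x) / (t - s) : ℝ) : EReal)) (𝓝[Ico 0 t] t)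
  power_right : ∀ t ∈ Icc 0 S.T, ∀ x,
    limsup (fun s => (((S.energy s x - S.energy t x) / (s - t) : ℝ) : EReal)) (𝓝[Ioc t S.T] t)
      ≤ (S.power t x : EReal)
  power_bound : ∃ C_P : ℝ, 0 < C_P ∧
    ∀ t ∈ Icc 0 S.T, ∀ x, |S.power t x| ≤ C_P * S.F t x

/-- Admissible viscous corrections. -/
structure AssumptionB : Prop where
  compat_right : ∀ x y z, S.d x y = 0 → S.δ z y ≤ S.δ z x
  compat_left : ∀ x y z, S.d x y = 0 → S.δ x z ≤ S.δ y z
  left_continuous : ∀ (x : ℕ → X) (x' : X), (∃ C : ℝ, ∀ n, S.F 0 (x n) ≤ C) →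
    Tendsto x atTop (𝓝 x') → Tendsto (fun n => S.d (x n) x') atTop (𝓝 0) →
    Tendsto (fun n => S.δ (x n) x') atTop (𝓝 0)
  local_stable : ∀ t ∈ Icc 0 S.T, ∀ x, S.Stable t x → ∀ M : ℝ, 1 < M →
    ∃ η : ℝ, 0 < η ∧ ∃ U ∈ 𝓝 x, ∀ s ∈ Icc 0 S.T, t - η < s → s ≤ t →
      ∀ y ∈ U, S.Stable s y → S.d y x ≤ ENNReal.ofReal η →
        S.energy s y ≤ S.energy s x + M * (S.d y x).toReal

/-- Closure of the quasi-stable sets, and separation of the stable set. -/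
structure AssumptionC : Prop where
  closed_quasiStable : ∀ (Q : ℝ≥0) (C : ℝ),
    IsClosed {p : ℝ × X | p ∈ S.sublevel C ∧ S.QuasiStable Q p.1 p.2}
  separated : ∀ t ∈ Icc 0 S.T, ∀ x y, S.Stable t x → S.Stable t y → S.d x y = 0 → x = y

/-! ### Transitions and the jump dissipation cost -/

/-- The bounded connected components `(a, b)` of the complement of a compact set `K ⊆ ℝ`, each given
by the pair of its end points. -/
def holes (K : Set ℝ) : Set (ℝ × ℝ) :=
  {I | I.1 ∈ K ∧ I.2 ∈ K ∧ I.1 < I.2 ∧ Disjoint (Ioo I.1 I.2) K}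

/-- `ϑ` belongs to `C_{σ,d}(K; X)`, for a nonempty compact set `K ⊆ ℝ`, it connects `x` to `y`, and
the energy at time `t` is bounded along it. -/
structure IsTransition (t : ℝ) (K : Set ℝ) (ϑ : ℝ → X) (x y : X) : Prop where
  compact : IsCompact K
  nonempty : K.Nonempty
  continuousOn : ContinuousOn ϑ K
  dist_continuous : ∀ ε : ℝ, 0 < ε → ∃ η : ℝ, 0 < η ∧
    ∀ s₀ ∈ K, ∀ s₁ ∈ K, s₀ ≤ s₁ → s₁ ≤ s₀ + η → S.d (ϑ s₀) (ϑ s₁) ≤ ENNReal.ofReal ε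
  left_end : ϑ (sInf K) = x
  right_end : ϑ (sSup K) = y
  energy_bdd : BddAbove ((fun s => S.energy t (ϑ s)) '' K)

/-- The transition cost: variation, plus the correction `δ` across the holes, plus the residual
stability summed over all the points of `K` except its maximum. -/
def transitionCost (t : ℝ) (K : Set ℝ) (ϑ : ℝ → X) : ℝ≥0∞ :=
  pointwiseVar S.d ϑ K + ∑' I : ↥(holes K), S.δ (ϑ I.1.1) (ϑ I.1.2)
    + ⨆ (P : Finset ℝ) (_ : (P : Set ℝ) ⊆ K \ {sSup K}), ∑ s ∈ P, S.residual t (ϑ s)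

/-- The visco-energetic jump dissipation cost `c(t, x, y)`. -/
def jumpCost (t : ℝ) (x y : X) : ℝ≥0∞ :=
  ⨅ (K : Set ℝ) (ϑ : ℝ → X) (_ : S.IsTransition t K ϑ x y), S.transitionCost t K ϑ

/-- Visco-Energetic solutions on `[0, T]`. -/
structure IsViscoEnergetic (u : ℝ → X) : Prop where
  regulated : IsRegulated S.d 0 S.T u
  stable : ∀ t ∈ Icc 0 S.T, t ∉ jumpSet 0 S.T u → S.Stable t (u t)
  var_finite : ∀ t ∈ Icc 0 S.T, augmentedVar S.d S.jumpCost u 0 t ≠ ⊤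
  power_integrable : IntervalIntegrable (fun s => S.power s (u s)) volume 0 S.T
  balance : ∀ t ∈ Icc 0 S.T,
    S.energy t (u t) + (augmentedVar S.d S.jumpCost u 0 t).toReal
      = S.energy 0 (u 0) + ∫ s in (0 : ℝ)..t, S.power s (u s)

end RateIndependentSystem

/-! ### The viscous incremental minimization scheme -/

/-- A partition `0 = t 0 < t 1 < ⋯ < t N = T`; the values `t n` for `n > N` play no role. -/
structure TimePartition (T : ℝ) where
  N : ℕ
  t : ℕ → ℝ
  t_zero : t 0 = 0
  t_last : t N = T
  t_lt : ∀ n < N, t n < t (n + 1)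

/-- The mesh of a partition. -/
def TimePartition.mesh {T : ℝ} (τ : TimePartition T) : ℝ :=
  ⨆ n : Fin τ.N, (τ.t (n + 1) - τ.t n)

/-- The left-continuous piecewise constant interpolant of the values `U 0, …, U N`: it equals `U 0`
at time `0` and `U n` on `(t (n-1), t n]`. -/
def TimePartition.interpolant {T : ℝ} (τ : TimePartition T) {X : Type*} (U : ℕ → X) (t : ℝ) : X :=
  U (sInf {n : ℕ | t ≤ τ.t n})

/-- `U 1, …, U N` solve the viscous incremental minimization scheme starting from `U 0`. -/
def RateIndependentSystem.IsDiscreteSolution {X : Type*} [TopologicalSpace X]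
    (S : RateIndependentSystem X) (τ : TimePartition S.T) (U : ℕ → X) : Prop :=
  ∀ n < τ.N, ∀ V : X,
    (S.D (U n) (U (n + 1)) : EReal) + (S.energy (τ.t (n + 1)) (U (n + 1)) : EReal)
      ≤ (S.D (U n) V : EReal) + (S.energy (τ.t (n + 1)) V : EReal)

end

/-!
Convergence of the viscous incremental minimization scheme to Visco-Energetic solutions.

Every step of the scheme satisfies
`D (U n) (U (n+1)) + ℛ (t (n+1), U n) ≤ e n := ℰ (t (n+1), U n) - ℰ (t (n+1), U (n+1))`
(`cost_le_of_minimizer`), and the sum of the `e n` is bounded by Gronwall's inequality. The discrete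
evolution is therefore reparametrized by an arclength whose increments dominate those of time and
the dissipated energies of the steps on both sides of each state; this is a `Chain`. The point of
this choice is that the residual instability of a state is at most its arclength distance to any
other state. Hence in the limit, states at accumulation points of the set of parameters are stable,
and by the separation of stable states limits are unique: a countable diagonal argument over
rational parameters gives convergence for all parameters (`exists_chainsTendsto`), without any
equicontinuity in the topology of `X`. The limit is an `IsProfile`: a compact set `K` of parameters,
a continuous state `ϑ`, the time `Θ` and the accumulated dissipation `G`, which dominates `d + ℛ`
along `K` and `D + ℛ` across the holes of `K`. Thus the fibres of `Θ` are transitions in the sense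
of the jump cost, of cost at most the increment of `G` (`IsProfile.jumpCost_le`).

The parameters of the interpolants at time `t` converge along a further subsequence to `α t` for all
`t`, since `Θ` has only countably many plateaus (`ChainsTendsto.exists_subseq_time`), and the limit
curve is `u = ϑ ∘ α`. Its one-sided limits are the stable states `ϑ (α (t±))`, and its augmented
variation on `[0, t]` is at most `G (α t)` (`IsClock.augmentedVar_le`). The energy balance follows
from two estimates: `ℰ (t, u t) + G (α t) ≤ ℰ (0, u 0) + ∫ 𝒫`, from the discrete energy identity by
lower semicontinuity and Fatou's lemma (`SchemeTendsto.eventually_energy_add_dissipated_le`), and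
`ℰ (0, u 0) + ∫ 𝒫 ≤ ℰ (t, u t) + Var_{d,c} (u, [0, t])` (`IsClock.energy_add_integral_le`). The
latter, like the bound of the jump cost from below by the energy drop
(`ofReal_energy_sub_le_jumpCost`), is a continuous induction along a compact set of reals
(`le_of_forall_exists_lt_le`), where the local stability condition compares stable states that
accumulate from the left. The estimates force all inequalities to be equalities, which also gives
the convergence of the energies and shows that the curve does not jump at distance zero.
-/

/-! ### Order, compactness and semicontinuity -/

/-- Continuous induction, from right to left, along a compact set of reals: the infimum of the
points where `φ` lies below `φ b` can only be the minimum of the set. -/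
theorem le_of_forall_exists_lt_le {K : Set ℝ} (hK : IsCompact K) {φ : ℝ → ℝ} {a b : ℝ}
    (ha : IsLeast K a) (hb : b ∈ K)
    (h₁ : ∀ s ∈ K, ∀ ε : ℝ, 0 < ε → ∀ᶠ r in 𝓝[K ∩ Ioi s] s, φ s ≤ φ r + ε)
    (h₂ : ∀ r ∈ K, a < r → ∃ s ∈ K, s < r ∧ φ s ≤ φ r) : φ a ≤ φ b := by
  set B : Set ℝ := {s | s ∈ K ∧ φ s ≤ φ b} with hB
  have hBK : B ⊆ K := fun s hs => hs.1
  have hBne : B.Nonempty := ⟨b, hb, le_rfl⟩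
  have hBbdd : BddBelow B := ⟨a, fun s hs => ha.2 hs.1⟩
  have hcl : sInf B ∈ closure B := csInf_mem_closure hBne hBbdd
  have hAK : sInf B ∈ K := hK.isClosed.closure_subset_iff.2 hBK hcl
  have hAB : φ (sInf B) ≤ φ b := by
    by_contra hcon
    have hnot : sInf B ∉ B := fun h => hcon h.2
    have hsub : B ⊆ K ∩ Ioi (sInf B) := fun s hs =>
      ⟨hs.1, lt_of_le_of_ne (csInf_le hBbdd hs) (fun h => hnot (h ▸ hs))⟩
    have : (𝓝[B] (sInf B)).NeBot := mem_closure_iff_nhdsWithin_neBot.1 hcl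
    refine hcon (le_of_forall_pos_le_add fun ε hε => ?_)
    obtain ⟨r, hr, hrB⟩ := (((h₁ _ hAK ε hε).filter_mono (nhdsWithin_mono _ hsub)).and
      self_mem_nhdsWithin).exists
    have := hrB.2
    linarith
  rcases (ha.2 hAK).eq_or_lt with h | h
  · rwa [h]
  · obtain ⟨s, hsK, hs, hle⟩ := h₂ _ hAK h
    exact absurd (csInf_le hBbdd ⟨hsK, hle.trans hAB⟩) (not_le.2 hs)

theorem IsSeqCompact.prod {Y Z : Type*} [TopologicalSpace Y] [TopologicalSpace Z] {s : Set Y}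
    {t : Set Z} (hs : IsSeqCompact s) (ht : IsSeqCompact t) : IsSeqCompact (s ×ˢ t) := by
  intro x hx
  obtain ⟨a, ha, φ, hφ, hφa⟩ := hs (fun n => (hx n).1)
  obtain ⟨b, hb, ψ, hψ, hψb⟩ := ht (fun n => (hx (φ n)).2)
  exact ⟨(a, b), ⟨ha, hb⟩, φ ∘ ψ, hφ.comp hψ,
    (hφa.comp hψ.tendsto_atTop).prodMk_nhds hψb⟩

/-- Cantor's diagonal argument: countably many sequences in a sequentially compact set converge
along a common subsequence. -/
theorem IsSeqCompact.exists_subseq_forall {ι Y : Type*} [Countable ι] [TopologicalSpace Y]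
    {s : Set Y} (hs : IsSeqCompact s) (y : ι → ℕ → Y) (hy : ∀ i k, y i k ∈ s) :
    ∃ φ : ℕ → ℕ, StrictMono φ ∧ ∀ i, ∃ l ∈ s, Tendsto (fun k => y i (φ k)) atTop (𝓝 l) := by
  rcases isEmpty_or_nonempty ι with hι | hι
  · exact ⟨id, strictMono_id, fun i => (hι.false i).elim⟩
  obtain ⟨e, he⟩ := exists_surjective_nat ι
  have step : ∀ (n : ℕ) (φ : ℕ → ℕ), ∃ ψ : ℕ → ℕ, StrictMono ψ ∧
      ∃ l ∈ s, Tendsto (fun k => y (e n) (φ (ψ k))) atTop (𝓝 l) := fun n φ => by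
    obtain ⟨l, hl, ψ, hψ, h⟩ := hs (fun k => hy (e n) (φ k))
    exact ⟨ψ, hψ, l, hl, h⟩
  choose ψ hψ hlim using step
  let Φ : ℕ → ℕ → ℕ := fun n => Nat.rec (ψ 0 id) (fun n φ => φ ∘ ψ (n + 1) φ) n
  have hΦs : ∀ n, Φ (n + 1) = Φ n ∘ ψ (n + 1) (Φ n) := fun n => rfl
  have hΦm : ∀ n, StrictMono (Φ n) := fun n => by
    induction n with
    | zero => exact hψ 0 id
    | succ n ih => rw [hΦs]; exact ih.comp (hψ _ _)
  have hΦl : ∀ n, ∃ l ∈ s, Tendsto (fun k => y (e n) (Φ n k)) atTop (𝓝 l) := fun n => by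
    cases n with
    | zero => exact hlim 0 id
    | succ n => exact hlim (n + 1) (Φ n)
  have hsub : ∀ n m, n ≤ m → ∃ g : ℕ → ℕ, StrictMono g ∧ Φ m = Φ n ∘ g := fun n m h => by
    induction m, h using Nat.le_induction with
    | base => exact ⟨id, strictMono_id, rfl⟩
    | succ m _ ih =>
      obtain ⟨g, hg, hgm⟩ := ih
      exact ⟨g ∘ ψ (m + 1) (Φ m), hg.comp (hψ _ _), by rw [hΦs, hgm]; rfl⟩
  refine ⟨fun n => Φ n n, strictMono_nat_of_lt_succ fun n => ?_, fun i => ?_⟩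
  · rw [hΦs]
    exact hΦm n (lt_of_lt_of_le n.lt_succ_self ((hψ _ _).le_apply))
  · obtain ⟨n, rfl⟩ := he i
    obtain ⟨l, hl, h⟩ := hΦl n
    refine ⟨l, hl, ?_⟩
    have hg : ∀ m, ∃ q, n ≤ m → m ≤ q ∧ Φ m m = Φ n q := fun m => by
      by_cases hm : n ≤ m
      · obtain ⟨g, hg, hgm⟩ := hsub n m hm
        exact ⟨g m, fun _ => ⟨hg.le_apply, by rw [hgm]; rfl⟩⟩
      · exact ⟨0, fun h => absurd h hm⟩
    choose q hq using hg
    have hqt : Tendsto q atTop atTop :=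
      tendsto_atTop_mono' _ ((eventually_ge_atTop n).mono fun m hm => (hq m hm).1) tendsto_id
    refine (h.comp hqt).congr' ((eventually_ge_atTop n).mono fun m hm => ?_)
    simp only [Function.comp_apply, (hq m hm).2]

/-- A sequence in a sequentially compact set converges to `l` as soon as `l` is the only possible
limit of its subsequences. -/
theorem IsSeqCompact.tendsto_of_unique {Y : Type*} [TopologicalSpace Y] {s : Set Y}
    (hs : IsSeqCompact s) {y : ℕ → Y} (hy : ∀ᶠ k in atTop, y k ∈ s) {l : Y}
    (h : ∀ ψ : ℕ → ℕ, StrictMono ψ → ∀ z, Tendsto (y ∘ ψ) atTop (𝓝 z) → z = l) :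
    Tendsto y atTop (𝓝 l) := by
  refine tendsto_of_subseq_tendsto fun ns hns => ?_
  obtain ⟨φ, hφ, hφ'⟩ := strictMono_subseq_of_tendsto_atTop hns
  obtain ⟨m, hm⟩ := (hφ'.tendsto_atTop.eventually hy).exists_forall_of_atTop
  obtain ⟨z, -, χ, hχ, hz⟩ := hs (x := fun n => y (ns (φ (n + m)))) (fun n => hm _ (by omega))
  have hadd : StrictMono fun n => n + m := fun a b h => by simpa using h
  have := h _ (hφ'.comp (hadd.comp hχ)) z hz
  subst this
  exact ⟨fun n => φ (χ n + m), hz⟩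

theorem LowerSemicontinuousWithinAt.le_of_tendsto_of_le {ι Y β : Type*} [TopologicalSpace Y]
    [LinearOrder β] [TopologicalSpace β] [OrderTopology β] [DenselyOrdered β] {l : Filter ι}
    [l.NeBot] {f : Y → β} {s : Set Y} {y : Y} (hf : LowerSemicontinuousWithinAt f s y)
    {p : ι → Y} (hp : Tendsto p l (𝓝 y)) (hps : ∀ᶠ i in l, p i ∈ s) {g : ι → β} {c : β}
    (hg : Tendsto g l (𝓝 c)) (h : ∀ᶠ i in l, f (p i) ≤ g i) : f y ≤ c := by
  by_contra! hcon
  obtain ⟨m, hm₁, hm₂⟩ := exists_between hcon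
  have hp' : Tendsto p l (𝓝[s] y) := tendsto_nhdsWithin_iff.2 ⟨hp, hps⟩
  obtain ⟨i, h1, h2, h3⟩ := ((hp'.eventually (hf m hm₂)).and
    ((hg.eventually (gt_mem_nhds hm₁)).and h)).exists
  exact absurd (h1.trans_le h3) (not_lt.2 h2.le)

theorem LowerSemicontinuous.le_of_tendsto_of_le {ι Y β : Type*} [TopologicalSpace Y]
    [LinearOrder β] [TopologicalSpace β] [OrderTopology β] [DenselyOrdered β] {l : Filter ι}
    [l.NeBot] {f : Y → β} {y : Y} (hf : LowerSemicontinuous f)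
    {p : ι → Y} (hp : Tendsto p l (𝓝 y)) {g : ι → β} {c : β}
    (hg : Tendsto g l (𝓝 c)) (h : ∀ᶠ i in l, f (p i) ≤ g i) : f y ≤ c :=
  LowerSemicontinuousWithinAt.le_of_tendsto_of_le (hf.lowerSemicontinuousWithinAt univ y) hp
    (Eventually.of_forall fun _ => mem_univ _) hg h

/-! ### The pointwise variation -/

section Variation

variable {X : Type*} {d : X → X → ℝ≥0∞} {u : ℝ → X}

theorem sum_le_pointwiseVar {E : Set ℝ} {t : ℕ → ℝ} (ht : Monotone t) (hE : ∀ i, t i ∈ E) (n : ℕ) :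
    ∑ j ∈ Finset.range n, d (u (t j)) (u (t (j + 1))) ≤ pointwiseVar d u E :=
  le_iSup (fun p : ℕ × {t : ℕ → ℝ // Monotone t ∧ ∀ i, t i ∈ E} =>
    ∑ j ∈ Finset.range p.1, d (u (p.2.1 j)) (u (p.2.1 (j + 1)))) (n, ⟨t, ht, hE⟩)

theorem le_pointwiseVar {E : Set ℝ} {s r : ℝ} (hs : s ∈ E) (hr : r ∈ E) (hsr : s ≤ r) :
    d (u s) (u r) ≤ pointwiseVar d u E := by
  have := sum_le_pointwiseVar (d := d) (u := u) (E := E) (t := fun n => if n = 0 then s else r)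
    (monotone_nat_of_le_succ fun n => by by_cases h : n = 0 <;> simp [h, hsr])
    (fun i => by by_cases h : i = 0 <;> simp [h, hs, hr]) 1
  simpa using this

theorem pointwiseVar_mono {E E₁ : Set ℝ} (h : E₁ ⊆ E) :
    pointwiseVar d u E₁ ≤ pointwiseVar d u E :=
  iSup_le fun p => sum_le_pointwiseVar p.2.2.1 (fun i => h (p.2.2.2 i)) p.1

/-- The variation is superadditive on consecutive sets. -/
theorem pointwiseVar_add_le {E E₁ E₂ : Set ℝ} (h₁ : E₁ ⊆ E) (h₂ : E₂ ⊆ E)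
    (h : ∀ s ∈ E₁, ∀ r ∈ E₂, s ≤ r) :
    pointwiseVar d u E₁ + pointwiseVar d u E₂ ≤ pointwiseVar d u E := by
  rcases isEmpty_or_nonempty (ℕ × {t : ℕ → ℝ // Monotone t ∧ ∀ i, t i ∈ E₁}) with e₁ | e₁
  · exact (add_le_of_nonpos_left (@iSup_of_empty _ _ _ e₁ _).le).trans (pointwiseVar_mono h₂)
  rcases isEmpty_or_nonempty (ℕ × {t : ℕ → ℝ // Monotone t ∧ ∀ i, t i ∈ E₂}) with e₂ | e₂
  · exact (add_le_of_nonpos_right (@iSup_of_empty _ _ _ e₂ _).le).trans (pointwiseVar_mono h₁)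
  refine ENNReal.iSup_add_iSup_le fun p q => ?_
  obtain ⟨n, t, ht, htE⟩ := p
  obtain ⟨m, r, hr, hrE⟩ := q
  let w : ℕ → ℝ := fun i => if i ≤ n then t i else r (i - (n + 1))
  have hw : Monotone w := fun i j hij => by
    by_cases hj : j ≤ n
    · simpa [w, hj, hij.trans hj] using ht hij
    · by_cases hi : i ≤ n
      · simpa [w, hi, hj] using h _ (htE _) _ (hrE _)
      · simpa [w, hi, hj] using hr (by omega)
  have hwE : ∀ i, w i ∈ E := fun i => by
    by_cases hi : i ≤ n
    · simpa [w, hi] using h₁ (htE _)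
    · simpa [w, hi] using h₂ (hrE _)
  refine le_trans ?_ (sum_le_pointwiseVar hw hwE (n + 1 + m))
  rw [Finset.sum_range_add, Finset.sum_range_succ]
  refine add_le_add (le_add_right (Finset.sum_le_sum fun j hj => ?_))
    (Finset.sum_le_sum fun j _ => ?_)
  · have := Finset.mem_range.1 hj
    simp [w, this.le, Nat.succ_le_of_lt this]
  · have e1 : w (n + 1 + j) = r j := by
      have : ¬ (n + 1 + j ≤ n) := by omega
      simp only [w, this, if_false]; congr 1; omega
    have e2 : w (n + 1 + j + 1) = r (j + 1) := by
      have : ¬ (n + 1 + j + 1 ≤ n) := by omega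
      simp only [w, this, if_false]; congr 1; omega
    rw [e1, e2]

end Variation

namespace RateIndependentSystem

variable {X : Type*} [TopologicalSpace X] {S : RateIndependentSystem X}

/-! ### Energy and power -/

theorem F_nonneg (hA : S.AssumptionA) {t : ℝ} (ht : t ∈ Icc 0 S.T) (x : X) : 0 ≤ S.F t x := by
  obtain ⟨c, hc, h⟩ := hA.power_bound
  exact nonneg_of_mul_nonneg_right ((abs_nonneg _).trans (h t ht x)) hc

theorem energy_le_F (t : ℝ) (x : X) : S.energy t x ≤ S.F t x := by
  have := S.Fo_nonneg
  have : 0 ≤ (S.d S.xo x).toReal := ENNReal.toReal_nonneg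
  unfold F; linarith

theorem eventually_energy_sub_le (hA : S.AssumptionA) {t : ℝ} (ht : t ∈ Icc 0 S.T) {x : X} {c : ℝ}
    (hc : S.power t x < c) :
    ∀ᶠ s in 𝓝[Ioc t S.T] t, S.energy s x - S.energy t x ≤ c * (s - t) := by
  have h := eventually_lt_of_limsup_lt
    ((hA.power_right t ht x).trans_lt (EReal.coe_lt_coe_iff.2 hc))
  filter_upwards [h, self_mem_nhdsWithin] with s hs hst
  exact ((div_lt_iff₀ (sub_pos.2 hst.1)).1 (EReal.coe_lt_coe_iff.1 hs)).le

theorem eventually_le_energy_sub (hA : S.AssumptionA) {t : ℝ} (ht : t ∈ Icc 0 S.T) {x : X} {c : ℝ}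
    (hc : c < S.power t x) :
    ∀ᶠ s in 𝓝[Ico 0 t] t, c * (t - s) ≤ S.energy t x - S.energy s x := by
  have h := eventually_lt_of_lt_liminf ((EReal.coe_lt_coe_iff.2 hc).trans_le (hA.power_left t ht x))
  filter_upwards [h, self_mem_nhdsWithin] with s hs hst
  exact ((lt_div_iff₀ (sub_pos.2 hst.2)).1 (EReal.coe_lt_coe_iff.1 hs)).le

theorem Icc_subset_Ico_union (a t b : ℝ) : Icc a b ⊆ Ico a t ∪ {t} ∪ Ioc t b := fun s hs => by
  rcases lt_trichotomy s t with h | h | h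
  · exact Or.inl (Or.inl ⟨hs.1, h⟩)
  · exact Or.inl (Or.inr h)
  · exact Or.inr ⟨h, hs.2⟩

theorem continuousOn_energy (hA : S.AssumptionA) (x : X) :
    ContinuousOn (fun s => S.energy s x) (Icc 0 S.T) := by
  intro t ht
  set c := |S.power t x| + 1
  have hub : ∀ᶠ s in 𝓝[Icc 0 S.T] t, S.energy s x ≤ S.energy t x + c * |s - t| := by
    refine Filter.Eventually.filter_mono (nhdsWithin_mono _ (Icc_subset_Ico_union 0 t S.T)) ?_
    rw [nhdsWithin_union, nhdsWithin_union, eventually_sup, eventually_sup]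
    refine ⟨⟨?_, ?_⟩, ?_⟩
    · have h : -c < S.power t x := by have := neg_abs_le (S.power t x); simp only [c]; linarith
      filter_upwards [eventually_le_energy_sub hA ht h, self_mem_nhdsWithin] with s hs hst
      rw [abs_of_neg (sub_neg.2 hst.2)]; linarith
    · simp [nhdsWithin_singleton]
    · have h : S.power t x < c := by have := le_abs_self (S.power t x); simp only [c]; linarith
      filter_upwards [eventually_energy_sub_le hA ht h, self_mem_nhdsWithin] with s hs hst
      rw [abs_of_pos (sub_pos.2 hst.1)]; linarith
  have hlim : Tendsto (fun s => S.energy t x + c * |s - t|) (𝓝[Icc 0 S.T] t)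
      (𝓝 (S.energy t x)) := by
    have : Continuous fun s : ℝ => S.energy t x + c * |s - t| := by fun_prop
    simpa using (this.tendsto t).mono_left nhdsWithin_le_nhds
  have hmem : ∀ᶠ s in 𝓝[Icc 0 S.T] t, (s, x) ∈ S.sublevel (S.F t x + 1) := by
    filter_upwards [hub, hlim.eventually (gt_mem_nhds (lt_add_one _)), self_mem_nhdsWithin]
      with s h1 h2 h3
    exact ⟨h3, by unfold F; linarith⟩
  have htm : (t, x) ∈ S.sublevel (S.F t x + 1) := ⟨ht, by linarith⟩
  have hpair : Tendsto (fun s : ℝ => (s, x)) (𝓝[Icc 0 S.T] t)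
      (𝓝[S.sublevel (S.F t x + 1)] (t, x)) :=
    tendsto_nhdsWithin_iff.2 ⟨((Continuous.prodMk_left x).tendsto t).mono_left
      nhdsWithin_le_nhds, hmem⟩
  refine (tendsto_order.2 ⟨fun m hm => ?_, fun m hm => ?_⟩ :
    Tendsto (fun s => S.energy s x) (𝓝[Icc 0 S.T] t) (𝓝 (S.energy t x)))
  · exact hpair.eventually (hA.energy_lsc _ _ htm m hm)
  · filter_upwards [hub, hlim.eventually (gt_mem_nhds hm)] with s h1 h2
    exact h1.trans_lt h2

/-- Grönwall's inequality for the energy, forward and backward in time. -/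
theorem energy_add_le_gronwallBound (hA : S.AssumptionA) {x : X} {c K ε : ℝ}
    (h : ∀ r ∈ Icc 0 S.T, |S.power r x| ≤ K * (S.energy r x + c) + ε) {s t : ℝ}
    (hs : s ∈ Icc 0 S.T) (ht : t ∈ Icc 0 S.T) :
    S.energy t x + c ≤ gronwallBound (S.energy s x + c) K ε |t - s| := by
  have hcont := (continuousOn_energy hA x).add (continuousOn_const (c := c))
  have aux : ∀ z q m r' : ℝ, 0 < z - q → ∀ f1 f2 : ℝ, f1 - f2 ≤ m * (z - q) → m < r' →
      (z - q)⁻¹ * (f1 - f2) < r' := fun z q m r' hz f1 f2 h1 h2 => by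
    rw [inv_mul_lt_iff₀ hz]
    exact h1.trans_lt (by rw [mul_comm]; exact mul_lt_mul_of_pos_left h2 hz)
  rcases le_total s t with hst | hst
  · rw [abs_of_nonneg (sub_nonneg.2 hst)]
    refine le_gronwallBound_of_liminf_deriv_right_le (f := fun r => S.energy r x + c)
      (f' := fun r => K * (S.energy r x + c) + ε)
      (hcont.mono (Icc_subset_Icc hs.1 ht.2)) (fun q hq r hr => ?_) le_rfl (fun _ _ => le_rfl) t
      ⟨hst, le_rfl⟩
    have hq' : q ∈ Icc 0 S.T := ⟨hs.1.trans hq.1, hq.2.le.trans ht.2⟩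
    obtain ⟨m, hm1, hm2⟩ := exists_between
      (((le_abs_self _).trans (h q hq')).trans_lt hr)
    have := eventually_energy_sub_le hA hq' hm1
    rw [nhdsWithin_Ioc_eq_nhdsGT (hq.2.trans_le ht.2)] at this
    refine Eventually.frequently ?_
    filter_upwards [this, self_mem_nhdsWithin] with z hz hz'
    exact aux z q m r (sub_pos.2 hz') _ _ (by simpa using hz) hm2
  · rw [abs_of_nonpos (sub_nonpos.2 hst)]
    have key := le_gronwallBound_of_liminf_deriv_right_le (f := fun r => S.energy (-r) x + c)
      (f' := fun r => K * (S.energy (-r) x + c) + ε) (a := -s) (b := -t)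
      (δ := S.energy s x + c) (K := K) (ε := ε)
      (hcont.comp (f := fun r : ℝ => -r) (by fun_prop) fun r hr => ?_) (fun q hq r hr => ?_)
      (by simp) (fun _ _ => le_rfl) (-t) ⟨by linarith, le_rfl⟩
    · have e : -t - -s = -(t - s) := by ring
      simpa [e] using key
    · exact ⟨by linarith [hr.2, ht.1], by linarith [hr.1, hs.2]⟩
    · have hq' : -q ∈ Icc 0 S.T := ⟨by linarith [hq.2, ht.1], by linarith [hq.1, hs.2]⟩
      obtain ⟨m, hm1, hm2⟩ := exists_between
        (((neg_le_abs _).trans (h (-q) hq')).trans_lt hr)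
      have := eventually_le_energy_sub hA hq' (neg_lt.1 hm1)
      rw [nhdsWithin_Ico_eq_nhdsLT (by linarith [hq.2, ht.1])] at this
      have ht' : Tendsto (fun z : ℝ => -z) (𝓝[>] q) (𝓝[<] (-q)) :=
        tendsto_neg_nhdsGT
      refine Eventually.frequently ?_
      filter_upwards [ht'.eventually this, self_mem_nhdsWithin] with z hz hz'
      exact aux z q m r (sub_pos.2 hz') _ _ (by linarith) hm2

theorem exists_F_le_exp_mul (hA : S.AssumptionA) : ∃ c : ℝ, 0 < c ∧
    (∀ t ∈ Icc 0 S.T, ∀ x, |S.power t x| ≤ c * S.F t x) ∧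
    ∀ s ∈ Icc 0 S.T, ∀ t ∈ Icc 0 S.T, ∀ x, S.F t x ≤ Real.exp (c * |t - s|) * S.F s x := by
  obtain ⟨c, hc, h⟩ := hA.power_bound
  refine ⟨c, hc, h, fun s hs t ht x => ?_⟩
  have hF : ∀ r, S.F r x = S.energy r x + ((S.d S.xo x).toReal + S.Fo) := fun r => by
    unfold F; ring
  have := energy_add_le_gronwallBound hA (x := x) (c := (S.d S.xo x).toReal + S.Fo) (K := c)
    (ε := 0) (fun r hr => by rw [← hF, add_zero]; exact h r hr x) hs ht
  rwa [gronwallBound_ε0, ← hF, ← hF, mul_comm] at this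

theorem energy_sub_le (hA : S.AssumptionA) {x : X} {L : ℝ}
    (hL : ∀ r ∈ Icc 0 S.T, |S.power r x| ≤ L) {s t : ℝ} (hs : s ∈ Icc 0 S.T)
    (ht : t ∈ Icc 0 S.T) : S.energy t x - S.energy s x ≤ L * |t - s| := by
  have := energy_add_le_gronwallBound hA (x := x) (c := 0) (K := 0) (ε := L)
    (fun r hr => by simpa using hL r hr) hs ht
  rw [gronwallBound_K0] at this
  linarith

/-- Since `ℰ(·, x)` is Lipschitz, the two one-sided bounds on its difference quotients identify its
derivative almost everywhere with the power. -/
theorem energy_sub_eq_integral (hA : S.AssumptionA) {x : X} {L : ℝ}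
    (hL : ∀ r ∈ Icc 0 S.T, |S.power r x| ≤ L) {s t : ℝ} (hs : s ∈ Icc 0 S.T)
    (ht : t ∈ Icc 0 S.T) (hst : s ≤ t) :
    IntervalIntegrable (fun r => S.power r x) volume s t ∧
      ∫ r in s..t, S.power r x = S.energy t x - S.energy s x := by
  have hL0 : 0 ≤ L := (abs_nonneg _).trans (hL s hs)
  have hsub : uIcc s t ⊆ Icc 0 S.T := by
    rw [uIcc_of_le hst]; exact Icc_subset_Icc hs.1 ht.2
  have hlip : LipschitzOnWith L.toNNReal (fun r => S.energy r x) (uIcc s t) := by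
    refine LipschitzOnWith.of_dist_le_mul fun p hp q hq => ?_
    rw [Real.coe_toNNReal _ hL0, Real.dist_eq, Real.dist_eq, abs_le]
    have h1 := energy_sub_le hA hL (hsub hp) (hsub hq)
    have h2 := energy_sub_le hA hL (hsub hq) (hsub hp)
    rw [abs_sub_comm] at h1
    exact ⟨by linarith, h2⟩
  have hac := hlip.absolutelyContinuousOnInterval
  have hder : ∀ r ∈ Ioo s t, DifferentiableAt ℝ (fun r => S.energy r x) r →
      deriv (fun r => S.energy r x) r = S.power r x := by
    intro r hr hd
    have hr' : r ∈ Icc 0 S.T := ⟨hs.1.trans hr.1.le, hr.2.le.trans ht.2⟩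
    have hslope := hd.hasDerivAt.tendsto_slope
    have hr0 : 0 < r := hs.1.trans_lt hr.1
    have hrT : r < S.T := hr.2.trans_le ht.2
    refine le_antisymm (le_of_forall_gt fun c hc => ?_) (le_of_forall_lt fun c hc => ?_)
    · obtain ⟨m, hm1, hm2⟩ := exists_between hc
      refine lt_of_le_of_lt ?_ hm2
      have h1 := eventually_energy_sub_le hA hr' hm1
      rw [nhdsWithin_Ioc_eq_nhdsGT hrT] at h1
      have h2 : Tendsto (slope (fun r => S.energy r x) r) (𝓝[>] r)
          (𝓝 (deriv (fun r => S.energy r x) r)) :=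
        hslope.mono_left (nhdsWithin_mono _ fun z hz => ne_of_gt hz)
      refine le_of_tendsto h2 ?_
      filter_upwards [h1, self_mem_nhdsWithin] with z hz hz'
      rw [slope_def_field, div_le_iff₀ (sub_pos.2 hz')]
      exact hz
    · obtain ⟨m, hm1, hm2⟩ := exists_between hc
      refine lt_of_lt_of_le hm1 ?_
      have h1 := eventually_le_energy_sub hA hr' hm2
      rw [nhdsWithin_Ico_eq_nhdsLT hr0] at h1
      have h2 : Tendsto (slope (fun r => S.energy r x) r) (𝓝[<] r)
          (𝓝 (deriv (fun r => S.energy r x) r)) :=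
        hslope.mono_left (nhdsWithin_mono _ fun z hz => ne_of_lt hz)
      refine ge_of_tendsto h2 ?_
      filter_upwards [h1, self_mem_nhdsWithin] with z hz hz'
      rw [slope_comm, slope_def_field, le_div_iff₀ (sub_pos.2 hz')]
      exact hz
  have hae : ∀ᵐ r ∂volume.restrict (Ioo s t),
      deriv (fun r => S.energy r x) r = S.power r x := by
    rw [ae_restrict_iff' measurableSet_Ioo]
    filter_upwards [hac.ae_differentiableAt] with r hr hrm
    exact hder r hrm (hr (by rw [uIcc_of_le hst]; exact Ioo_subset_Icc_self hrm))
  have hae' : ∀ᵐ r ∂volume.restrict (Ioc s t),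
      deriv (fun r => S.energy r x) r = S.power r x := by
    rwa [← restrict_Ioo_eq_restrict_Ioc]
  have huI : Set.uIoc s t = Ioc s t := uIoc_of_le hst
  constructor
  · exact hac.intervalIntegrable_deriv.congr_ae (by rw [huI]; exact hae')
  · rw [← hac.integral_deriv_eq_sub]
    refine intervalIntegral.integral_congr_ae_restrict ?_
    rw [huI]
    filter_upwards [hae'] with r hr using hr.symm

/-! ### Sequential forms of the semicontinuity and compactness assumptions -/

theorem isClosed_sublevel (hC : S.AssumptionC) (hA : S.AssumptionA) (C : ℝ) :
    IsClosed (S.sublevel C) := by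
  convert hC.closed_quasiStable (Real.toNNReal C) C using 1
  ext ⟨t, x⟩
  refine ⟨fun h => ⟨h, fun y => ?_⟩, fun h => h.1⟩
  have hF := h.2
  have ht : t ∈ Icc 0 S.T := h.1
  have h0 := F_nonneg hA ht y
  simp only at hF ⊢
  by_cases hD : S.D x y = ⊤
  · rw [hD]; simp
  have hd : S.d x y ≠ ⊤ := fun h => hD (by simp [D, h])
  have hdD : (S.d x y).toReal ≤ (S.D x y).toReal := ENNReal.toReal_mono hD le_self_add
  have htri : (S.d S.xo y).toReal ≤ (S.d S.xo x).toReal + (S.d x y).toReal := by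
    rw [← ENNReal.toReal_add (S.d_finite x) hd]
    exact ENNReal.toReal_mono (ENNReal.add_ne_top.2 ⟨S.d_finite x, hd⟩) (S.d_triangle _ _ _)
  rw [Real.coe_toNNReal _ ((F_nonneg hA ht x).trans hF)]
  have hcoe : ((S.D x y : ℝ≥0∞) : EReal) = (((S.D x y).toReal : ℝ) : EReal) :=
    (EReal.coe_toReal (by simpa using hD) (by simp)).symm.trans (by simp)
  rw [hcoe]
  norm_cast
  unfold F at hF h0
  linarith

/-! ### Residual stability -/

theorem residual_le_iff_quasiStable {Q : ℝ≥0} {t : ℝ} {x : X} :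
    S.residual t x ≤ Q ↔ S.QuasiStable Q t x := by
  unfold residual QuasiStable
  rw [iSup_le_iff]
  refine forall_congr' fun y => ?_
  rw [tsub_le_iff_right]
  by_cases hD : S.D x y = ⊤
  · simp [hD]
  lift S.D x y to ℝ≥0 using hD with D
  rw [← ENNReal.coe_add, ENNReal.ofReal_le_iff_le_toReal ENNReal.coe_ne_top, ENNReal.coe_toReal,
    NNReal.coe_add, EReal.coe_nnreal_eq_coe_real]
  norm_cast
  rw [NNReal.coe_add]
  constructor <;> intro h <;> linarith

theorem stable_iff_residual_eq_zero {t : ℝ} {x : X} : S.Stable t x ↔ S.residual t x = 0 := by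
  have h := residual_le_iff_quasiStable (S := S) (Q := 0) (t := t) (x := x)
  simpa [QuasiStable, Stable] using h.symm

theorem ofReal_energy_sub_le (t : ℝ) (x y : X) :
    ENNReal.ofReal (S.energy t x - S.energy t y) ≤ S.D x y + S.residual t x := by
  rw [add_comm, ← tsub_le_iff_right]
  exact le_iSup (fun y => ENNReal.ofReal (S.energy t x - S.energy t y) - S.D x y) y

theorem energy_sub_le_of_le_ofReal {t c : ℝ} {x y : X} (hc : 0 ≤ c)
    (h : S.D x y + S.residual t x ≤ ENNReal.ofReal c) : S.energy t x - S.energy t y ≤ c :=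
  (ENNReal.ofReal_le_ofReal_iff hc).1 ((ofReal_energy_sub_le t x y).trans h)

theorem Stable.energy_le {t : ℝ} {x y : X} (h : S.Stable t x) (hD : S.D x y ≠ ⊤) :
    S.energy t x ≤ S.energy t y + (S.D x y).toReal := by
  have := energy_sub_le_of_le_ofReal (S := S) (t := t) (x := x) (y := y)
    (c := (S.D x y).toReal) ENNReal.toReal_nonneg
    (by rw [ENNReal.ofReal_toReal hD, stable_iff_residual_eq_zero.1 h, add_zero])
  linarith

theorem toReal_d_triangle {x y : X} (h : S.d x y ≠ ⊤) :
    (S.d S.xo y).toReal ≤ (S.d S.xo x).toReal + (S.d x y).toReal := by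
  rw [← ENNReal.toReal_add (S.d_finite x) h]
  exact ENNReal.toReal_mono (ENNReal.add_ne_top.2 ⟨S.d_finite x, h⟩) (S.d_triangle _ _ _)

theorem residual_le_F (hA : S.AssumptionA) {t : ℝ} (ht : t ∈ Icc 0 S.T) (x : X) :
    S.residual t x ≤ ENNReal.ofReal (S.F t x) := by
  refine iSup_le fun y => ?_
  rw [tsub_le_iff_right]
  by_cases hd : S.d x y = ⊤
  · simp [D, hd]
  refine le_trans ?_ (add_le_add_right (le_self_add : S.d x y ≤ S.D x y) _)
  rw [← ENNReal.ofReal_toReal hd, ← ENNReal.ofReal_add (F_nonneg hA ht x) ENNReal.toReal_nonneg]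
  refine ENNReal.ofReal_le_ofReal ?_
  have h1 := F_nonneg hA ht y
  have h2 := toReal_d_triangle hd
  unfold F at h1 ⊢
  linarith

/-- Closedness of the quasi-stable sets is lower semicontinuity of the residual. -/
theorem lowerSemicontinuousOn_residual (hC : S.AssumptionC) (C : ℝ) :
    LowerSemicontinuousOn (fun p : ℝ × X => S.residual p.1 p.2) (S.sublevel C) := by
  intro p hp m hm
  obtain ⟨q, hq1, hq2⟩ := ENNReal.lt_iff_exists_nnreal_btwn.1 hm
  have hcl := hC.closed_quasiStable q C
  have hnot : p ∉ {p : ℝ × X | p ∈ S.sublevel C ∧ S.QuasiStable q p.1 p.2} := fun h =>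
    absurd (residual_le_iff_quasiStable.2 h.2) (not_le.2 hq2)
  filter_upwards [nhdsWithin_le_nhds (hcl.isOpen_compl.mem_nhds hnot), self_mem_nhdsWithin]
    with z hz hzC
  refine hq1.trans (lt_of_not_ge fun hle => hz ⟨hzC, residual_le_iff_quasiStable.1 hle⟩)

theorem D_le_of_d_eq_zero (hB : S.AssumptionB) {x y : X} (h : S.d x y = 0) (z : X) :
    S.D z y ≤ S.D z x := by
  refine add_le_add ?_ (hB.compat_right x y z h)
  simpa [h] using S.d_triangle z x y

/-- A point which is `d`-reached at no cost from a stable point, at no higher energy, is stable. -/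
theorem Stable.of_d_eq_zero (hB : S.AssumptionB) {t : ℝ} {x y : X} (hx : S.Stable t x)
    (h : S.d x y = 0) (hE : S.energy t y ≤ S.energy t x) : S.Stable t y := by
  intro v
  have h1 : S.D x v ≤ S.D y v := by
    refine add_le_add ?_ (hB.compat_left x y v h)
    simpa [h] using S.d_triangle x y v
  calc (S.energy t y : EReal) ≤ S.energy t x := EReal.coe_le_coe_iff.2 hE
    _ ≤ _ := hx v
    _ ≤ _ := add_le_add_right (EReal.coe_ennreal_le_coe_ennreal_iff.2 h1) _

/-! ### Dissipation functions along transitions -/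

/-- A function `G` on `K` whose increments control the infinitesimal cost of `ϑ`: the `d`-distance
plus the residual of the left end point, plus `δ` across the holes of `K`. It is the distribution
function of a measure bounding the transition cost. -/
structure IsDissipation (S : RateIndependentSystem X) (t : ℝ) (K : Set ℝ) (ϑ : ℝ → X)
    (G : ℝ → ℝ) : Prop where
  mono : MonotoneOn G K
  dist_add_residual_le : ∀ s ∈ K, ∀ r ∈ K, s < r →
    S.d (ϑ s) (ϑ r) + S.residual t (ϑ s) ≤ ENNReal.ofReal (G r - G s)
  hole_le : ∀ s r, (s, r) ∈ holes K →
    S.D (ϑ s) (ϑ r) + S.residual t (ϑ s) ≤ ENNReal.ofReal (G r - G s)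

theorem exists_mem_holes_left {K : Set ℝ} (hK : IsCompact K) {r : ℝ} (hr : r ∈ K)
    (hne : (K ∩ Iio r).Nonempty) (hacc : r ∉ closure (K ∩ Iio r)) : ∃ q, (q, r) ∈ holes K := by
  have hbdd : BddAbove (K ∩ Iio r) := ⟨r, fun s hs => le_of_lt hs.2⟩
  have hcl : sSup (K ∩ Iio r) ∈ closure (K ∩ Iio r) := csSup_mem_closure hne hbdd
  have hle : sSup (K ∩ Iio r) ≤ r := csSup_le hne fun s hs => le_of_lt hs.2
  refine ⟨sSup (K ∩ Iio r), ?_, hr, lt_of_le_of_ne hle fun h => hacc (by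
    have h' : sSup (K ∩ Iio r) = r := h
    rwa [h'] at hcl), ?_⟩
  · exact hK.isClosed.closure_subset_iff.2 inter_subset_left hcl
  · refine disjoint_left.2 fun z hz hzK => ?_
    exact absurd (le_csSup hbdd ⟨hzK, hz.2⟩) (not_le.2 hz.1)

theorem IsDissipation.energy_le_of_hole {t : ℝ} {K : Set ℝ} {ϑ : ℝ → X} {G : ℝ → ℝ}
    (hG : IsDissipation S t K ϑ G) {q r : ℝ} (h : (q, r) ∈ holes K) :
    S.energy t (ϑ q) - S.energy t (ϑ r) ≤ G r - G q :=
  energy_sub_le_of_le_ofReal (sub_nonneg.2 (hG.mono h.1 h.2.1 (le_of_lt h.2.2.1)))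
    (hG.hole_le q r h)

/-- The residual vanishes in the limit at points accumulated from the left. -/
theorem IsDissipation.tendsto_residual {t : ℝ} {K : Set ℝ} {ϑ : ℝ → X} {G : ℝ → ℝ}
    (hG : IsDissipation S t K ϑ G) {r : ℝ} (hr : r ∈ K) :
    Tendsto (fun s => S.residual t (ϑ s)) (𝓝[K ∩ Iio r] r) (𝓝 0) := by
  rcases eq_or_neBot (𝓝[K ∩ Iio r] r) with h | h
  · rw [h]; exact tendsto_bot
  have hcl : r ∈ closure (K ∩ Iio r) := mem_closure_iff_nhdsWithin_neBot.2 h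
  have hacc : ∀ s < r, ∃ q ∈ K, s < q ∧ q < r := fun s hs => by
    obtain ⟨q, hq1, hq2⟩ := mem_closure_iff.1 hcl (Ioi s) isOpen_Ioi hs
    exact ⟨q, hq2.1, hq1, hq2.2⟩
  have hne : (G '' (K ∩ Iio r)).Nonempty := by
    obtain ⟨q, hq, -, hqr⟩ := hacc (r - 1) (by linarith)
    exact ⟨_, q, ⟨hq, hqr⟩, rfl⟩
  have hbdd : BddAbove (G '' (K ∩ Iio r)) := ⟨G r, by
    rintro _ ⟨s, hs, rfl⟩; exact hG.mono hs.1 hr (le_of_lt hs.2)⟩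
  refine ENNReal.tendsto_nhds_zero.2 fun ε hε => ?_
  obtain ⟨e, he0, heε⟩ : ∃ e : ℝ, 0 < e ∧ ENNReal.ofReal e ≤ ε := by
    rcases eq_or_ne ε ⊤ with h | h
    · exact ⟨1, one_pos, by simp [h]⟩
    · exact ⟨ε.toReal, ENNReal.toReal_pos hε.ne' h, ENNReal.ofReal_toReal_le⟩
  obtain ⟨_, ⟨s₀, hs₀, rfl⟩, hlt⟩ := exists_lt_of_lt_csSup hne
    (sub_lt_self (sSup (G '' (K ∩ Iio r))) he0)
  filter_upwards [self_mem_nhdsWithin, nhdsWithin_le_nhds (lt_mem_nhds hs₀.2)] with s hs hs₀s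
  obtain ⟨q, hq, hsq, hqr⟩ := hacc s hs.2
  refine le_trans ?_ heε
  refine (le_add_self.trans (hG.dist_add_residual_le s hs.1 q hq hsq)).trans
    (ENNReal.ofReal_le_ofReal ?_)
  have h1 := hG.mono hs₀.1 hs.1 (le_of_lt hs₀s)
  have h2 := le_csSup hbdd (mem_image_of_mem G ⟨hq, hqr⟩)
  linarith

theorem exists_forall_F_le_of_dissipation {t : ℝ} {K : Set ℝ} {ϑ : ℝ → X} {G : ℝ → ℝ} {x y : X}
    (hϑ : S.IsTransition t K ϑ x y) (hG : IsDissipation S t K ϑ G) :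
    ∃ C, ∀ s ∈ K, S.F t (ϑ s) ≤ C := by
  obtain ⟨B, hB⟩ := hϑ.energy_bdd
  have hmin := hϑ.compact.isLeast_sInf hϑ.nonempty
  have hmax := hϑ.compact.isGreatest_sSup hϑ.nonempty
  refine ⟨B + ((S.d S.xo x).toReal + (G (sSup K) - G (sInf K))) + S.Fo, fun s hs => ?_⟩
  have h1 := hB (mem_image_of_mem _ hs)
  have hG1 := hG.mono hs hmax.1 (hmax.2 hs)
  have hG2 := hG.mono hmin.1 hs (hmin.2 hs)
  have hd : S.d x (ϑ s) ≤ ENNReal.ofReal (G s - G (sInf K)) := by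
    rcases (hmin.2 hs).eq_or_lt with h | h
    · rw [← h, hϑ.left_end, S.d_self]; exact bot_le
    · have := hG.dist_add_residual_le _ hmin.1 s hs h
      rw [hϑ.left_end] at this
      exact le_self_add.trans this
  have h2 := toReal_d_triangle (S := S) (x := x) (y := ϑ s)
    (ne_top_of_le_ne_top ENNReal.ofReal_ne_top hd)
  have h3 := ENNReal.toReal_mono ENNReal.ofReal_ne_top hd
  rw [ENNReal.toReal_ofReal (sub_nonneg.2 hG2)] at h3
  unfold F
  linarith

theorem tendsto_energy_lsc (hA : S.AssumptionA) {C t : ℝ} {x : X} (hx : (t, x) ∈ S.sublevel C)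
    {ι : Type*} {l : Filter ι} {p : ι → ℝ × X} (hp : Tendsto p l (𝓝 (t, x)))
    (hpC : ∀ᶠ i in l, p i ∈ S.sublevel C) {ε : ℝ} (hε : 0 < ε) :
    ∀ᶠ i in l, S.energy t x ≤ S.energy (p i).1 (p i).2 + ε := by
  have := (tendsto_nhdsWithin_iff.2 ⟨hp, hpC⟩).eventually
    (hA.energy_lsc C _ hx (S.energy t x - ε) (by simp [hε]))
  filter_upwards [this] with i hi
  linarith

/-- The chain-rule inequality along a transition: the energy drop is at most the dissipation.
At a point accumulated from the left the local stability assumption provides a steeper bound for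
nearby stable points; if there are none, the nearby points are isolated and can be connected hole by
hole, up to an error that vanishes by the left continuity of `δ`. -/
theorem IsDissipation.energy_le (hA : S.AssumptionA) (hB : S.AssumptionB) (hC : S.AssumptionC)
    {t : ℝ} (ht : t ∈ Icc 0 S.T) {K : Set ℝ} {ϑ : ℝ → X} {G : ℝ → ℝ} {x y : X}
    (hϑ : S.IsTransition t K ϑ x y) (hG : IsDissipation S t K ϑ G) :
    S.energy t x ≤ S.energy t y + (G (sSup K) - G (sInf K)) := by
  have hK := hϑ.compact
  have hmin := hK.isLeast_sInf hϑ.nonempty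
  have hmax := hK.isGreatest_sSup hϑ.nonempty
  obtain ⟨C, hCK⟩ := exists_forall_F_le_of_dissipation hϑ hG
  have hsub : ∀ s ∈ K, (t, ϑ s) ∈ S.sublevel C := fun s hs => ⟨ht, hCK s hs⟩
  have hpair : ∀ s ∈ K, ∀ A : Set ℝ, Tendsto (fun r => (t, ϑ r)) (𝓝[K ∩ A] s) (𝓝 (t, ϑ s)) :=
    fun s hs A => tendsto_const_nhds.prodMk_nhds
      ((hϑ.continuousOn s hs).mono_left (nhdsWithin_mono _ inter_subset_left))
  -- It suffices to bound the drop by `M` times the dissipation, for every `M > 1`.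
  suffices H : ∀ M : ℝ, 1 < M →
      S.energy t (ϑ (sInf K)) + M * G (sInf K) ≤ S.energy t (ϑ (sSup K)) + M * G (sSup K) by
    rw [hϑ.left_end, hϑ.right_end] at H
    have hlim : Tendsto (fun M : ℝ => S.energy t y + M * (G (sSup K) - G (sInf K))) (𝓝[>] 1)
        (𝓝 (S.energy t y + 1 * (G (sSup K) - G (sInf K)))) :=
      ((Continuous.tendsto (by fun_prop) 1).mono_left nhdsWithin_le_nhds)
    rw [one_mul] at hlim
    refine ge_of_tendsto hlim ?_
    filter_upwards [self_mem_nhdsWithin] with M hM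
    have := H M hM
    linarith
  intro M hM
  have hstep : ∀ q r, (q, r) ∈ holes K →
      S.energy t (ϑ q) + M * G q ≤ S.energy t (ϑ r) + M * G r := fun q r h => by
    have h1 := hG.energy_le_of_hole h
    have h2 := hG.mono h.1 h.2.1 (le_of_lt h.2.2.1)
    nlinarith
  have hlsc : ∀ s ∈ K, ∀ ε : ℝ, 0 < ε → ∀ᶠ r in 𝓝[K ∩ Ioi s] s,
      S.energy t (ϑ s) + M * G s ≤ S.energy t (ϑ r) + M * G r + ε := fun s hs ε hε => by
    filter_upwards [self_mem_nhdsWithin, tendsto_energy_lsc hA (hsub s hs) (hpair s hs (Ioi s))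
      (by filter_upwards [self_mem_nhdsWithin] with r hr using hsub r hr.1) hε] with r hr h
    have := hG.mono hs hr.1 (le_of_lt hr.2)
    nlinarith
  refine le_of_forall_exists_lt_le (φ := fun s => S.energy t (ϑ s) + M * G s) hK hmin hmax.1 hlsc
    fun r hr hlt => ?_
  by_cases hacc : r ∈ closure (K ∩ Iio r)
  swap
  · obtain ⟨q, hq⟩ := exists_mem_holes_left hK hr ⟨_, hmin.1, hlt⟩ hacc
    exact ⟨q, hq.1, hq.2.2.1, hstep q r hq⟩
  have hstable : ∀ r ∈ K, r ∈ closure (K ∩ Iio r) → S.Stable t (ϑ r) := fun r hr hacc => by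
    have : (𝓝[K ∩ Iio r] r).NeBot := mem_closure_iff_nhdsWithin_neBot.1 hacc
    rw [stable_iff_residual_eq_zero, ← nonpos_iff_eq_zero]
    refine LowerSemicontinuousWithinAt.le_of_tendsto_of_le
      (lowerSemicontinuousOn_residual hC C _ (hsub r hr)) (hpair r hr (Iio r)) ?_
      (hG.tendsto_residual hr) (Eventually.of_forall fun _ => le_rfl)
    filter_upwards [self_mem_nhdsWithin] with s hs using hsub s hs.1
  have hne : (𝓝[K ∩ Iio r] r).NeBot := mem_closure_iff_nhdsWithin_neBot.1 hacc
  have hdist : Tendsto (fun s => S.d (ϑ s) (ϑ r)) (𝓝[K ∩ Iio r] r) (𝓝 0) := by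
    refine ENNReal.tendsto_nhds_zero.2 fun ε hε => ?_
    obtain ⟨e, he0, heε⟩ : ∃ e : ℝ, 0 < e ∧ ENNReal.ofReal e ≤ ε := by
      rcases eq_or_ne ε ⊤ with h | h
      · exact ⟨1, one_pos, by simp [h]⟩
      · exact ⟨ε.toReal, ENNReal.toReal_pos hε.ne' h, ENNReal.ofReal_toReal_le⟩
    obtain ⟨η, hη, h⟩ := hϑ.dist_continuous e he0
    filter_upwards [self_mem_nhdsWithin,
      nhdsWithin_le_nhds (lt_mem_nhds (sub_lt_self r hη))] with s hs hs'
    exact (h s hs.1 r hr (le_of_lt hs.2) (by linarith)).trans heε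
  obtain ⟨η, hη, U, hU, hloc⟩ := hB.local_stable t ht (ϑ r) (hstable r hr hacc) M hM
  have hgood : ∀ᶠ s in 𝓝[K ∩ Iio r] r, s ∈ K ∩ Iio r ∧ (S.Stable t (ϑ s) →
      S.energy t (ϑ s) + M * G s ≤ S.energy t (ϑ r) + M * G r) := by
    have hc := (hϑ.continuousOn r hr).mono_left
      (nhdsWithin_mono r (inter_subset_left : K ∩ Iio r ⊆ K))
    filter_upwards [self_mem_nhdsWithin, hc hU,
      hdist.eventually (ge_mem_nhds (ENNReal.ofReal_pos.2 hη))] with s hs hsU hsd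
    refine ⟨hs, fun hst => ?_⟩
    have h1 := hloc t ht (by linarith) le_rfl _ hsU hst hsd
    have h2 : (S.d (ϑ s) (ϑ r)).toReal ≤ G r - G s := by
      have := le_self_add.trans (hG.dist_add_residual_le s hs.1 r hr hs.2)
      have h3 := ENNReal.toReal_mono ENNReal.ofReal_ne_top this
      rwa [ENNReal.toReal_ofReal (sub_nonneg.2 (hG.mono hs.1 hr (le_of_lt hs.2)))] at h3
    nlinarith
  by_cases hex : ∃ᶠ s in 𝓝[K ∩ Iio r] r, S.Stable t (ϑ s)
  · obtain ⟨s, hst, hs, h⟩ := (hex.and_eventually hgood).exists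
    exact ⟨s, hs.1, hs.2, h hst⟩
  -- No stable point nearby: all points of `K` in some `(s₀, r)` are isolated from the left.
  have hun := not_frequently.1 hex
  obtain ⟨l, hl, hlun⟩ : ∃ l < r, ∀ s ∈ K, l < s → s < r → ¬ S.Stable t (ϑ s) := by
    obtain ⟨ε, hε, hball⟩ := Metric.mem_nhdsWithin_iff.1 hun
    exact ⟨r - ε, by linarith, fun s hs h1 h2 => hball
      ⟨by rw [Metric.mem_ball, Real.dist_eq, abs_lt]; constructor <;> linarith, hs, h2⟩⟩
  obtain ⟨s₀, hs₀l, hs₀K, hs₀r⟩ := mem_closure_iff.1 hacc (Ioi l) isOpen_Ioi hl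
  refine ⟨s₀, hs₀K, hs₀r, ?_⟩
  have hinner : ∀ s ∈ K, s₀ ≤ s → s < r →
      S.energy t (ϑ s₀) + M * G s₀ ≤ S.energy t (ϑ s) + M * G s := fun s hs h0s hsr => by
    refine le_of_forall_exists_lt_le (φ := fun s => S.energy t (ϑ s) + M * G s)
      (K := K ∩ Icc s₀ s) (hK.inter_right isClosed_Icc)
      ⟨⟨hs₀K, le_rfl, h0s⟩, fun z hz => hz.2.1⟩ ⟨hs, h0s, le_rfl⟩
      (fun q hq ε hε => (hlsc q hq.1 ε hε).filter_mono (nhdsWithin_mono _ (by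
        intro z hz; exact ⟨hz.1.1, hz.2⟩))) fun q hq hlt' => ?_
    have hnacc : q ∉ closure (K ∩ Iio q) := fun h =>
      hlun q hq.1 (lt_of_lt_of_le hs₀l hq.2.1) (lt_of_le_of_lt hq.2.2 hsr) (hstable q hq.1 h)
    obtain ⟨p, hp⟩ := exists_mem_holes_left hK hq.1 ⟨_, hs₀K, hlt'⟩ hnacc
    have hs₀p : s₀ ≤ p := by
      by_contra! hlt''
      exact disjoint_left.1 hp.2.2.2 ⟨hlt'', hlt'⟩ hs₀K
    exact ⟨p, ⟨hp.1, hs₀p, (le_of_lt hp.2.2.1).trans hq.2.2⟩, hp.2.2.1, hstep p q hp⟩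
  obtain ⟨σ, hσ⟩ := exists_seq_tendsto (𝓝[K ∩ Iio r] r)
  have hσK : ∀ᶠ n in atTop, σ n ∈ K ∩ Iio r := hσ.eventually self_mem_nhdsWithin
  obtain ⟨κ, -, -, hκ⟩ := exists_F_le_exp_mul hA
  have hδ : Tendsto (fun n => S.δ (ϑ (σ n)) (ϑ r)) atTop (𝓝 0) := by
    obtain ⟨m, hm⟩ := hσK.exists_forall_of_atTop
    have := hB.left_continuous (fun n => ϑ (σ (n + m))) (ϑ r)
      ⟨Real.exp (κ * |0 - t|) * C, fun n => (hκ t ht 0 ⟨le_rfl, S.T_pos.le⟩ _).trans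
        (mul_le_mul_of_nonneg_left (hCK _ (hm _ (by omega)).1) (Real.exp_pos _).le)⟩
      ((((hϑ.continuousOn r hr).mono_left (nhdsWithin_mono r inter_subset_left)).comp hσ).comp
        (tendsto_add_atTop_nat m)) ((hdist.comp hσ).comp (tendsto_add_atTop_nat m))
    exact (tendsto_add_atTop_iff_nat m).1 this
  have hcost : Tendsto (fun n => S.D (ϑ (σ n)) (ϑ r) + S.residual t (ϑ (σ n))) atTop (𝓝 0) := by
    have := ((hdist.comp hσ).add hδ).add ((hG.tendsto_residual hr).comp hσ)
    simpa [D] using this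
  refine le_of_forall_pos_le_add fun ε hε => ?_
  obtain ⟨n, hnK, hn, hn0⟩ := (hσK.and ((hcost.eventually
    (ge_mem_nhds (ENNReal.ofReal_pos.2 hε))).and
    ((hσ.mono_right nhdsWithin_le_nhds).eventually (lt_mem_nhds hs₀r)))).exists
  have h1 := hinner _ hnK.1 (le_of_lt hn0) hnK.2
  have h2 := energy_sub_le_of_le_ofReal hε.le hn
  have h3 := hG.mono hnK.1 hr (le_of_lt hnK.2)
  nlinarith

end RateIndependentSystem

/-- If the increments of `G` control the `d`-distance together with a weight `w₂` for leaving the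
left end point and a weight `w₁` for reaching the right one, then the total increment of `G`
controls the variation plus all the weights. -/
theorem pointwiseVar_add_sum_le {X : Type*} {d : X → X → ℝ≥0∞} (d_self : ∀ x, d x x = 0)
    (d_triangle : ∀ x y z, d x z ≤ d x y + d y z) {u : ℝ → X} {E : Set ℝ} {a b : ℝ}
    (ha : IsLeast E a) (hb : IsGreatest E b) {G : ℝ → ℝ} (hG : MonotoneOn G E) {w₁ w₂ : ℝ → ℝ≥0∞}
    (h : ∀ s ∈ E, ∀ r ∈ E, s < r → d (u s) (u r) + w₂ s + w₁ r ≤ ENNReal.ofReal (G r - G s))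
    {P : Finset ℝ} (hP : ∀ p ∈ P, p ∈ E) :
    pointwiseVar d u E + ∑ p ∈ P, ((if p < b then w₂ p else 0) + (if a < p then w₁ p else 0))
      ≤ ENNReal.ofReal (G b - G a) := by
  have add : ∀ {s q r : ℝ}, s ∈ E → q ∈ E → r ∈ E → s ≤ q → q ≤ r →
      ENNReal.ofReal (G q - G s) + ENNReal.ofReal (G r - G q) = ENNReal.ofReal (G r - G s) :=
    fun hs hq hr hsq hqr => by
      rw [← ENNReal.ofReal_add (sub_nonneg.2 (hG hs hq hsq)) (sub_nonneg.2 (hG hq hr hqr))]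
      congr 1; ring
  -- Insert the points of a finite set between two given points.
  have inner : ∀ Q : Finset ℝ, (∀ p ∈ Q, p ∈ E) → ∀ s ∈ E, ∀ r ∈ E, s < r →
      d (u s) (u r) + w₂ s + w₁ r + ∑ p ∈ Q, (if s < p ∧ p < r then w₁ p + w₂ p else 0)
        ≤ ENNReal.ofReal (G r - G s) := by
    intro Q
    induction Q using Finset.induction_on with
    | empty => intro _ s hs r hr hsr; simpa using h s hs r hr hsr
    | insert p Q hpQ ih =>
      intro hQ s hs r hr hsr
      have ih' := ih fun q hq => hQ q (Finset.mem_insert_of_mem hq)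
      have hpE := hQ p (Finset.mem_insert_self _ _)
      rw [Finset.sum_insert hpQ]
      by_cases hp : s < p ∧ p < r
      · rw [if_pos hp, ← add hs hpE hr hp.1.le hp.2.le]
        refine le_trans ?_ (add_le_add (ih' s hs p hpE hp.1) (ih' p hpE r hr hp.2))
        have hsum : ∑ q ∈ Q, (if s < q ∧ q < r then w₁ q + w₂ q else 0) ≤
            ∑ q ∈ Q, (if s < q ∧ q < p then w₁ q + w₂ q else 0) +
            ∑ q ∈ Q, (if p < q ∧ q < r then w₁ q + w₂ q else 0) := by
          rw [← Finset.sum_add_distrib]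
          refine Finset.sum_le_sum fun q hq => ?_
          have hne : q ≠ p := fun h => hpQ (h ▸ hq)
          rcases lt_or_gt_of_ne hne with h' | h'
          · by_cases h1 : s < q
            · simp [h1, h', h'.trans hp.2]
            · simp [h1]
          · by_cases h1 : q < r
            · simp [h1, h', hp.1.trans h']
            · simp [h1]
        calc d (u s) (u r) + w₂ s + w₁ r + (w₁ p + w₂ p +
              ∑ q ∈ Q, (if s < q ∧ q < r then w₁ q + w₂ q else 0))
            ≤ (d (u s) (u p) + d (u p) (u r)) + w₂ s + w₁ r + (w₁ p + w₂ p +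
              (∑ q ∈ Q, (if s < q ∧ q < p then w₁ q + w₂ q else 0) +
              ∑ q ∈ Q, (if p < q ∧ q < r then w₁ q + w₂ q else 0))) := by
              gcongr; exact d_triangle _ _ _
          _ = _ := by ring
      · rw [if_neg hp, zero_add]; exact ih' s hs r hr hsr
  let W : ℝ → ℝ → ℝ≥0∞ := fun s r =>
    ∑ p ∈ P, ((if s ≤ p ∧ p < r then w₂ p else 0) + (if s < p ∧ p ≤ r then w₁ p else 0))
  have hW : ∀ s q r, s ≤ q → q ≤ r → W s r = W s q + W q r := fun s q r hsq hqr => by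
    simp only [W, ← Finset.sum_add_distrib]
    refine Finset.sum_congr rfl fun p _ => ?_
    have e2 : (if s ≤ p ∧ p < r then w₂ p else 0) =
        (if s ≤ p ∧ p < q then w₂ p else 0) + (if q ≤ p ∧ p < r then w₂ p else 0) := by
      by_cases h1 : p < q
      · simp [h1, h1.trans_le hqr, not_le.2 h1]
      · simp [h1, not_lt.1 h1, hsq.trans (not_lt.1 h1)]
    have e1 : (if s < p ∧ p ≤ r then w₁ p else 0) =
        (if s < p ∧ p ≤ q then w₁ p else 0) + (if q < p ∧ p ≤ r then w₁ p else 0) := by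
      by_cases h1 : p ≤ q
      · simp [h1, h1.trans hqr, not_lt.2 h1]
      · simp [h1, not_le.1 h1, hsq.trans_lt (not_le.1 h1)]
    rw [e1, e2]; ring
  have step : ∀ s ∈ E, ∀ r ∈ E, s ≤ r →
      d (u s) (u r) + W s r ≤ ENNReal.ofReal (G r - G s) := fun s hs r hr hsr => by
    rcases hsr.eq_or_lt with rfl | hlt
    · have : W s s = 0 := Finset.sum_eq_zero fun p _ => by
        rw [if_neg (fun h => absurd h.1 (not_le.2 h.2)),
          if_neg (fun h => absurd h.2 (not_le.2 h.1)), add_zero]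
      simp [this, d_self]
    · refine le_trans ?_ (inner P hP s hs r hr hlt)
      have : W s r ≤ w₂ s + w₁ r + ∑ p ∈ P, (if s < p ∧ p < r then w₁ p + w₂ p else 0) := by
        have hs' : ∑ p ∈ P, (if p = s then w₂ s else 0) ≤ w₂ s := by
          rw [Finset.sum_ite_eq']; split_ifs <;> simp
        have hr' : ∑ p ∈ P, (if p = r then w₁ r else 0) ≤ w₁ r := by
          rw [Finset.sum_ite_eq']; split_ifs <;> simp
        refine le_trans ?_ (add_le_add_left (add_le_add hs' hr') _)
        rw [← Finset.sum_add_distrib, ← Finset.sum_add_distrib]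
        refine Finset.sum_le_sum fun p _ => ?_
        rcases lt_trichotomy p s with h1 | rfl | h1
        · simp [not_le.2 h1, not_lt.2 h1.le]
        · simp [hlt]
        · rcases lt_trichotomy p r with h2 | rfl | h2
          · simp [h1, h2, h1.le, h2.le, h1.ne', h2.ne, add_comm]
          · simp [hlt]
          · simp [not_le.2 h2, not_lt.2 h2.le]
      rw [add_assoc (d (u s) (u r)), add_assoc (d (u s) (u r))]
      gcongr
  have chain : ∀ t : ℕ → ℝ, Monotone t → (∀ i, t i ∈ E) → ∀ n,
      ∑ j ∈ Finset.range n, d (u (t j)) (u (t (j + 1))) + W (t 0) (t n)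
        ≤ ENNReal.ofReal (G (t n) - G (t 0)) := fun t ht htE n => by
    induction n with
    | zero => simpa [d_self] using step _ (htE 0) _ (htE 0) le_rfl
    | succ n ih =>
      rw [Finset.sum_range_succ, hW _ _ _ (ht n.zero_le) (ht n.le_succ),
        ← add (htE 0) (htE n) (htE (n + 1)) (ht n.zero_le) (ht n.le_succ)]
      calc _ = (∑ j ∈ Finset.range n, d (u (t j)) (u (t (j + 1))) + W (t 0) (t n)) +
            (d (u (t n)) (u (t (n + 1))) + W (t n) (t (n + 1))) := by ring
        _ ≤ _ := add_le_add ih (step _ (htE n) _ (htE (n + 1)) (ht n.le_succ))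
  have hsum : ∑ p ∈ P, ((if p < b then w₂ p else 0) + (if a < p then w₁ p else 0)) = W a b :=
    Finset.sum_congr rfl fun p hp => by simp [ha.2 (hP p hp), hb.2 (hP p hp)]
  have : Nonempty (ℕ × {t : ℕ → ℝ // Monotone t ∧ ∀ i, t i ∈ E}) :=
    ⟨0, fun _ => a, monotone_const, fun _ => ha.1⟩
  rw [hsum, pointwiseVar, ENNReal.iSup_add]
  refine iSup_le fun ⟨n, t, ht, htE⟩ => ?_
  have h0 := ha.2 (htE 0)
  have hn := hb.2 (htE n)
  have h0n := ht n.zero_le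
  rw [hW _ _ _ h0 (h0n.trans hn), hW _ _ _ h0n hn, ← add ha.1 (htE 0) hb.1 h0 (h0n.trans hn),
    ← add (htE 0) (htE n) hb.1 h0n hn]
  calc _ = W a (t 0) + ((∑ j ∈ Finset.range n, d (u (t j)) (u (t (j + 1))) + W (t 0) (t n)) +
        W (t n) b) := by simp only; ring
    _ ≤ _ := add_le_add (le_add_self.trans (step _ ha.1 _ (htE 0) h0))
        (add_le_add (chain t ht htE n) (le_add_self.trans (step _ (htE n) _ hb.1 hn)))

namespace RateIndependentSystem

variable {X : Type*} [TopologicalSpace X] {S : RateIndependentSystem X}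

/-! ### Transition costs and dissipation functions -/

theorem eq_of_mem_holes {K : Set ℝ} {p r r' : ℝ} (h : (p, r) ∈ holes K) (h' : (p, r') ∈ holes K) :
    r = r' := by
  rcases lt_trichotomy r r' with hl | hl | hl
  · exact absurd h.2.1 (disjoint_left.1 h'.2.2.2 ⟨h.2.2.1, hl⟩)
  · exact hl
  · exact absurd h'.2.1 (disjoint_left.1 h.2.2.2 ⟨h'.2.2.1, hl⟩)

theorem IsDissipation.transitionCost_le {t : ℝ} {K : Set ℝ} (hK : IsCompact K) (hne : K.Nonempty)
    {ϑ : ℝ → X} {G : ℝ → ℝ} (hG : IsDissipation S t K ϑ G) :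
    S.transitionCost t K ϑ ≤ ENNReal.ofReal (G (sSup K) - G (sInf K)) := by
  classical
  let ω : ℝ → ℝ≥0∞ := fun p => ⨆ (r : ℝ) (_ : (p, r) ∈ holes K), S.δ (ϑ p) (ϑ r)
  have hω : ∀ {p r}, (p, r) ∈ holes K → ω p = S.δ (ϑ p) (ϑ r) := fun {p r} h =>
    le_antisymm (iSup₂_le fun r' h' => by rw [eq_of_mem_holes h h'])
      (le_iSup₂ (f := fun r (_ : (p, r) ∈ holes K) => S.δ (ϑ p) (ϑ r)) r h)
  have key := fun (P : Finset ℝ) => pointwiseVar_add_sum_le (P := P) S.d_self S.d_triangle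
    (hK.isLeast_sInf hne) (hK.isGreatest_sSup hne) (u := ϑ) hG.mono (w₁ := 0)
    (w₂ := fun p => S.residual t (ϑ p) + ω p) (fun s hs r hr hsr => by
      rw [Pi.zero_apply, add_zero]
      by_cases hex : ∃ q, (s, q) ∈ holes K
      · obtain ⟨q, hq⟩ := hex
        have hqr : q ≤ r := by
          by_contra! hlt
          exact disjoint_left.1 hq.2.2.2 ⟨hsr, hlt⟩ hr
        rw [hω hq]
        have h1 := hG.hole_le s q hq
        have h2 : S.d (ϑ q) (ϑ r) ≤ ENNReal.ofReal (G r - G q) := by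
          rcases hqr.eq_or_lt with rfl | hlt
          · simp [S.d_self]
          · exact le_self_add.trans (hG.dist_add_residual_le q hq.2.1 r hr hlt)
        have hqs : s < q := hq.2.2.1
        have e : G r - G s = (G q - G s) + (G r - G q) := by ring
        rw [e, ENNReal.ofReal_add (sub_nonneg.2 (hG.mono hs hq.2.1 hqs.le))
          (sub_nonneg.2 (hG.mono hq.2.1 hr hqr))]
        refine le_trans ?_ (add_le_add h1 h2)
        calc _ ≤ S.d (ϑ s) (ϑ q) + S.d (ϑ q) (ϑ r) +
              (S.residual t (ϑ s) + S.δ (ϑ s) (ϑ q)) :=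
              add_le_add_left (S.d_triangle _ _ _) _
          _ = _ := by unfold D; ring
      · have : ω s = 0 := by
          simp only [ω, ENNReal.iSup_eq_zero]
          exact fun q hq => absurd ⟨q, hq⟩ hex
        rw [this, add_zero]
        exact hG.dist_add_residual_le s hs r hr hsr)
  have hmax := hK.isGreatest_sSup hne
  have : Nonempty {P : Finset ℝ // (P : Set ℝ) ⊆ K \ {sSup K}} := ⟨∅, by simp⟩
  unfold transitionCost
  rw [ENNReal.tsum_eq_iSup_sum, iSup_subtype', ENNReal.add_iSup]
  refine iSup_le fun ⟨P, hP⟩ => ?_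
  rw [add_right_comm, ENNReal.add_iSup]
  refine iSup_le fun H => ?_
  let Q : Finset ℝ := H.image fun I => I.1.1
  have hQ : ∀ p ∈ Q, p ∈ K \ {sSup K} := fun p hp => by
    obtain ⟨I, -, rfl⟩ := Finset.mem_image.1 hp
    exact ⟨I.2.1, ne_of_lt (lt_of_lt_of_le I.2.2.2.1 (hmax.2 I.2.2.1))⟩
  have hPQ : ∀ p ∈ P ∪ Q, p ∈ K \ {sSup K} := fun p hp =>
    (Finset.mem_union.1 hp).elim (fun h => hP h) (hQ p)
  refine le_trans ?_ (key (P ∪ Q) fun p hp => (hPQ p hp).1)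
  rw [add_assoc]
  refine add_le_add_right ?_ _
  have e1 : ∑ I ∈ H, S.δ (ϑ I.1.1) (ϑ I.1.2) = ∑ p ∈ Q, ω p := by
    rw [Finset.sum_image fun I _ J _ h => ?_]
    · exact Finset.sum_congr rfl fun I _ => (hω I.2).symm
    · obtain ⟨⟨p, r⟩, hI⟩ := I
      obtain ⟨⟨p', r'⟩, hJ⟩ := J
      obtain rfl : p = p' := h
      rw [Subtype.mk.injEq, eq_of_mem_holes hI hJ]
  rw [e1]
  calc ∑ p ∈ P, S.residual t (ϑ p) + ∑ p ∈ Q, ω p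
      ≤ ∑ p ∈ P ∪ Q, S.residual t (ϑ p) + ∑ p ∈ P ∪ Q, ω p :=
        add_le_add (Finset.sum_le_sum_of_subset Finset.subset_union_left)
          (Finset.sum_le_sum_of_subset Finset.subset_union_right)
    _ = _ := by
        rw [← Finset.sum_add_distrib]
        refine Finset.sum_congr rfl fun p hp => ?_
        have : p < sSup K := lt_of_le_of_ne (hmax.2 (hPQ p hp).1) (hPQ p hp).2
        simp [this]

/-- The cost of the restrictions of a transition to initial pieces is a dissipation function. -/
theorem IsTransition.isDissipation {t : ℝ} {K : Set ℝ} {ϑ : ℝ → X} {x y : X}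
    (hϑ : S.IsTransition t K ϑ x y) (hfin : S.transitionCost t K ϑ ≠ ⊤) :
    IsDissipation S t K ϑ (fun s => (S.transitionCost t (K ∩ Iic s) ϑ).toReal) := by
  classical
  have hmax := hϑ.compact.isGreatest_sSup hϑ.nonempty
  have hsup : ∀ s ∈ K, sSup (K ∩ Iic s) = s := fun s hs =>
    IsGreatest.csSup_eq ⟨⟨hs, mem_Iic.2 le_rfl⟩, fun z hz => hz.2⟩
  have hKmax : K ∩ Iic (sSup K) = K := inter_eq_left.2 fun z hz => mem_Iic.2 (hmax.2 hz)
  have hholes : ∀ s r, s ≤ r → holes (K ∩ Iic s) ⊆ holes (K ∩ Iic r) := fun s r hsr I hI =>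
    ⟨⟨hI.1.1, hI.1.2.trans hsr⟩, ⟨hI.2.1.1, hI.2.1.2.trans hsr⟩, hI.2.2.1,
      disjoint_left.2 fun z hz hzK =>
        disjoint_left.1 hI.2.2.2 hz ⟨hzK.1, hz.2.le.trans hI.2.1.2⟩⟩
  have hvar : ∀ s ∈ K, ∀ r ∈ K, s ≤ r → pointwiseVar S.d ϑ (K ∩ Iic s) + S.d (ϑ s) (ϑ r) ≤
      pointwiseVar S.d ϑ (K ∩ Iic r) := fun s hs r hr hsr =>
    (add_le_add_right (le_pointwiseVar (E := {s, r}) (by simp) (by simp) hsr) _).trans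
      (pointwiseVar_add_le (fun z hz => ⟨hz.1, hz.2.trans hsr⟩)
        (by rintro z (rfl | rfl); exacts [⟨hs, hsr⟩, ⟨hr, mem_Iic.2 le_rfl⟩])
        (by rintro z hz w (rfl | rfl); exacts [hz.2, hz.2.trans hsr]))
  have hres : ∀ s ∈ K, ∀ r ∈ K, s < r →
      (⨆ (P : Finset ℝ) (_ : (P : Set ℝ) ⊆ (K ∩ Iic s) \ {sSup (K ∩ Iic s)}),
        ∑ p ∈ P, S.residual t (ϑ p)) + S.residual t (ϑ s) ≤
      ⨆ (P : Finset ℝ) (_ : (P : Set ℝ) ⊆ (K ∩ Iic r) \ {sSup (K ∩ Iic r)}),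
        ∑ p ∈ P, S.residual t (ϑ p) := fun s hs r hr hsr => by
    have : Nonempty {P : Finset ℝ // (P : Set ℝ) ⊆ (K ∩ Iic s) \ {sSup (K ∩ Iic s)}} :=
      ⟨∅, by simp⟩
    rw [iSup_subtype', ENNReal.iSup_add]
    refine iSup_le fun ⟨P, hP⟩ => ?_
    rw [hsup s hs] at hP
    rw [hsup r hr]
    have hsP : s ∉ P := fun h => (hP h).2 rfl
    rw [add_comm, ← Finset.sum_insert (f := fun p => S.residual t (ϑ p)) hsP]
    refine le_iSup₂ (f := fun (P : Finset ℝ) (_ : (P : Set ℝ) ⊆ (K ∩ Iic r) \ {r}) =>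
      ∑ p ∈ P, S.residual t (ϑ p)) (insert s P) ?_
    intro p hp
    rcases Finset.mem_insert.1 (Finset.mem_coe.1 hp) with rfl | hp
    · exact ⟨⟨hs, hsr.le⟩, hsr.ne⟩
    · exact ⟨⟨(hP hp).1.1, (hP hp).1.2.trans hsr.le⟩, ne_of_lt (lt_of_le_of_lt (hP hp).1.2 hsr)⟩
  have hcost : ∀ s ∈ K, ∀ r ∈ K, s < r → S.transitionCost t (K ∩ Iic s) ϑ +
      (S.d (ϑ s) (ϑ r) + S.residual t (ϑ s)) ≤ S.transitionCost t (K ∩ Iic r) ϑ :=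
    fun s hs r hr hsr => by
    have h2 := ENNReal.tsum_mono_subtype (fun I : ℝ × ℝ => S.δ (ϑ I.1) (ϑ I.2))
      (hholes s r hsr.le)
    refine le_trans (le_of_eq ?_) (add_le_add (add_le_add (hvar s hs r hr hsr.le) h2)
      (hres s hs r hr hsr))
    unfold transitionCost
    ring
  have hcosth : ∀ s r, (s, r) ∈ holes K → S.transitionCost t (K ∩ Iic s) ϑ +
      (S.D (ϑ s) (ϑ r) + S.residual t (ϑ s)) ≤ S.transitionCost t (K ∩ Iic r) ϑ :=
    fun s r h => by
    have hsr : s < r := h.2.2.1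
    have hnot : (s, r) ∉ holes (K ∩ Iic s) := fun h' => absurd h'.2.1.2 (not_le.2 hsr)
    have h2 : ∑' I : ↥(holes (K ∩ Iic s)), S.δ (ϑ I.1.1) (ϑ I.1.2) + S.δ (ϑ s) (ϑ r) ≤
        ∑' I : ↥(holes (K ∩ Iic r)), S.δ (ϑ I.1.1) (ϑ I.1.2) := by
      have e := ENNReal.summable.tsum_union_disjoint
        (f := fun I : ℝ × ℝ => S.δ (ϑ I.1) (ϑ I.2)) (disjoint_singleton_right.2 hnot)
        ENNReal.summable
      rw [tsum_singleton (s, r) (fun I : ℝ × ℝ => S.δ (ϑ I.1) (ϑ I.2))] at e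
      rw [← e]
      refine ENNReal.tsum_mono_subtype (fun I : ℝ × ℝ => S.δ (ϑ I.1) (ϑ I.2))
        (union_subset (hholes s r hsr.le) (singleton_subset_iff.2 ?_))
      exact ⟨⟨h.1, hsr.le⟩, ⟨h.2.1, mem_Iic.2 le_rfl⟩, hsr, h.2.2.2.mono_right inter_subset_left⟩
    refine le_trans (le_of_eq ?_) (add_le_add (add_le_add (hvar s h.1 r h.2.1 hsr.le) h2)
      (hres s h.1 r h.2.1 hsr))
    unfold transitionCost D
    ring
  have hfin' : ∀ s ∈ K, S.transitionCost t (K ∩ Iic s) ϑ ≠ ⊤ := fun s hs => by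
    rcases (hmax.2 hs).eq_or_lt with h | h
    · rwa [h, hKmax]
    · refine ne_top_of_le_ne_top ?_ (le_self_add.trans (hcost s hs _ hmax.1 h))
      rwa [hKmax]
  have conv : ∀ {s r : ℝ} {c : ℝ≥0∞}, r ∈ K →
      S.transitionCost t (K ∩ Iic s) ϑ + c ≤ S.transitionCost t (K ∩ Iic r) ϑ →
      c ≤ ENNReal.ofReal ((S.transitionCost t (K ∩ Iic r) ϑ).toReal -
        (S.transitionCost t (K ∩ Iic s) ϑ).toReal) := fun {s r c} hr h => by
    have hs' := ne_top_of_le_ne_top (hfin' r hr) (le_self_add.trans h)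
    rw [ENNReal.ofReal_sub _ ENNReal.toReal_nonneg, ENNReal.ofReal_toReal (hfin' r hr),
      ENNReal.ofReal_toReal hs']
    exact ENNReal.le_sub_of_add_le_left hs' h
  refine ⟨fun s hs r hr hsr => ?_, fun s hs r hr hsr => conv hr (hcost s hs r hr hsr),
    fun s r h => conv h.2.1 (hcosth s r h)⟩
  rcases hsr.eq_or_lt with rfl | hlt
  · exact le_rfl
  · exact ENNReal.toReal_mono (hfin' r hr) (le_self_add.trans (hcost s hs r hr hlt))

theorem ofReal_energy_sub_le_jumpCost (hA : S.AssumptionA) (hB : S.AssumptionB)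
    (hC : S.AssumptionC) {t : ℝ} (ht : t ∈ Icc 0 S.T) (x y : X) :
    ENNReal.ofReal (S.energy t x - S.energy t y) ≤ S.jumpCost t x y := by
  refine le_iInf fun K => le_iInf fun ϑ => le_iInf fun hϑ => ?_
  by_cases hfin : S.transitionCost t K ϑ = ⊤
  · rw [hfin]; exact le_top
  have hG := hϑ.isDissipation hfin
  have h := hG.energy_le hA hB hC ht hϑ
  have hmax := hϑ.compact.isGreatest_sSup hϑ.nonempty
  have hKmax : K ∩ Iic (sSup K) = K := inter_eq_left.2 fun z hz => mem_Iic.2 (hmax.2 hz)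
  rw [hKmax] at h
  rw [← ENNReal.ofReal_toReal hfin]
  refine ENNReal.ofReal_le_ofReal ?_
  have : 0 ≤ (S.transitionCost t (K ∩ Iic (sInf K)) ϑ).toReal := ENNReal.toReal_nonneg
  linarith

theorem d_le_jumpCost (t : ℝ) (x y : X) : S.d x y ≤ S.jumpCost t x y := by
  refine le_iInf fun K => le_iInf fun ϑ => le_iInf fun hϑ => ?_
  have hmin := hϑ.compact.isLeast_sInf hϑ.nonempty
  have hmax := hϑ.compact.isGreatest_sSup hϑ.nonempty
  have := le_pointwiseVar (d := S.d) (u := ϑ) hmin.1 hmax.1 (hmin.2 hmax.1)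
  rw [hϑ.left_end, hϑ.right_end] at this
  exact (this.trans le_self_add).trans le_self_add

theorem IsDissipation.jumpCost_le {t : ℝ} {K : Set ℝ} {ϑ : ℝ → X} {G : ℝ → ℝ} {x y : X}
    (hϑ : S.IsTransition t K ϑ x y) (hG : IsDissipation S t K ϑ G) :
    S.jumpCost t x y ≤ ENNReal.ofReal (G (sSup K) - G (sInf K)) := by
  unfold jumpCost
  exact iInf_le_of_le K (iInf_le_of_le ϑ (iInf_le_of_le hϑ
    (hG.transitionCost_le hϑ.compact hϑ.nonempty)))

theorem jumpCost_self (t : ℝ) (x : X) : S.jumpCost t x x = 0 := by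
  have hϑ : S.IsTransition t {0} (fun _ => x) x x :=
    { compact := isCompact_singleton
      nonempty := singleton_nonempty _
      continuousOn := continuousOn_const
      dist_continuous := fun ε _ => ⟨1, one_pos, fun _ _ _ _ _ _ => by simp [S.d_self]⟩
      left_end := rfl
      right_end := rfl
      energy_bdd := ⟨S.energy t x, by rintro _ ⟨s, -, rfl⟩; exact le_rfl⟩ }
  have hG : IsDissipation S t {0} (fun _ => x) (fun _ => 0) :=
    ⟨fun _ _ _ _ _ => le_rfl, fun s hs r hr h => by
      rw [mem_singleton_iff] at hs hr; simp [hs, hr] at h, fun s r h => by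
      have h1 : s = 0 := h.1
      have h2 : r = 0 := h.2.1
      have h3 : s < r := h.2.2.1
      simp [h1, h2] at h3⟩
  simpa using hG.jumpCost_le hϑ

/-! ### Discrete evolutions -/

/-- A finite evolution `x 0, …, x N` at times `t 0 ≤ ⋯ ≤ t N`, with accumulated dissipation `σ` and
an arclength `a`. The increments of `a` dominate those of `t` and `σ`, and they dominate the
residual at *both* end points of a step. Hence the residual at a point is small as soon as another
point is close to it in arclength. -/
structure Chain (S : RateIndependentSystem X) (C R : ℝ) where
  N : ℕ
  t : ℕ → ℝ
  x : ℕ → X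
  σ : ℕ → ℝ
  a : ℕ → ℝ
  t_mem : ∀ j ≤ N, t j ∈ Icc 0 S.T
  F_le : ∀ j ≤ N, ∀ s ∈ Icc 0 S.T, S.F s (x j) ≤ C
  a_zero : a 0 = 0
  σ_zero : σ 0 = 0
  a_le : ∀ j ≤ N, a j ≤ R
  t_step : ∀ j < N, t j ≤ t (j + 1) ∧ t (j + 1) - t j ≤ a (j + 1) - a j
  σ_step : ∀ j < N, σ j ≤ σ (j + 1) ∧ σ (j + 1) - σ j ≤ a (j + 1) - a j
  cost_le : ∀ j < N,
    S.D (x j) (x (j + 1)) + S.residual (t (j + 1)) (x j) ≤ ENNReal.ofReal (σ (j + 1) - σ j)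
  residual_le : ∀ j < N,
    S.residual (t (min (j + 2) N)) (x (j + 1)) ≤ ENNReal.ofReal (a (j + 1) - a j)

namespace Chain

variable {C R : ℝ} (c : S.Chain C R)

theorem le_of_step {f : ℕ → ℝ} {N : ℕ} (h : ∀ j < N, f j ≤ f (j + 1)) {i j : ℕ} (hij : i ≤ j)
    (hj : j ≤ N) : f i ≤ f j := by
  induction j, hij using Nat.le_induction with
  | base => exact le_rfl
  | succ j _ ih => exact (ih (by omega)).trans (h j (by omega))

theorem t_le {i j : ℕ} (hij : i ≤ j) (hj : j ≤ c.N) : c.t i ≤ c.t j :=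
  le_of_step (fun j hj => (c.t_step j hj).1) hij hj

theorem t_sub_le {i j : ℕ} (hij : i ≤ j) (hj : j ≤ c.N) : c.t j - c.t i ≤ c.a j - c.a i := by
  have := le_of_step (f := fun j => c.a j - c.t j) (N := c.N)
    (fun j hj => by linarith [(c.t_step j hj).2]) hij hj
  linarith

theorem σ_le {i j : ℕ} (hij : i ≤ j) (hj : j ≤ c.N) : c.σ i ≤ c.σ j :=
  le_of_step (fun j hj => (c.σ_step j hj).1) hij hj

theorem σ_sub_le {i j : ℕ} (hij : i ≤ j) (hj : j ≤ c.N) : c.σ j - c.σ i ≤ c.a j - c.a i := by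
  have := le_of_step (f := fun j => c.a j - c.σ j) (N := c.N)
    (fun j hj => by linarith [(c.σ_step j hj).2]) hij hj
  linarith

theorem a_mono {i j : ℕ} (hij : i ≤ j) (hj : j ≤ c.N) : c.a i ≤ c.a j := by
  linarith [c.t_le hij hj, c.t_sub_le hij hj]

theorem d_le {i j : ℕ} (hij : i ≤ j) (hj : j ≤ c.N) :
    S.d (c.x i) (c.x j) ≤ ENNReal.ofReal (c.σ j - c.σ i) := by
  induction j, hij using Nat.le_induction with
  | base => simp [S.d_self]
  | succ j hij ih =>
    have h1 := c.σ_le hij (by omega)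
    have h2 := (c.σ_step j (by omega)).1
    have e : c.σ (j + 1) - c.σ i = (c.σ j - c.σ i) + (c.σ (j + 1) - c.σ j) := by ring
    rw [e, ENNReal.ofReal_add (by linarith) (by linarith)]
    exact (S.d_triangle _ _ _).trans (add_le_add (ih (by omega))
      ((le_self_add.trans le_self_add).trans (c.cost_le j (by omega))))

theorem d_add_residual_le {i j : ℕ} (hij : i < j) (hj : j ≤ c.N) :
    S.d (c.x i) (c.x j) + S.residual (c.t (i + 1)) (c.x i) ≤ ENNReal.ofReal (c.σ j - c.σ i) := by
  have h1 := c.d_le (Nat.succ_le_of_lt hij) hj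
  have h2 := c.cost_le i (by omega)
  have e : c.σ j - c.σ i = (c.σ (i + 1) - c.σ i) + (c.σ j - c.σ (i + 1)) := by ring
  rw [e, ENNReal.ofReal_add (sub_nonneg.2 (c.σ_step i (by omega)).1)
    (sub_nonneg.2 (c.σ_le (Nat.succ_le_of_lt hij) hj))]
  calc _ ≤ (S.d (c.x i) (c.x (i + 1)) + S.d (c.x (i + 1)) (c.x j)) +
        S.residual (c.t (i + 1)) (c.x i) := add_le_add_left (S.d_triangle _ _ _) _
    _ = (S.d (c.x i) (c.x (i + 1)) + S.residual (c.t (i + 1)) (c.x i)) +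
        S.d (c.x (i + 1)) (c.x j) := by ring
    _ ≤ _ := add_le_add ((add_le_add_left le_self_add _).trans h2) h1

theorem residual_le_of_ne {i j : ℕ} (hi : i ≤ c.N) (hj : j ≤ c.N) (hij : i ≠ j) :
    S.residual (c.t (min (j + 1) c.N)) (c.x j) ≤ ENNReal.ofReal |c.a i - c.a j| := by
  rcases lt_or_gt_of_ne hij with h | h
  · obtain ⟨k, rfl⟩ : ∃ k, j = k + 1 := ⟨j - 1, by omega⟩
    refine (c.residual_le k (by omega)).trans (ENNReal.ofReal_le_ofReal ?_)
    have := c.a_mono (show i ≤ k by omega) (by omega)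
    rw [abs_sub_comm]
    exact le_trans (by linarith) (le_abs_self _)
  · rw [min_eq_left (by omega)]
    refine (le_add_self.trans (c.cost_le j (by omega))).trans (ENNReal.ofReal_le_ofReal ?_)
    have h1 := (c.σ_step j (by omega)).2
    have h2 := c.a_mono (show j + 1 ≤ i by omega) hi
    exact le_trans (by linarith) (le_abs_self _)

end Chain

/-- A minimizing step dissipates at least the distance covered plus the residual stability of the
point it leaves. -/
theorem cost_le_of_minimizer {t : ℝ} {x x' : X}
    (h : ∀ V, (S.D x x' : EReal) + (S.energy t x' : EReal) ≤ S.D x V + S.energy t V) :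
    S.energy t x' ≤ S.energy t x ∧
      S.D x x' + S.residual t x ≤ ENNReal.ofReal (S.energy t x - S.energy t x') := by
  have hself : S.D x x = 0 := by simp [D, S.d_self, S.δ_self]
  have h0 := h x
  rw [hself] at h0
  have hD : S.D x x' ≠ ⊤ := fun hD => by simp [hD] at h0
  have key : ∀ V, S.D x V ≠ ⊤ →
      (S.D x x').toReal + S.energy t x' ≤ (S.D x V).toReal + S.energy t V := fun V hV => by
    have := h V
    rw [← ENNReal.ofReal_toReal hD, ← ENNReal.ofReal_toReal hV, EReal.coe_ennreal_ofReal,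
      EReal.coe_ennreal_ofReal, max_eq_left ENNReal.toReal_nonneg,
      max_eq_left ENNReal.toReal_nonneg] at this
    exact_mod_cast this
  have h1 := key x (by simp [hself])
  rw [hself, ENNReal.toReal_zero, zero_add] at h1
  have hnn : 0 ≤ (S.D x x').toReal := ENNReal.toReal_nonneg
  refine ⟨by linarith, ?_⟩
  have hres : S.residual t x ≤
      ENNReal.ofReal (S.energy t x - S.energy t x' - (S.D x x').toReal) := by
    refine iSup_le fun V => ?_
    rw [tsub_le_iff_right]
    by_cases hV : S.D x V = ⊤
    · simp [hV]
    rw [← ENNReal.ofReal_toReal hV, ← ENNReal.ofReal_add (by linarith) ENNReal.toReal_nonneg]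
    refine ENNReal.ofReal_le_ofReal ?_
    linarith [key V hV]
  calc S.D x x' + S.residual t x ≤ ENNReal.ofReal (S.D x x').toReal +
        ENNReal.ofReal (S.energy t x - S.energy t x' - (S.D x x').toReal) := by
        rw [ENNReal.ofReal_toReal hD]; exact add_le_add_right hres _
    _ = _ := by
        rw [← ENNReal.ofReal_add hnn (by linarith)]
        congr 1; ring

theorem exists_le_energy (hA : S.AssumptionA) (C : ℝ) :
    ∃ m : ℝ, 0 ≤ m ∧ ∀ p ∈ S.sublevel C, -m ≤ S.energy p.1 p.2 := by
  by_contra! hcon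
  choose p hp hlt using fun n : ℕ => hcon n n.cast_nonneg
  obtain ⟨q, hq, φ, hφ, hlim⟩ := hA.sublevel_compact C hp
  have := (tendsto_energy_lsc hA (t := q.1) (x := q.2) hq hlim
    (Eventually.of_forall fun n => hp _) one_pos)
  have h2 := (tendsto_natCast_atTop_atTop (R := ℝ)).comp hφ.tendsto_atTop
  obtain ⟨n, h1, h2⟩ := (this.and (h2.eventually_gt_atTop (1 - S.energy q.1 q.2))).exists
  have h3 := hlt (φ n)
  simp only [Function.comp_apply] at h1 h2
  linarith

theorem _root_.TimePartition.t_le {T : ℝ} (τ : TimePartition T) {i j : ℕ} (hij : i ≤ j)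
    (hj : j ≤ τ.N) : τ.t i ≤ τ.t j :=
  Chain.le_of_step (fun j hj => (τ.t_lt j hj).le) hij hj

theorem _root_.TimePartition.t_mem {T : ℝ} (τ : TimePartition T) {j : ℕ} (hj : j ≤ τ.N) :
    τ.t j ∈ Icc 0 T :=
  ⟨τ.t_zero.ge.trans (τ.t_le j.zero_le hj), (τ.t_le hj le_rfl).trans τ.t_last.le⟩

/-- The energy dissipated in the first `j` steps of the scheme. -/
def dissipated (S : RateIndependentSystem X) (t : ℕ → ℝ) (U : ℕ → X) (j : ℕ) : ℝ :=
  ∑ i ∈ Finset.range j, (S.energy (t (i + 1)) (U i) - S.energy (t (i + 1)) (U (i + 1)))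

/-- The discrete energy identity. -/
theorem energy_add_dissipated (t : ℕ → ℝ) (U : ℕ → X) (j : ℕ) :
    S.energy (t j) (U j) + S.dissipated t U j = S.energy (t 0) (U 0) +
      ∑ i ∈ Finset.range j, (S.energy (t (i + 1)) (U i) - S.energy (t i) (U i)) := by
  induction j with
  | zero => simp [dissipated]
  | succ j ih =>
    rw [dissipated, Finset.sum_range_succ, ← dissipated, Finset.sum_range_succ]
    linarith

/-- A priori estimates: discrete solutions with bounded initial energy are chains with uniform
bounds. -/
theorem exists_chain (hA : S.AssumptionA) (B : ℝ) : ∃ C R : ℝ,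
    ∀ (τ : TimePartition S.T) (U : ℕ → X), S.IsDiscreteSolution τ U → S.F 0 (U 0) ≤ B →
      ∃ c : S.Chain C R, c.N = τ.N ∧ c.t = τ.t ∧ c.x = U ∧ c.σ = S.dissipated τ.t U := by
  obtain ⟨κ, hκ, hP, hexp⟩ := exists_F_le_exp_mul hA
  set C := Real.exp (κ * S.T) * (Real.exp (κ * S.T) * B) with hCdef
  obtain ⟨m, hm0, hm⟩ := exists_le_energy hA C
  set V := C + m + κ * C * S.T with hVdef
  refine ⟨C, S.T + V + (V + C), fun τ U hU hB => ?_⟩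
  have hT := S.T_pos
  have h0T : (0 : ℝ) ∈ Icc 0 S.T := ⟨le_rfl, hT.le⟩
  have hB0 : 0 ≤ B := (F_nonneg hA h0T _).trans hB
  have hC0 : 0 ≤ C := by positivity
  have hstep := fun n hn => cost_le_of_minimizer (hU n hn)
  have htm : ∀ {j}, j ≤ τ.N → τ.t j ∈ Icc 0 S.T := fun hj => τ.t_mem hj
  have hFt : ∀ j ≤ τ.N, S.F (τ.t j) (U j) ≤ Real.exp (κ * τ.t j) * B := by
    intro j
    induction j with
    | zero => intro _; simpa [τ.t_zero] using hB
    | succ j ih =>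
      intro hj
      have h1 := ih (by omega)
      have h2 := hexp _ (htm (show j ≤ τ.N by omega)) _ (htm hj) (U j)
      obtain ⟨hE, hc⟩ := hstep j (by omega)
      have hD := le_self_add.trans hc
      have hd : S.d (U j) (U (j + 1)) ≤ ENNReal.ofReal
        (S.energy (τ.t (j + 1)) (U j) - S.energy (τ.t (j + 1)) (U (j + 1))) :=
        le_self_add.trans hD
      have h3 := toReal_d_triangle (ne_top_of_le_ne_top ENNReal.ofReal_ne_top hd)
      have h4 := ENNReal.toReal_mono ENNReal.ofReal_ne_top hd
      rw [ENNReal.toReal_ofReal (by linarith)] at h4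
      have h5 : S.F (τ.t (j + 1)) (U (j + 1)) ≤ S.F (τ.t (j + 1)) (U j) := by
        unfold F; linarith
      refine h5.trans (h2.trans ((mul_le_mul_of_nonneg_left h1 (Real.exp_pos _).le).trans ?_))
      rw [← mul_assoc, ← Real.exp_add, abs_of_nonneg (sub_nonneg.2 (τ.t_le j.le_succ hj))]
      refine le_of_eq ?_
      congr 2; ring
  have hF : ∀ j ≤ τ.N, ∀ s ∈ Icc 0 S.T, S.F s (U j) ≤ C := fun j hj s hs => by
    have h1 := hexp _ (htm hj) s hs (U j)
    have h2 := htm hj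
    have habs : |s - τ.t j| ≤ S.T := abs_le.2 ⟨by linarith [hs.1, h2.2], by linarith [hs.2, h2.1]⟩
    refine h1.trans (mul_le_mul (Real.exp_le_exp.2 (by gcongr)) ((hFt j hj).trans ?_)
      (F_nonneg hA h2 _) (Real.exp_pos _).le)
    gcongr; exact h2.2
  have hPL : ∀ j ≤ τ.N, ∀ r ∈ Icc 0 S.T, |S.power r (U j)| ≤ κ * C := fun j hj r hr =>
    (hP r hr _).trans (mul_le_mul_of_nonneg_left (hF j hj r hr) hκ.le)
  set σ := S.dissipated τ.t U with hσdef
  have hσs : ∀ j, σ (j + 1) - σ j =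
      S.energy (τ.t (j + 1)) (U j) - S.energy (τ.t (j + 1)) (U (j + 1)) := fun j => by
    simp only [hσdef, dissipated, Finset.sum_range_succ]; ring
  have hσ0 : σ 0 = 0 := by simp [hσdef, dissipated]
  have hσV : ∀ j ≤ τ.N, σ j ≤ V := fun j hj => by
    have h1 := S.energy_add_dissipated τ.t U j
    have h2 : ∑ i ∈ Finset.range j, (S.energy (τ.t (i + 1)) (U i) - S.energy (τ.t i) (U i)) ≤
        ∑ i ∈ Finset.range j, κ * C * (τ.t (i + 1) - τ.t i) := by
      refine Finset.sum_le_sum fun i hi => ?_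
      have hi' : i < j := Finset.mem_range.1 hi
      have := energy_sub_le hA (hPL i (by omega)) (htm (show i ≤ τ.N by omega))
        (htm (show i + 1 ≤ τ.N by omega))
      rwa [abs_of_nonneg (sub_nonneg.2 (τ.t_le i.le_succ (by omega)))] at this
    rw [← Finset.mul_sum, Finset.sum_range_sub, τ.t_zero] at h2
    have h3 := hm (τ.t j, U j) ⟨htm hj, hF j hj _ (htm hj)⟩
    have h4 : S.energy (τ.t 0) (U 0) ≤ C :=
      (energy_le_F _ _).trans (hF 0 (Nat.zero_le _) _ (htm (Nat.zero_le _)))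
    have h5 : κ * C * (τ.t j - 0) ≤ κ * C * S.T := by
      have := (htm hj).2
      gcongr; linarith
    simp only at h3
    linarith
  have hσm : ∀ j < τ.N, σ j ≤ σ (j + 1) := fun j hj => by
    have := (hstep j hj).1
    linarith [hσs j]
  have hN : 1 ≤ τ.N := by
    by_contra! h
    have h1 := τ.t_last
    rw [Nat.lt_one_iff.1 h, τ.t_zero] at h1
    linarith
  have hσ1 : 0 ≤ σ 1 := hσ0 ▸ hσm 0 (by omega)
  -- The last two summands of the arclength account for the residual on arrival.
  let a : ℕ → ℝ := fun j => τ.t j + σ j +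
    (σ (min (j + 1) τ.N) + (if j = τ.N then C else 0) - σ 1)
  have ha : ∀ j < τ.N, ∃ e, 0 ≤ e ∧ a (j + 1) - a j = τ.t (j + 1) - τ.t j + (σ (j + 1) - σ j) + e ∧
      S.residual (τ.t (min (j + 2) τ.N)) (U (j + 1)) ≤ ENNReal.ofReal e := fun j hj => by
    rcases (Nat.succ_le_of_lt hj).eq_or_lt with h | h
    · refine ⟨C, hC0, ?_, ?_⟩
      · have e1 : min (j + 1 + 1) τ.N = τ.N := min_eq_right (by omega)
        have e2 : min (j + 1) τ.N = τ.N := min_eq_right (by omega)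
        have e3 : j + 1 = τ.N := h
        simp only [a, e1, e2, if_pos e3, if_neg hj.ne]
        ring
      · rw [min_eq_right (by omega)]
        exact (residual_le_F hA (htm le_rfl) _).trans
          (ENNReal.ofReal_le_ofReal (hF _ (by omega) _ (htm le_rfl)))
    · refine ⟨σ (j + 2) - σ (j + 1), sub_nonneg.2 (hσm _ h), ?_, ?_⟩
      · have e1 : min (j + 1 + 1) τ.N = j + 2 := min_eq_left (by omega)
        have e2 : min (j + 1) τ.N = j + 1 := min_eq_left (by omega)
        have e3 : ¬ j + 1 = τ.N := by omega
        simp only [a, e1, e2, if_neg e3, if_neg hj.ne]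
        ring
      · rw [min_eq_left (by omega), hσs]
        exact le_add_self.trans (hstep (j + 1) h).2
  have ha_le : ∀ j ≤ τ.N, a j ≤ S.T + V + (V + C) := fun j hj => by
    have h1 := (htm hj).2
    have h2 := hσV j hj
    have h3 := hσV (min (j + 1) τ.N) (min_le_right _ _)
    have h4 : (if j = τ.N then C else 0) ≤ C := by split_ifs <;> linarith
    simp only [a]; linarith
  refine ⟨{ N := τ.N, t := τ.t, x := U, σ := σ, a := a, t_mem := fun j hj => htm hj, F_le := hF,
            a_zero := ?_, σ_zero := hσ0, a_le := ha_le, t_step := ?_, σ_step := ?_, cost_le := ?_,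
            residual_le := ?_ }, rfl, rfl, rfl, rfl⟩
  · have : ¬ 0 = τ.N := by omega
    simp [a, τ.t_zero, hσ0, this, min_eq_left hN]
  · intro j hj
    obtain ⟨e, he, h1, -⟩ := ha j hj
    have := hσm j hj
    exact ⟨(τ.t_lt j hj).le, by linarith⟩
  · intro j hj
    obtain ⟨e, he, h1, -⟩ := ha j hj
    have := τ.t_lt j hj
    exact ⟨hσm j hj, by linarith⟩
  · intro j hj
    rw [hσs]; exact (hstep j hj).2
  · intro j hj
    obtain ⟨e, he, h1, h2⟩ := ha j hj
    refine h2.trans (ENNReal.ofReal_le_ofReal ?_)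
    have := hσm j hj
    have := τ.t_lt j hj
    linarith

/-! ### Limits of discrete evolutions in arclength -/

/-- A parametrized evolution: on a compact set `K` of arclength parameters, `ϑ` is the state, `Θ`
the time and `G` the accumulated dissipation. The cost inequalities are those of a chain. -/
structure IsProfile (S : RateIndependentSystem X) (C : ℝ) (K : Set ℝ) (ϑ : ℝ → X)
    (Θ G : ℝ → ℝ) : Prop where
  compact : IsCompact K
  F_le : ∀ b ∈ K, ∀ s ∈ Icc 0 S.T, S.F s (ϑ b) ≤ C
  time_mem : ∀ b ∈ K, Θ b ∈ Icc 0 S.T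
  time_mono : MonotoneOn Θ K
  time_sub_le : ∀ b ∈ K, ∀ b' ∈ K, b ≤ b' → Θ b' - Θ b ≤ b' - b
  G_mono : MonotoneOn G K
  G_sub_le : ∀ b ∈ K, ∀ b' ∈ K, b ≤ b' → G b' - G b ≤ b' - b
  cost_le : ∀ b ∈ K, ∀ b' ∈ K, b < b' →
    S.d (ϑ b) (ϑ b') + S.residual (Θ b) (ϑ b) ≤ ENNReal.ofReal (G b' - G b)
  hole_le : ∀ b b', (b, b') ∈ holes K →
    S.D (ϑ b) (ϑ b') + S.residual (Θ b) (ϑ b) ≤ ENNReal.ofReal (G b' - G b)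
  residual_le : ∀ b ∈ K, ∀ b' ∈ K, b ≠ b' →
    S.residual (Θ b) (ϑ b) ≤ ENNReal.ofReal |b' - b|

/-- Convergence of chains to a parametrized evolution: the sets of arclength parameters converge to
`K`, and whenever parameters converge, even along a subsequence, so do states, times and
dissipations. -/
structure ChainsTendsto {C R : ℝ} (c : ℕ → S.Chain C R) (K : Set ℝ) (ϑ : ℝ → X)
    (Θ G : ℝ → ℝ) : Prop where
  exists_index : ∀ b ∈ K, ∃ j : ℕ → ℕ, (∀ k, j k ≤ (c k).N) ∧
    Tendsto (fun k => (c k).a (j k)) atTop (𝓝 b)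
  tendsto : ∀ ψ : ℕ → ℕ, StrictMono ψ → ∀ j : ℕ → ℕ, (∀ k, j k ≤ (c (ψ k)).N) → ∀ b,
    Tendsto (fun k => (c (ψ k)).a (j k)) atTop (𝓝 b) →
      b ∈ K ∧ Tendsto (fun k => (c (ψ k)).x (j k)) atTop (𝓝 (ϑ b)) ∧
      Tendsto (fun k => (c (ψ k)).t (j k)) atTop (𝓝 (Θ b)) ∧
      Tendsto (fun k => (c (ψ k)).σ (j k)) atTop (𝓝 (G b))

theorem ChainsTendsto.subseq {C R : ℝ} {c : ℕ → S.Chain C R} {K : Set ℝ} {ϑ : ℝ → X}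
    {Θ G : ℝ → ℝ} (h : ChainsTendsto c K ϑ Θ G) {φ : ℕ → ℕ} (hφ : StrictMono φ) :
    ChainsTendsto (fun k => c (φ k)) K ϑ Θ G := by
  refine ⟨fun b hb => ?_, fun ψ hψ j hj b hb => h.tendsto (φ ∘ ψ) (hφ.comp hψ) j hj b hb⟩
  obtain ⟨j, hj, hlim⟩ := h.exists_index b hb
  exact ⟨j ∘ φ, fun k => hj _, hlim.comp hφ.tendsto_atTop⟩

section Limits

variable {C R : ℝ} {c : ℕ → S.Chain C R} {μ : ℕ → ℝ}

theorem Chain.mem_sublevel (c : S.Chain C R) {j : ℕ} (hj : j ≤ c.N) {s : ℝ}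
    (hs : s ∈ Icc 0 S.T) : (s, c.x j) ∈ S.sublevel C := ⟨hs, c.F_le j hj s hs⟩

theorem Chain.a_mem (c : S.Chain C R) {j : ℕ} (hj : j ≤ c.N) : c.a j ∈ Icc 0 R :=
  ⟨c.a_zero.ge.trans (c.a_mono j.zero_le hj), c.a_le j hj⟩

theorem Chain.σ_mem (c : S.Chain C R) {j : ℕ} (hj : j ≤ c.N) : c.σ j ∈ Icc 0 R := by
  have h1 := c.σ_le j.zero_le hj
  have h2 := c.σ_sub_le j.zero_le hj
  have h3 := c.a_le j hj
  rw [c.σ_zero] at h1 h2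
  rw [c.a_zero] at h2
  exact ⟨h1, by linarith⟩

theorem Chain.abs_t_sub_le (c : S.Chain C R) {i j : ℕ} (hi : i ≤ c.N) (hj : j ≤ c.N) :
    |c.t j - c.t i| ≤ |c.a j - c.a i| := by
  rcases le_total i j with h | h
  · rw [abs_of_nonneg (sub_nonneg.2 (c.t_le h hj)), abs_of_nonneg (sub_nonneg.2 (c.a_mono h hj))]
    exact c.t_sub_le h hj
  · rw [abs_sub_comm, abs_sub_comm (c.a j), abs_of_nonneg (sub_nonneg.2 (c.t_le h hi)),
      abs_of_nonneg (sub_nonneg.2 (c.a_mono h hi))]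
    exact c.t_sub_le h hi

theorem Chain.abs_σ_sub_le (c : S.Chain C R) {i j : ℕ} (hi : i ≤ c.N) (hj : j ≤ c.N) :
    |c.σ j - c.σ i| ≤ |c.a j - c.a i| := by
  rcases le_total i j with h | h
  · rw [abs_of_nonneg (sub_nonneg.2 (c.σ_le h hj)), abs_of_nonneg (sub_nonneg.2 (c.a_mono h hj))]
    exact c.σ_sub_le h hj
  · rw [abs_sub_comm, abs_sub_comm (c.a j), abs_of_nonneg (sub_nonneg.2 (c.σ_le h hi)),
      abs_of_nonneg (sub_nonneg.2 (c.a_mono h hi))]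
    exact c.σ_sub_le h hi

theorem tendsto_t_succ (hμ : Tendsto μ atTop (𝓝 0))
    (hmesh : ∀ k, ∀ j < (c k).N, (c k).t (j + 1) - (c k).t j ≤ μ k) {j : ℕ → ℕ}
    (hj : ∀ k, j k ≤ (c k).N) {θ : ℝ} (hθ : Tendsto (fun k => (c k).t (j k)) atTop (𝓝 θ)) :
    Tendsto (fun k => (c k).t (min (j k + 1) (c k).N)) atTop (𝓝 θ) := by
  have h0 : Tendsto (fun k => (c k).t (min (j k + 1) (c k).N) - (c k).t (j k)) atTop (𝓝 0) := by
    have hμ' := hμ.abs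
    rw [abs_zero] at hμ'
    refine squeeze_zero (fun k => ?_) (fun k => ?_) hμ'
    · exact sub_nonneg.2 ((c k).t_le (le_min (Nat.le_succ _) (hj k)) (min_le_right _ _))
    · rcases (hj k).eq_or_lt with h | h
      · rw [min_eq_right (by omega), h, sub_self]; exact abs_nonneg _
      · rw [min_eq_left (by omega)]; exact (hmesh k _ h).trans (le_abs_self _)
  simpa using h0.add hθ

theorem residual_le_of_tendsto (hC : S.AssumptionC) (hA : S.AssumptionA)
    (hμ : Tendsto μ atTop (𝓝 0))
    (hmesh : ∀ k, ∀ j < (c k).N, (c k).t (j + 1) - (c k).t j ≤ μ k) {i j : ℕ → ℕ}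
    (hi : ∀ k, i k ≤ (c k).N) (hj : ∀ k, j k ≤ (c k).N) (hij : ∀ᶠ k in atTop, i k ≠ j k)
    {b b' θ : ℝ} {z : X} (hb : Tendsto (fun k => (c k).a (i k)) atTop (𝓝 b))
    (hb' : Tendsto (fun k => (c k).a (j k)) atTop (𝓝 b'))
    (hθ : Tendsto (fun k => (c k).t (j k)) atTop (𝓝 θ))
    (hz : Tendsto (fun k => (c k).x (j k)) atTop (𝓝 z)) :
    S.residual θ z ≤ ENNReal.ofReal |b - b'| := by
  have hmem : ∀ k, ((c k).t (min (j k + 1) (c k).N), (c k).x (j k)) ∈ S.sublevel C := fun k =>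
    (c k).mem_sublevel (hj k) ((c k).t_mem _ (min_le_right _ _))
  have hlim := (tendsto_t_succ hμ hmesh hj hθ).prodMk_nhds hz
  refine LowerSemicontinuousWithinAt.le_of_tendsto_of_le
    (lowerSemicontinuousOn_residual hC C _ ?_) hlim (Eventually.of_forall hmem)
    (ENNReal.tendsto_ofReal (hb.sub hb').abs) ?_
  · exact (isClosed_sublevel hC hA C).mem_of_tendsto hlim (Eventually.of_forall hmem)
  · filter_upwards [hij] with k hk using (c k).residual_le_of_ne (hi k) (hj k) hk

theorem d_le_of_tendsto {i j : ℕ → ℕ} (hj : ∀ k, j k ≤ (c k).N) (hij : ∀ᶠ k in atTop, i k ≤ j k)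
    {s s' : ℝ} {z z' : X} (hs : Tendsto (fun k => (c k).σ (i k)) atTop (𝓝 s))
    (hs' : Tendsto (fun k => (c k).σ (j k)) atTop (𝓝 s'))
    (hz : Tendsto (fun k => (c k).x (i k)) atTop (𝓝 z))
    (hz' : Tendsto (fun k => (c k).x (j k)) atTop (𝓝 z')) :
    S.d z z' ≤ ENNReal.ofReal (s' - s) := by
  refine S.d_lsc.le_of_tendsto_of_le (hz.prodMk_nhds hz')
    (ENNReal.tendsto_ofReal (hs'.sub hs)) ?_
  filter_upwards [hij] with k hk using (c k).d_le hk (hj k)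

theorem lowerSemicontinuousOn_cost (hC : S.AssumptionC) (C : ℝ) {e : X → X → ℝ≥0∞}
    (he : LowerSemicontinuous fun p : X × X => e p.1 p.2) :
    LowerSemicontinuousOn (fun p : (ℝ × X) × X => e p.1.2 p.2 + S.residual p.1.1 p.1.2)
      (S.sublevel C ×ˢ univ) := by
  refine LowerSemicontinuousOn.add ?_ ?_
  · exact (he.comp (g := fun p : (ℝ × X) × X => (p.1.2, p.2)) (by fun_prop)).lowerSemicontinuousOn _
  · intro p hp
    exact LowerSemicontinuousWithinAt.comp (f := fun q : ℝ × X => S.residual q.1 q.2)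
      (g := fun p : (ℝ × X) × X => p.1)
      (lowerSemicontinuousOn_residual hC C p.1 hp.1) continuous_fst.continuousWithinAt
      (fun q hq => hq.1)

theorem cost_le_of_tendsto (hC : S.AssumptionC) (hA : S.AssumptionA)
    (hμ : Tendsto μ atTop (𝓝 0))
    (hmesh : ∀ k, ∀ j < (c k).N, (c k).t (j + 1) - (c k).t j ≤ μ k) {e : X → X → ℝ≥0∞}
    (he : LowerSemicontinuous fun p : X × X => e p.1 p.2) {i j : ℕ → ℕ}
    (hi : ∀ k, i k ≤ (c k).N) {θ s s' : ℝ} {z z' : X}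
    (hcost : ∀ᶠ k in atTop, i k + 1 ≤ (c k).N ∧
      e ((c k).x (i k)) ((c k).x (j k)) + S.residual ((c k).t (i k + 1)) ((c k).x (i k)) ≤
      ENNReal.ofReal ((c k).σ (j k) - (c k).σ (i k)))
    (hθ : Tendsto (fun k => (c k).t (i k)) atTop (𝓝 θ))
    (hs : Tendsto (fun k => (c k).σ (i k)) atTop (𝓝 s))
    (hs' : Tendsto (fun k => (c k).σ (j k)) atTop (𝓝 s'))
    (hz : Tendsto (fun k => (c k).x (i k)) atTop (𝓝 z))
    (hz' : Tendsto (fun k => (c k).x (j k)) atTop (𝓝 z')) :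
    e z z' + S.residual θ z ≤ ENNReal.ofReal (s' - s) := by
  have hmem : ∀ k, ((c k).t (min (i k + 1) (c k).N), (c k).x (i k)) ∈ S.sublevel C := fun k =>
    (c k).mem_sublevel (hi k) ((c k).t_mem _ (min_le_right _ _))
  have hlim := (tendsto_t_succ hμ hmesh hi hθ).prodMk_nhds hz
  refine LowerSemicontinuousWithinAt.le_of_tendsto_of_le
    (lowerSemicontinuousOn_cost hC C he ((θ, z), z') ⟨?_, mem_univ _⟩) (hlim.prodMk_nhds hz')
    (Eventually.of_forall fun k => ⟨hmem k, mem_univ _⟩)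
    (ENNReal.tendsto_ofReal (hs'.sub hs)) ?_
  · exact (isClosed_sublevel hC hA C).mem_of_tendsto hlim (Eventually.of_forall hmem)
  · filter_upwards [hcost] with k hk
    rw [min_eq_left hk.1]
    exact hk.2

open Classical in
/-- The first index at which the arclength reaches `q` (the last index if it does not). -/
noncomputable def Chain.index (c : S.Chain C R) (q : ℝ) : ℕ :=
  Nat.find (p := fun j => j = c.N ∨ q ≤ c.a j) ⟨c.N, Or.inl rfl⟩

open Classical in
theorem Chain.index_le (c : S.Chain C R) (q : ℝ) : c.index q ≤ c.N :=
  Nat.find_min' _ (Or.inl rfl)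

open Classical in
theorem Chain.index_le_of_le (c : S.Chain C R) {q : ℝ} {j : ℕ} (h : q ≤ c.a j) : c.index q ≤ j :=
  Nat.find_min' _ (Or.inr h)

open Classical in
theorem Chain.le_a_index (c : S.Chain C R) {q : ℝ} {j : ℕ} (hj : j ≤ c.N) (h : q ≤ c.a j) :
    q ≤ c.a (c.index q) := by
  rcases Nat.find_spec (p := fun j => j = c.N ∨ q ≤ c.a j) ⟨c.N, Or.inl rfl⟩ with h' | h'
  · have h1 : c.index q = c.N := h'
    have h2 := c.index_le_of_le h
    rw [show j = c.index q by omega] at h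
    exact h
  · exact h'

theorem Chain.lt_index (c : S.Chain C R) {q : ℝ} {j : ℕ} (hj : j < c.N) (h : c.a j < q) :
    j < c.index q := by
  classical
  by_contra! hle
  rcases Nat.find_spec (p := fun j => j = c.N ∨ q ≤ c.a j) ⟨c.N, Or.inl rfl⟩ with h' | h'
  · have h1 : c.index q = c.N := h'
    omega
  · have h1 : q ≤ c.a (c.index q) := h'
    linarith [c.a_mono hle hj.le]

/-- Two families of chain points at the same arclength in the limit have the same limit: if they
do not eventually coincide, their residuals vanish and so does their distance in one order. -/
theorem tendsto_of_tendsto_of_a_sub [T2Space X] (hA : S.AssumptionA) (hC : S.AssumptionC)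
    (hμ : Tendsto μ atTop (𝓝 0))
    (hmesh : ∀ k, ∀ j < (c k).N, (c k).t (j + 1) - (c k).t j ≤ μ k) {i j : ℕ → ℕ}
    (hi : ∀ k, i k ≤ (c k).N) (hj : ∀ k, j k ≤ (c k).N) {b θ s : ℝ} {z : X}
    (hbi : Tendsto (fun k => (c k).a (i k)) atTop (𝓝 b))
    (hbj : Tendsto (fun k => (c k).a (j k)) atTop (𝓝 b))
    (hθ : Tendsto (fun k => (c k).t (i k)) atTop (𝓝 θ))
    (hs : Tendsto (fun k => (c k).σ (i k)) atTop (𝓝 s))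
    (hz : Tendsto (fun k => (c k).x (i k)) atTop (𝓝 z)) :
    Tendsto (fun k => (c k).x (j k)) atTop (𝓝 z) ∧
      Tendsto (fun k => (c k).t (j k)) atTop (𝓝 θ) ∧
      Tendsto (fun k => (c k).σ (j k)) atTop (𝓝 s) := by
  have hab : Tendsto (fun k => |(c k).a (j k) - (c k).a (i k)|) atTop (𝓝 0) := by
    simpa using (hbj.sub hbi).abs
  have ht : Tendsto (fun k => (c k).t (j k)) atTop (𝓝 θ) := by
    have := (squeeze_zero_norm (fun k => (c k).abs_t_sub_le (hi k) (hj k)) hab).add hθ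
    simpa using this
  have hσ : Tendsto (fun k => (c k).σ (j k)) atTop (𝓝 s) := by
    have := (squeeze_zero_norm (fun k => (c k).abs_σ_sub_le (hi k) (hj k)) hab).add hs
    simpa using this
  refine ⟨?_, ht, hσ⟩
  have hpair : Tendsto (fun k => ((c k).t (j k), (c k).x (j k))) atTop (𝓝 (θ, z)) := by
    refine (hA.sublevel_compact C).tendsto_of_unique (Eventually.of_forall fun k =>
      (c k).mem_sublevel (hj k) ((c k).t_mem _ (hj k))) fun ψ hψ w hw => ?_
    have hwt : w.1 = θ := tendsto_nhds_unique ((continuous_fst.tendsto w).comp hw)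
      (ht.comp hψ.tendsto_atTop)
    have hwx := (continuous_snd.tendsto w).comp hw
    refine Prod.ext hwt ?_
    have hψt := hψ.tendsto_atTop
    by_cases hfreq : ∃ᶠ k in atTop, i (ψ k) ≠ j (ψ k)
    swap
    · have hev : ∀ᶠ k in atTop, i (ψ k) = j (ψ k) := by simpa using hfreq
      refine tendsto_nhds_unique hwx ((hz.comp hψt).congr' ?_)
      filter_upwards [hev] with k hk
      simp [hk]
    obtain ⟨χ, hχ, hne⟩ := extraction_of_frequently_atTop hfreq
    have hχt := hχ.tendsto_atTop
    have hcomp := hψt.comp hχt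
    have h1 : S.residual θ z ≤ ENNReal.ofReal |b - b| :=
      residual_le_of_tendsto (c := fun k => c (ψ (χ k))) (μ := fun k => μ (ψ (χ k))) hC hA
        (hμ.comp hcomp) (fun k => hmesh _) (fun k => hj _) (fun k => hi _)
        (Eventually.of_forall fun k => (hne k).symm) (hbj.comp hcomp) (hbi.comp hcomp)
        (hθ.comp hcomp) (hz.comp hcomp)
    have h2 : S.residual θ w.2 ≤ ENNReal.ofReal |b - b| :=
      residual_le_of_tendsto (c := fun k => c (ψ (χ k))) (μ := fun k => μ (ψ (χ k))) hC hA
        (hμ.comp hcomp) (fun k => hmesh _) (fun k => hi _) (fun k => hj _)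
        (Eventually.of_forall hne) (hbi.comp hcomp) (hbj.comp hcomp)
        (ht.comp hcomp) (hwx.comp hχt)
    simp only [sub_self, abs_zero, ENNReal.ofReal_zero, nonpos_iff_eq_zero,
      ← stable_iff_residual_eq_zero] at h1 h2
    have hθm : θ ∈ Icc 0 S.T :=
      isClosed_Icc.mem_of_tendsto hθ (Eventually.of_forall fun k => (c k).t_mem _ (hi k))
    by_cases hlt : ∃ᶠ k in atTop, i (ψ (χ k)) < j (ψ (χ k))
    · obtain ⟨ω, hω, hlt'⟩ := extraction_of_frequently_atTop hlt
      have hω' := hcomp.comp hω.tendsto_atTop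
      have h3 := d_le_of_tendsto (c := fun k => c (ψ (χ (ω k)))) (fun k => hj _)
        (Eventually.of_forall fun k => (hlt' k).le) (hs.comp hω') (hσ.comp hω') (hz.comp hω')
        (hwx.comp (hχt.comp hω.tendsto_atTop))
      rw [sub_self, ENNReal.ofReal_zero, nonpos_iff_eq_zero] at h3
      exact (hC.separated θ hθm _ _ h1 h2 h3).symm
    · have h3 := d_le_of_tendsto (c := fun k => c (ψ (χ k))) (fun k => hi _)
        ((not_frequently.1 hlt).mono fun k hk => not_lt.1 hk) (hσ.comp hcomp) (hs.comp hcomp)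
        (hwx.comp hχt) (hz.comp hcomp)
      rw [sub_self, ENNReal.ofReal_zero, nonpos_iff_eq_zero] at h3
      exact hC.separated θ hθm _ _ h2 h1 h3
  exact (continuous_snd.tendsto _).comp hpair

end Limits

section Compactness

variable {C R : ℝ} {c : ℕ → S.Chain C R} {μ : ℕ → ℝ}

/-- If the chain points of first arclength `≥ q` converge for all rational `q`, then the chain
points converge at every arclength. At an arclength `b` which is not one of the countably many
limits, `b` is approached from the left by these limits, whose states converge to a stable point;
any limit state at `b` is stable and at distance zero from it. -/
theorem exists_limit_at [T2Space X] (hA : S.AssumptionA) (hC : S.AssumptionC)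
    (hμ : Tendsto μ atTop (𝓝 0))
    (hmesh : ∀ k, ∀ j < (c k).N, (c k).t (j + 1) - (c k).t j ≤ μ k)
    {l θ s : ℚ → ℝ} {p : ℚ → X}
    (hl : ∀ q : ℚ, Tendsto (fun k => (c k).a ((c k).index q)) atTop (𝓝 (l q)))
    (hθ : ∀ q : ℚ, Tendsto (fun k => (c k).t ((c k).index q)) atTop (𝓝 (θ q)))
    (hs : ∀ q : ℚ, Tendsto (fun k => (c k).σ ((c k).index q)) atTop (𝓝 (s q)))
    (hp : ∀ q : ℚ, Tendsto (fun k => (c k).x ((c k).index q)) atTop (𝓝 (p q))) (b : ℝ) :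
    ∃ (z : X) (θ' s' : ℝ), ∀ ψ : ℕ → ℕ, StrictMono ψ → ∀ j : ℕ → ℕ,
      (∀ k, j k ≤ (c (ψ k)).N) → Tendsto (fun k => (c (ψ k)).a (j k)) atTop (𝓝 b) →
      (∀ ε : ℝ, 0 < ε → ∃ q, |l q - b| < ε) ∧
      Tendsto (fun k => (c (ψ k)).x (j k)) atTop (𝓝 z) ∧
      Tendsto (fun k => (c (ψ k)).t (j k)) atTop (𝓝 θ') ∧
      Tendsto (fun k => (c (ψ k)).σ (j k)) atTop (𝓝 s') := by
  by_cases hq : ∃ q, l q = b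
  · obtain ⟨q, rfl⟩ := hq
    refine ⟨p q, θ q, s q, fun ψ hψ j hj hlim => ⟨fun ε hε => ⟨q, by simpa using hε⟩, ?_⟩⟩
    have hψt := hψ.tendsto_atTop
    exact tendsto_of_tendsto_of_a_sub (c := fun k => c (ψ k)) (μ := fun k => μ (ψ k)) hA hC
      (hμ.comp hψt) (fun k => hmesh _) (fun k => (c (ψ k)).index_le q) hj ((hl q).comp hψt) hlim
      ((hθ q).comp hψt) ((hs q).comp hψt) ((hp q).comp hψt)
  have hidx : ∀ ψ : ℕ → ℕ, StrictMono ψ → ∀ j : ℕ → ℕ, (∀ k, j k ≤ (c (ψ k)).N) →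
      Tendsto (fun k => (c (ψ k)).a (j k)) atTop (𝓝 b) → ∀ q : ℚ, (q : ℝ) < b →
      (∀ᶠ k in atTop, (c (ψ k)).index q < j k) ∧ (q : ℝ) ≤ l q ∧ l q < b := by
    intro ψ hψ j hj hlim q hqb
    have hlq := (hl q).comp hψ.tendsto_atTop
    have hev := hlim.eventually (lt_mem_nhds hqb)
    have h1 : (q : ℝ) ≤ l q := by
      refine ge_of_tendsto hlq ?_
      filter_upwards [hev] with k hk using (c (ψ k)).le_a_index (hj k) hk.le
    have h2 : l q ≤ b := by
      refine le_of_tendsto_of_tendsto hlq hlim ?_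
      filter_upwards [hev] with k hk
        using (c (ψ k)).a_mono ((c (ψ k)).index_le_of_le hk.le) (hj k)
    have h3 : l q < b := lt_of_le_of_ne h2 fun h => hq ⟨q, h⟩
    obtain ⟨m, hm1, hm2⟩ := exists_between h3
    refine ⟨?_, h1, h3⟩
    filter_upwards [hlq.eventually (gt_mem_nhds hm1), hlim.eventually (lt_mem_nhds hm2)]
      with k h4 h5
    by_contra! hle
    have := (c (ψ k)).a_mono hle ((c (ψ k)).index_le q)
    simp only [Function.comp_apply] at h4
    linarith
  by_cases hex : ∃ ψ : ℕ → ℕ, StrictMono ψ ∧ ∃ j : ℕ → ℕ, (∀ k, j k ≤ (c (ψ k)).N) ∧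
      Tendsto (fun k => (c (ψ k)).a (j k)) atTop (𝓝 b)
  swap
  · exact ⟨p 0, 0, 0, fun ψ hψ j hj hlim => absurd ⟨ψ, hψ, j, hj, hlim⟩ hex⟩
  obtain ⟨ψ₀, hψ₀, j₀, hj₀, hlim₀⟩ := hex
  have hq_ex : ∀ n : ℕ, ∃ q : ℚ, b - 1 / ((n : ℝ) + 1) < q ∧ (q : ℝ) < b := fun n =>
    exists_rat_btwn (sub_lt_self b (by positivity))
  choose q hq1 hq2 using hq_ex
  have hlq : Tendsto (fun n => l (q n)) atTop (𝓝 b) := by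
    refine tendsto_of_tendsto_of_tendsto_of_le_of_le (g := fun n : ℕ => b - 1 / ((n : ℝ) + 1))
      (h := fun _ => b) ?_ tendsto_const_nhds
      (fun n => (hq1 n).le.trans (hidx ψ₀ hψ₀ j₀ hj₀ hlim₀ _ (hq2 n)).2.1)
      (fun n => (hidx ψ₀ hψ₀ j₀ hj₀ hlim₀ _ (hq2 n)).2.2.le)
    simpa using tendsto_const_nhds (x := b) |>.sub tendsto_one_div_add_atTop_nhds_zero_nat
  have hcl := isClosed_sublevel hC hA C
  have hmem : ∀ q, (θ q, p q) ∈ S.sublevel C := fun q =>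
    hcl.mem_of_tendsto ((hθ q).prodMk_nhds (hp q)) (Eventually.of_forall fun k =>
      (c k).mem_sublevel ((c k).index_le q) ((c k).t_mem _ ((c k).index_le q)))
  have hsR : ∀ q, s q ∈ Icc 0 R := fun q =>
    isClosed_Icc.mem_of_tendsto (hs q) (Eventually.of_forall fun k =>
      (c k).σ_mem ((c k).index_le q))
  have hcpt : IsSeqCompact (S.sublevel C ×ˢ Icc (0 : ℝ) R) :=
    (hA.sublevel_compact C).prod isCompact_Icc.isSeqCompact
  obtain ⟨⟨⟨θ', z⟩, s'⟩, hmem', χ, hχ, hχlim⟩ :=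
    hcpt (x := fun n => ((θ (q n), p (q n)), s (q n))) (fun n => ⟨hmem _, hsR _⟩)
  have hχp := (continuous_fst.tendsto _).comp hχlim
  have hχθ : Tendsto (fun n => θ (q (χ n))) atTop (𝓝 θ') := (continuous_fst.tendsto _).comp hχp
  have hχz : Tendsto (fun n => p (q (χ n))) atTop (𝓝 z) := (continuous_snd.tendsto _).comp hχp
  have hχs : Tendsto (fun n => s (q (χ n))) atTop (𝓝 s') := (continuous_snd.tendsto _).comp hχlim
  have hχl : Tendsto (fun n => l (q (χ n))) atTop (𝓝 b) := hlq.comp hχ.tendsto_atTop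
  have hgap : Tendsto (fun n => |b - l (q (χ n))|) atTop (𝓝 0) := by
    simpa using (tendsto_const_nhds (x := b) |>.sub hχl).abs
  have hgap' : Tendsto (fun n => ENNReal.ofReal |b - l (q (χ n))|) atTop (𝓝 0) := by
    simpa using ENNReal.tendsto_ofReal hgap
  -- The states at the approximating arclengths have small residual.
  have hres : ∀ n, S.residual (θ (q n)) (p (q n)) ≤ ENNReal.ofReal |b - l (q n)| := fun n => by
    have hψt := hψ₀.tendsto_atTop
    exact residual_le_of_tendsto (c := fun k => c (ψ₀ k)) (μ := fun k => μ (ψ₀ k)) hC hA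
      (hμ.comp hψt) (fun k => hmesh _) hj₀ (fun k => (c (ψ₀ k)).index_le _)
      ((hidx ψ₀ hψ₀ j₀ hj₀ hlim₀ _ (hq2 n)).1.mono fun k hk => hk.ne') hlim₀
      ((hl _).comp hψt) ((hθ _).comp hψt) ((hp _).comp hψt)
  have hz : S.Stable θ' z := by
    rw [stable_iff_residual_eq_zero, ← nonpos_iff_eq_zero]
    exact LowerSemicontinuousWithinAt.le_of_tendsto_of_le
      (lowerSemicontinuousOn_residual hC C _ hmem'.1) hχp (Eventually.of_forall fun n => hmem _)
      hgap' (Eventually.of_forall fun n => hres _)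
  refine ⟨z, θ', s', fun ψ hψ j hj hlim => ⟨fun ε hε => ?_, ?_⟩⟩
  · obtain ⟨n, hn⟩ := (hlq.eventually (Metric.ball_mem_nhds b hε)).exists
    exact ⟨q n, hn⟩
  have hψt := hψ.tendsto_atTop
  have hall : Tendsto (fun k => (((c (ψ k)).t (j k), (c (ψ k)).x (j k)), (c (ψ k)).σ (j k))) atTop
      (𝓝 ((θ', z), s')) := by
    refine hcpt.tendsto_of_unique (Eventually.of_forall fun k =>
      ⟨(c (ψ k)).mem_sublevel (hj k) ((c (ψ k)).t_mem _ (hj k)), (c (ψ k)).σ_mem (hj k)⟩)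
      fun ω hω w hw => ?_
    obtain ⟨⟨θw, xw⟩, sw⟩ := w
    have hωt := hψt.comp hω.tendsto_atTop
    have hwp := (continuous_fst.tendsto _).comp hw
    have hwθ : Tendsto (fun k => (c (ψ (ω k))).t (j (ω k))) atTop (𝓝 θw) :=
      (continuous_fst.tendsto _).comp hwp
    have hwx : Tendsto (fun k => (c (ψ (ω k))).x (j (ω k))) atTop (𝓝 xw) :=
      (continuous_snd.tendsto _).comp hwp
    have hws : Tendsto (fun k => (c (ψ (ω k))).σ (j (ω k))) atTop (𝓝 sw) :=
      (continuous_snd.tendsto _).comp hw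
    have hwa : Tendsto (fun k => (c (ψ (ω k))).a (j (ω k))) atTop (𝓝 b) :=
      hlim.comp hω.tendsto_atTop
    have hθw : θw = θ' := by
      have h1 : ∀ n, |θw - θ (q n)| ≤ |b - l (q n)| := fun n =>
        le_of_tendsto_of_tendsto (hwθ.sub ((hθ _).comp hωt)).abs (hwa.sub ((hl _).comp hωt)).abs
          (Eventually.of_forall fun k =>
            (c (ψ (ω k))).abs_t_sub_le ((c (ψ (ω k))).index_le _) (hj (ω k)))
      have h2 := squeeze_zero (fun n => abs_nonneg _) (fun n => h1 (χ n)) hgap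
      have h3 := tendsto_nhds_unique h2 (tendsto_const_nhds.sub hχθ).abs
      exact sub_eq_zero.1 (abs_eq_zero.1 h3.symm)
    have hsw : sw = s' := by
      have h1 : ∀ n, |sw - s (q n)| ≤ |b - l (q n)| := fun n =>
        le_of_tendsto_of_tendsto (hws.sub ((hs _).comp hωt)).abs (hwa.sub ((hl _).comp hωt)).abs
          (Eventually.of_forall fun k =>
            (c (ψ (ω k))).abs_σ_sub_le ((c (ψ (ω k))).index_le _) (hj (ω k)))
      have h2 := squeeze_zero (fun n => abs_nonneg _) (fun n => h1 (χ n)) hgap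
      have h3 := tendsto_nhds_unique h2 (tendsto_const_nhds.sub hχs).abs
      exact sub_eq_zero.1 (abs_eq_zero.1 h3.symm)
    subst hθw hsw
    have hidx' := fun n => (hidx (ψ ∘ ω) (hψ.comp hω) (j ∘ ω) (fun k => hj _) hwa _ (hq2 n)).1
    have hw_stable : S.Stable θw xw := by
      rw [stable_iff_residual_eq_zero, ← nonpos_iff_eq_zero]
      have h0 : Tendsto (fun n => ENNReal.ofReal |l (q (χ n)) - b|) atTop (𝓝 0) := by
        simpa only [abs_sub_comm] using hgap'
      refine ge_of_tendsto' h0 fun n => ?_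
      exact residual_le_of_tendsto (c := fun k => c (ψ (ω k))) (μ := fun k => μ (ψ (ω k))) hC hA
        (hμ.comp hωt) (fun k => hmesh _) (fun k => (c (ψ (ω k))).index_le _) (fun k => hj _)
        ((hidx' (χ n)).mono fun k hk => hk.ne) ((hl _).comp hωt) hwa hwθ hwx
    have hd : S.d z xw ≤ ENNReal.ofReal (sw - sw) := by
      refine S.d_lsc.le_of_tendsto_of_le (hχz.prodMk_nhds tendsto_const_nhds)
        (ENNReal.tendsto_ofReal (tendsto_const_nhds.sub hχs)) (Eventually.of_forall fun n => ?_)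
      exact d_le_of_tendsto (c := fun k => c (ψ (ω k))) (fun k => hj _)
        ((hidx' (χ n)).mono fun k hk => hk.le) ((hs _).comp hωt) hws ((hp _).comp hωt) hwx
    rw [sub_self, ENNReal.ofReal_zero, nonpos_iff_eq_zero] at hd
    rw [hC.separated θw hmem'.1.1 _ _ hz hw_stable hd]
  have h1 := (continuous_fst.tendsto _).comp hall
  exact ⟨(continuous_snd.tendsto _).comp h1, (continuous_fst.tendsto _).comp h1,
    (continuous_snd.tendsto _).comp hall⟩

/-- Chains with uniform bounds and vanishing mesh converge along a subsequence. -/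
theorem exists_chainsTendsto [T2Space X] (hA : S.AssumptionA) (hC : S.AssumptionC)
    (hμ : Tendsto μ atTop (𝓝 0))
    (hmesh : ∀ k, ∀ j < (c k).N, (c k).t (j + 1) - (c k).t j ≤ μ k) :
    ∃ φ : ℕ → ℕ, StrictMono φ ∧ ∃ (K : Set ℝ) (ϑ : ℝ → X) (Θ G : ℝ → ℝ),
      ChainsTendsto (fun k => c (φ k)) K ϑ Θ G := by
  have hcpt : IsSeqCompact (S.sublevel C ×ˢ (Icc (0 : ℝ) R ×ˢ Icc (0 : ℝ) R)) :=
    (hA.sublevel_compact C).prod (isCompact_Icc.isSeqCompact.prod isCompact_Icc.isSeqCompact)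
  obtain ⟨φ, hφ, hlim⟩ := hcpt.exists_subseq_forall (ι := ℚ)
    (fun q k => (((c k).t ((c k).index q), (c k).x ((c k).index q)),
      ((c k).a ((c k).index q), (c k).σ ((c k).index q))))
    (fun q k => ⟨(c k).mem_sublevel ((c k).index_le q) ((c k).t_mem _ ((c k).index_le q)),
      (c k).a_mem ((c k).index_le q), (c k).σ_mem ((c k).index_le q)⟩)
  choose L _ hL using hlim
  have h1 := fun q => (continuous_fst.tendsto _).comp (hL q)
  have h2 := fun q => (continuous_snd.tendsto _).comp (hL q)
  have hl : ∀ q : ℚ, Tendsto (fun k => (c (φ k)).a ((c (φ k)).index q)) atTop (𝓝 (L q).2.1) :=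
    fun q => (continuous_fst.tendsto _).comp (h2 q)
  choose ϑ Θ G hlim using exists_limit_at (c := fun k => c (φ k)) hA hC
    (hμ.comp hφ.tendsto_atTop) (fun k => hmesh _)
    hl (fun q : ℚ => (continuous_fst.tendsto _).comp (h1 q))
    (fun q : ℚ => (continuous_snd.tendsto _).comp (h2 q))
    (fun q : ℚ => (continuous_snd.tendsto _).comp (h1 q))
  refine ⟨φ, hφ, {b | ∀ ε : ℝ, 0 < ε → ∀ᶠ k in atTop, ∃ j ≤ (c (φ k)).N,
    |(c (φ k)).a j - b| < ε}, ϑ, Θ, G, fun b hb => ?_, fun ψ hψ j hj b hb => ?_⟩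
  · have hmin := fun k => Finset.exists_min_image (Finset.range ((c (φ k)).N + 1))
      (fun j => |(c (φ k)).a j - b|) ⟨0, by simp⟩
    choose j hj hjmin using hmin
    refine ⟨j, fun k => by simpa [Nat.lt_succ_iff] using hj k,
      Metric.tendsto_atTop'.2 fun ε hε => ?_⟩
    obtain ⟨n, hn⟩ := (hb ε hε).exists_forall_of_atTop
    refine ⟨n, fun k hk => ?_⟩
    obtain ⟨i, hi, hlt⟩ := hn k hk.le
    exact (hjmin k i (by simpa [Nat.lt_succ_iff] using hi)).trans_lt hlt
  · obtain ⟨hnear, hrest⟩ := hlim b ψ hψ j hj hb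
    refine ⟨fun ε hε => ?_, hrest⟩
    obtain ⟨q, hq⟩ := hnear (ε / 2) (by linarith)
    filter_upwards [(hl q).eventually (Metric.ball_mem_nhds _ (half_pos hε))] with k hk
    refine ⟨_, (c (φ k)).index_le q, ?_⟩
    rw [Real.dist_eq] at hk
    calc _ ≤ |(c (φ k)).a ((c (φ k)).index q) - (L q).2.1| + |(L q).2.1 - b| := abs_sub_le _ _ _
      _ < ε := by linarith

/-- Limits of chains satisfy the cost inequalities. -/
theorem ChainsTendsto.isProfile (hA : S.AssumptionA) (hC : S.AssumptionC)
    (hμ : Tendsto μ atTop (𝓝 0))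
    (hmesh : ∀ k, ∀ j < (c k).N, (c k).t (j + 1) - (c k).t j ≤ μ k) {K : Set ℝ} {ϑ : ℝ → X}
    {Θ G : ℝ → ℝ} (h : ChainsTendsto c K ϑ Θ G) : IsProfile S C K ϑ Θ G := by
  have hlim : ∀ b ∈ K, ∃ j : ℕ → ℕ, (∀ k, j k ≤ (c k).N) ∧
      Tendsto (fun k => (c k).a (j k)) atTop (𝓝 b) ∧
      Tendsto (fun k => (c k).x (j k)) atTop (𝓝 (ϑ b)) ∧
      Tendsto (fun k => (c k).t (j k)) atTop (𝓝 (Θ b)) ∧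
      Tendsto (fun k => (c k).σ (j k)) atTop (𝓝 (G b)) := fun b hb => by
    obtain ⟨j, hj, hja⟩ := h.exists_index b hb
    exact ⟨j, hj, hja, (h.tendsto id strictMono_id j hj b hja).2⟩
  choose! j hj ha hx ht hσ using hlim
  have hlt : ∀ b ∈ K, ∀ b' ∈ K, b < b' → ∀ᶠ k in atTop, j b k < j b' k := fun b hb b' hb' hbb' => by
    obtain ⟨m, hm1, hm2⟩ := exists_between hbb'
    filter_upwards [(ha b hb).eventually (gt_mem_nhds hm1),
      (ha b' hb').eventually (lt_mem_nhds hm2)] with k h1 h2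
    by_contra! hle
    have := (c k).a_mono hle (hj b hb k)
    linarith
  have hle : ∀ b ∈ K, ∀ b' ∈ K, b ≤ b' → ∀ᶠ k in atTop, j b k ≤ j b' k :=
    fun b hb b' hb' hbb' => by
      rcases hbb'.eq_or_lt with rfl | h'
      · exact Eventually.of_forall fun _ => le_rfl
      · exact (hlt b hb b' hb' h').mono fun _ => le_of_lt
  have hKR : K ⊆ Icc 0 R := fun b hb =>
    isClosed_Icc.mem_of_tendsto (ha b hb) (Eventually.of_forall fun k => (c k).a_mem (hj b hb k))
  have hclosed : IsClosed K := by
    refine isClosed_of_closure_subset fun b hb => ?_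
    -- Choose indices along a subsequence whose arclengths converge to `b`.
    have hnear : ∀ n : ℕ, ∃ᶠ k in atTop, ∃ i ≤ (c k).N, |(c k).a i - b| < 1 / ((n : ℝ) + 1) :=
      fun n => by
        have hpos : (0 : ℝ) < 1 / ((n : ℝ) + 1) / 2 := by positivity
        obtain ⟨b', hb'K, hb'⟩ := Metric.mem_closure_iff.1 hb _ hpos
        rw [Real.dist_eq, abs_sub_comm] at hb'
        refine Eventually.frequently ?_
        filter_upwards [(ha b' hb'K).eventually (Metric.ball_mem_nhds _ hpos)] with k hk
        rw [Real.dist_eq] at hk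
        refine ⟨_, hj b' hb'K k, ?_⟩
        calc _ ≤ |(c k).a (j b' k) - b'| + |b' - b| := abs_sub_le _ _ _
          _ < _ := by linarith
    obtain ⟨ψ, hψ, hψi⟩ := extraction_forall_of_frequently hnear
    choose i hi hib using hψi
    refine (h.tendsto ψ hψ i hi b ?_).1
    rw [tendsto_iff_dist_tendsto_zero]
    exact squeeze_zero (fun _ => dist_nonneg) (fun n => (hib n).le)
      tendsto_one_div_add_atTop_nhds_zero_nat
  refine
    { compact := isCompact_Icc.of_isClosed_subset hclosed hKR
      F_le := fun b hb s hs => ?_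
      time_mem := fun b hb => isClosed_Icc.mem_of_tendsto (ht b hb)
        (Eventually.of_forall fun k => (c k).t_mem _ (hj b hb k))
      time_mono := fun b hb b' hb' hbb' => le_of_tendsto_of_tendsto (ht b hb) (ht b' hb')
        ((hle b hb b' hb' hbb').mono fun k hk => (c k).t_le hk (hj b' hb' k))
      time_sub_le := fun b hb b' hb' hbb' => le_of_tendsto_of_tendsto
        ((ht b' hb').sub (ht b hb)) ((ha b' hb').sub (ha b hb))
        ((hle b hb b' hb' hbb').mono fun k hk => (c k).t_sub_le hk (hj b' hb' k))
      G_mono := fun b hb b' hb' hbb' => le_of_tendsto_of_tendsto (hσ b hb) (hσ b' hb')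
        ((hle b hb b' hb' hbb').mono fun k hk => (c k).σ_le hk (hj b' hb' k))
      G_sub_le := fun b hb b' hb' hbb' => le_of_tendsto_of_tendsto
        ((hσ b' hb').sub (hσ b hb)) ((ha b' hb').sub (ha b hb))
        ((hle b hb b' hb' hbb').mono fun k hk => (c k).σ_sub_le hk (hj b' hb' k))
      cost_le := fun b hb b' hb' hbb' => ?_
      hole_le := fun b b' hbb' => ?_
      residual_le := fun b hb b' hb' hbb' => ?_ }
  · exact ((isClosed_sublevel hC hA C).mem_of_tendsto
      (tendsto_const_nhds.prodMk_nhds (hx b hb)) (Eventually.of_forall fun k =>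
        (c k).mem_sublevel (hj b hb k) hs)).2
  · refine cost_le_of_tendsto hC hA hμ hmesh S.d_lsc (hj b hb) ?_ (ht b hb) (hσ b hb) (hσ b' hb')
      (hx b hb) (hx b' hb')
    filter_upwards [hlt b hb b' hb' hbb'] with k hk
    exact ⟨(Nat.succ_le_of_lt hk).trans (hj b' hb' k), (c k).d_add_residual_le hk (hj b' hb' k)⟩
  · -- The two chain points next to the midpoint of the hole converge to its end points.
    have hb := hbb'.1
    have hb' := hbb'.2.1
    have hlt' : b < b' := hbb'.2.2.1
    set m := (b + b') / 2 with hm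
    have hev : ∀ᶠ k in atTop, ∃ i, j b k ≤ i ∧ i + 1 ≤ j b' k ∧ (c k).a i < m ∧
        m ≤ (c k).a (i + 1) := by
      filter_upwards [(ha b hb).eventually (gt_mem_nhds (show b < m by rw [hm]; linarith)),
        (ha b' hb').eventually (lt_mem_nhds (show m < b' by rw [hm]; linarith)),
        hlt b hb b' hb' hlt'] with k h1 h2 h3
      have h4 : j b k < (c k).index m := (c k).lt_index (h3.trans_le (hj b' hb' k)) h1
      have h5 := (c k).index_le_of_le h2.le
      refine ⟨(c k).index m - 1, by omega, by omega, ?_, ?_⟩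
      · by_contra! hge
        have := (c k).index_le_of_le hge
        omega
      · rw [Nat.sub_add_cancel (by omega)]
        exact (c k).le_a_index (hj b' hb' k) h2.le
    obtain ⟨n, hn⟩ := hev.exists_forall_of_atTop
    choose i hi1 hi2 hi3 hi4 using fun k => hn (k + n) (by omega)
    have hiN : ∀ k, i k + 1 ≤ (c (k + n)).N := fun k => (hi2 k).trans (hj b' hb' _)
    obtain ⟨⟨l, l'⟩, -, χ, hχ, hχlim⟩ :=
      (isCompact_Icc.isSeqCompact.prod isCompact_Icc.isSeqCompact)
      (x := fun k => ((c (k + n)).a (i k), (c (k + n)).a (i k + 1)))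
      (fun k => ⟨(c (k + n)).a_mem ((Nat.le_succ _).trans (hiN k)), (c (k + n)).a_mem (hiN k)⟩)
    have hl : Tendsto (fun k => (c (χ k + n)).a (i (χ k))) atTop (𝓝 l) :=
      (continuous_fst.tendsto _).comp hχlim
    have hl' : Tendsto (fun k => (c (χ k + n)).a (i (χ k) + 1)) atTop (𝓝 l') :=
      (continuous_snd.tendsto _).comp hχlim
    have hχn : StrictMono fun k => χ k + n := fun x y hxy => by simpa using hχ hxy
    obtain ⟨hlK, hlx, hlt, hlσ⟩ := h.tendsto _ hχn (fun k => i (χ k))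
      (fun k => (Nat.le_succ _).trans (hiN _)) l hl
    obtain ⟨hl'K, hl'x, -, hl'σ⟩ := h.tendsto _ hχn (fun k => i (χ k) + 1) (fun k => hiN _) l' hl'
    have e : l = b := by
      have h1 : b ≤ l := le_of_tendsto_of_tendsto' ((ha b hb).comp hχn.tendsto_atTop) hl fun k =>
        (c (χ k + n)).a_mono (hi1 _) ((Nat.le_succ _).trans (hiN _))
      have h2 : l ≤ m := le_of_tendsto' hl fun k => (hi3 _).le
      by_contra hne
      exact disjoint_left.1 hbb'.2.2.2
        ⟨lt_of_le_of_ne h1 (Ne.symm hne), lt_of_le_of_lt h2 (by simp only [hm]; linarith)⟩ hlK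
    have e' : l' = b' := by
      have h1 : l' ≤ b' := le_of_tendsto_of_tendsto' hl' ((ha b' hb').comp hχn.tendsto_atTop)
        fun k => (c (χ k + n)).a_mono (hi2 _) (hj b' hb' _)
      have h2 : m ≤ l' := ge_of_tendsto' hl' fun k => hi4 _
      by_contra hne
      exact disjoint_left.1 hbb'.2.2.2
        ⟨lt_of_lt_of_le (by simp only [hm]; linarith) h2, lt_of_le_of_ne h1 hne⟩ hl'K
    subst e e'
    refine cost_le_of_tendsto (c := fun k => c (χ k + n)) (μ := fun k => μ (χ k + n))
      (e := S.D) (i := fun k => i (χ k)) (j := fun k => i (χ k) + 1)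
      hC hA (hμ.comp hχn.tendsto_atTop) (fun k => hmesh _)
      (S.d_lsc.add S.δ_lsc) (fun k => (Nat.le_succ _).trans (hiN _)) ?_ hlt hlσ hl'σ hlx hl'x
    exact Eventually.of_forall fun k => ⟨hiN _, (c (χ k + n)).cost_le _ (hiN _)⟩
  · have hne : ∀ᶠ k in atTop, j b' k ≠ j b k := by
      rcases lt_or_gt_of_ne hbb' with h' | h'
      · exact (hlt b hb b' hb' h').mono fun k hk => hk.ne'
      · exact (hlt b' hb' b hb h').mono fun k hk => hk.ne
    exact residual_le_of_tendsto hC hA hμ hmesh (hj b' hb') (hj b hb) hne (ha b' hb') (ha b hb)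
      (ht b hb) (hx b hb)

/-- Given, for each time `t`, indices whose times tend to `t`, a further subsequence makes their
arclengths converge for all `t`: only the countably many times at which `Θ` has a plateau need a
diagonal argument. -/
theorem ChainsTendsto.exists_subseq_time {K : Set ℝ} {ϑ : ℝ → X} {Θ G : ℝ → ℝ}
    (h : ChainsTendsto c K ϑ Θ G) (hprof : IsProfile S C K ϑ Θ G) {i : ℕ → ℝ → ℕ}
    (hi : ∀ k, ∀ t ∈ Icc 0 S.T, i k t ≤ (c k).N)
    (hit : ∀ t ∈ Icc 0 S.T, Tendsto (fun k => (c k).t (i k t)) atTop (𝓝 t)) :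
    ∃ D : Set ℝ, D.Countable ∧
      (∀ b ∈ K, ∀ b' ∈ K, Θ b = Θ b' → Θ b ∉ D → b = b') ∧
      ∃ φ : ℕ → ℕ, StrictMono φ ∧ ∀ t ∈ Icc 0 S.T, ∃ l,
        Tendsto (fun k => (c (φ k)).a (i (φ k) t)) atTop (𝓝 l) := by
  set D : Set ℝ := {t | t ∈ Icc 0 S.T ∧ ∃ b ∈ K, ∃ b' ∈ K, b < b' ∧ Θ b = t ∧ Θ b' = t} with hD
  have huniq : ∀ b ∈ K, ∀ b' ∈ K, Θ b = Θ b' → Θ b ∉ D → b = b' := fun b hb b' hb' he hnot => by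
    rcases lt_trichotomy b b' with h' | h' | h'
    · exact absurd ⟨hprof.time_mem b hb, b, hb, b', hb', h', rfl, he.symm⟩ hnot
    · exact h'
    · exact absurd ⟨hprof.time_mem b hb, b', hb', b, hb, h', he.symm, rfl⟩ hnot
  have hDc : D.Countable := by
    -- Distinct plateaus are separated by rational parameters.
    have hq : ∀ t ∈ D, ∃ q : ℚ, ∃ b ∈ K, ∃ b' ∈ K, b < q ∧ (q : ℝ) < b' ∧ Θ b = t ∧ Θ b' = t := by
      rintro t ⟨-, b, hb, b', hb', hlt, h1, h2⟩
      obtain ⟨q, hq1, hq2⟩ := exists_rat_btwn hlt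
      exact ⟨q, b, hb, b', hb', hq1, hq2, h1, h2⟩
    choose! q b hb b' hb' h1 h2 h3 h4 using hq
    have hinj : InjOn q D := by
      have hno : ∀ s ∈ D, ∀ t ∈ D, q s = q t → t ≤ s := fun s hs t ht he => by
        have := hprof.time_mono (hb t ht) (hb' s hs)
          ((h1 t ht).le.trans (by rw [← he]; exact (h2 s hs).le))
        rwa [h3 t ht, h4 s hs] at this
      exact fun s hs t ht he => le_antisymm (hno t ht s hs he.symm) (hno s hs t ht he)
    exact MapsTo.countable_of_injOn (mapsTo_univ _ _) hinj countable_univ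
  refine ⟨D, hDc, huniq, ?_⟩
  have : Countable D := hDc.to_subtype
  obtain ⟨φ, hφ, hlim⟩ := (isCompact_Icc (a := (0 : ℝ)) (b := R)).isSeqCompact.exists_subseq_forall
    (fun (t : D) k => (c k).a (i k t)) (fun t k => (c k).a_mem (hi k t t.2.1))
  refine ⟨φ, hφ, fun t ht => ?_⟩
  by_cases htD : t ∈ D
  · obtain ⟨l, -, hl⟩ := hlim ⟨t, htD⟩
    exact ⟨l, hl⟩
  have hmem : ∀ k, (c (φ k)).a (i (φ k) t) ∈ Icc 0 R := fun k => (c (φ k)).a_mem (hi _ t ht)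
  have hsub : ∀ ψ : ℕ → ℕ, StrictMono ψ → ∀ z,
      Tendsto (fun k => (c (φ (ψ k))).a (i (φ (ψ k)) t)) atTop (𝓝 z) → z ∈ K ∧ Θ z = t :=
    fun ψ hψ z hz => by
      have hcomp := hφ.comp hψ
      obtain ⟨hzK, -, hzt, -⟩ := h.tendsto (φ ∘ ψ) hcomp (fun k => i (φ (ψ k)) t)
        (fun k => hi _ t ht) z hz
      exact ⟨hzK, tendsto_nhds_unique hzt ((hit t ht).comp hcomp.tendsto_atTop)⟩
  obtain ⟨l, -, χ, hχ, hl⟩ := isCompact_Icc.isSeqCompact hmem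
  obtain ⟨hlK, hlt⟩ := hsub χ hχ l hl
  refine ⟨l, isCompact_Icc.isSeqCompact.tendsto_of_unique (Eventually.of_forall hmem)
    fun ψ hψ z hz => ?_⟩
  obtain ⟨hzK, hzt⟩ := hsub ψ hψ z hz
  exact huniq z hzK l hlK (hzt.trans hlt.symm) (by rwa [hzt])

end Compactness

end RateIndependentSystem

/-! ### One-sided limits and the augmented variation -/

theorem pointwiseVar_singleton {X : Type*} {d : X → X → ℝ≥0∞} {u : ℝ → X}
    (d_self : ∀ x, d x x = 0) (t : ℝ) : pointwiseVar d u {t} = 0 := by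
  refine nonpos_iff_eq_zero.1 (iSup_le fun p => ?_)
  refine (Finset.sum_eq_zero fun j _ => ?_).le
  have h1 : p.2.1 j = t := p.2.2.2 j
  have h2 : p.2.1 (j + 1) = t := p.2.2.2 (j + 1)
  rw [h1, h2, d_self]

section OneSided

variable {X : Type*} [TopologicalSpace X] {u : ℝ → X}

theorem leftLimit_self (a : ℝ) : leftLimit a u a = u a := by simp [leftLimit]

theorem rightLimit_self (b : ℝ) : rightLimit b u b = u b := by simp [rightLimit]

theorem rightLimit_congr {b b' t : ℝ} (h : t < b) (h' : t < b') :
    rightLimit b u t = rightLimit b' u t := by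
  by_cases hex : ∃ y, Tendsto u (𝓝[>] t) (𝓝 y)
  · rw [rightLimit, rightLimit, dif_pos ⟨h, hex⟩, dif_pos ⟨h', hex⟩]
  · rw [rightLimit, rightLimit, dif_neg fun hc => hex hc.2, dif_neg fun hc => hex hc.2]

theorem leftLimit_eq_of_tendsto [T2Space X] {a t : ℝ} {x : X} (h : a < t)
    (hx : Tendsto u (𝓝[<] t) (𝓝 x)) : leftLimit a u t = x := by
  have hex : a < t ∧ ∃ y, Tendsto u (𝓝[<] t) (𝓝 y) := ⟨h, x, hx⟩
  rw [leftLimit, dif_pos hex]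
  exact tendsto_nhds_unique hex.2.choose_spec hx

theorem rightLimit_eq_of_tendsto [T2Space X] {b t : ℝ} {x : X} (h : t < b)
    (hx : Tendsto u (𝓝[>] t) (𝓝 x)) : rightLimit b u t = x := by
  have hex : t < b ∧ ∃ y, Tendsto u (𝓝[>] t) (𝓝 y) := ⟨h, x, hx⟩
  rw [rightLimit, dif_pos hex]
  exact tendsto_nhds_unique hex.2.choose_spec hx

variable {d : X → X → ℝ≥0∞} {e : ℝ → X → X → ℝ≥0∞}

theorem augmentedVar_self (d_self : ∀ x, d x x = 0) (e_self : ∀ t x, e t x x = 0) (t : ℝ) :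
    augmentedVar d e u t t = 0 := by
  have : IsEmpty ↥(jumpSet t t u ∩ Ioo t t) := by simp
  simp [augmentedVar, jumpVar, leftLimit_self, rightLimit_self, d_self, e_self,
    pointwiseVar_singleton d_self]

/-- Superadditivity of the augmented variation: extending the interval from `[0, s]` to `[0, r]`
adds the variation on `[s, r]`, the jump from `u s` to `u (s+)`, and the jump from `u (r-)` to
`u r`. -/
theorem augmentedVar_add_le (d_self : ∀ x, d x x = 0) (e_self : ∀ t x, e t x x = 0) {s r : ℝ}
    (hs : 0 ≤ s) (hsr : s < r) :
    augmentedVar d e u 0 s + (pointwiseVar d u (Icc s r) +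
      (e s (u s) (rightLimit r u s) - d (u s) (rightLimit r u s)) +
      (e r (leftLimit 0 u r) (u r) - d (leftLimit 0 u r) (u r))) ≤ augmentedVar d e u 0 r := by
  rcases hs.eq_or_lt with rfl | hs0
  · rw [augmentedVar_self d_self e_self, zero_add, augmentedVar, jumpVar, add_assoc]
    exact add_le_add_right le_self_add _
  set f : ℝ → ℝ≥0∞ := fun p => (e p (leftLimit 0 u p) (u p) - d (leftLimit 0 u p) (u p)) +
    (e p (u p) (rightLimit r u p) - d (u p) (rightLimit r u p)) with hf
  have hvar : pointwiseVar d u (Icc 0 s) + pointwiseVar d u (Icc s r) ≤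
      pointwiseVar d u (Icc 0 r) :=
    pointwiseVar_add_le (Icc_subset_Icc le_rfl hsr.le) (Icc_subset_Icc hs0.le le_rfl)
      fun p hp q hq => hp.2.trans hq.1
  have hsum : ∑' p : ↥(jumpSet 0 s u ∩ Ioo 0 s),
      ((e p (leftLimit 0 u p) (u p) - d (leftLimit 0 u p) (u p)) +
        (e p (u p) (rightLimit s u p) - d (u p) (rightLimit s u p))) + f s ≤
      ∑' p : ↥(jumpSet 0 r u ∩ Ioo 0 r), f p := by
    have hsub : jumpSet 0 s u ∩ Ioo 0 s ⊆ jumpSet 0 r u ∩ Ioo 0 r := fun p hp => by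
      have hps := hp.2.2
      refine ⟨⟨⟨hp.2.1.le, (hps.trans hsr).le⟩, ?_⟩, hp.2.1, hps.trans hsr⟩
      rw [rightLimit_congr (hps.trans hsr) hps]
      exact hp.1.2
    have h1 : ∑' p : ↥(jumpSet 0 s u ∩ Ioo 0 s),
        ((e p (leftLimit 0 u p) (u p) - d (leftLimit 0 u p) (u p)) +
          (e p (u p) (rightLimit s u p) - d (u p) (rightLimit s u p))) =
        ∑' p : ↥(jumpSet 0 s u ∩ Ioo 0 s), f p := by
      refine tsum_congr fun p => ?_
      rw [hf, rightLimit_congr p.2.2.2 (p.2.2.2.trans hsr)]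
    rw [h1]
    by_cases hsJ : s ∈ jumpSet 0 r u
    · have hnot : s ∉ jumpSet 0 s u ∩ Ioo 0 s := fun h => lt_irrefl _ h.2.2
      have e1 := ENNReal.summable.tsum_union_disjoint (f := f) (disjoint_singleton_right.2 hnot)
        ENNReal.summable
      rw [tsum_singleton s f] at e1
      rw [← e1]
      exact ENNReal.tsum_mono_subtype f (union_subset hsub
        (singleton_subset_iff.2 ⟨hsJ, hs0, hsr⟩))
    · have h2 : leftLimit 0 u s = u s ∧ u s = rightLimit r u s := by
        by_contra hne
        exact hsJ ⟨⟨hs0.le, hsr.le⟩, by tauto⟩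
      have : f s = 0 := by simp [hf, h2.1, ← h2.2, e_self]
      rw [this, add_zero]
      exact ENNReal.tsum_mono_subtype f hsub
  have h0 : rightLimit s u 0 = rightLimit r u 0 := rightLimit_congr hs0 (hs0.trans hsr)
  rw [augmentedVar, augmentedVar, jumpVar, jumpVar, h0]
  refine le_trans (le_of_eq ?_) (add_le_add hvar (add_le_add_right hsum _))
  simp only [hf]
  ring

/-- The augmented variation is controlled by any monotone function whose increments control the
costs of the jumps and, between the one-sided limits, the `d`-distance. -/
theorem augmentedVar_le (d_self : ∀ x, d x x = 0) (d_triangle : ∀ x y z, d x z ≤ d x y + d y z)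
    (e_self : ∀ t x, e t x x = 0) {t : ℝ} (ht : 0 ≤ t) {V : ℝ → ℝ} (hV : MonotoneOn V (Icc 0 t))
    (h : ∀ s ∈ Icc 0 t, ∀ r ∈ Icc 0 t, s < r → d (u s) (u r) +
      (e s (u s) (rightLimit t u s) - d (u s) (rightLimit t u s)) +
      (e r (leftLimit 0 u r) (u r) - d (leftLimit 0 u r) (u r)) ≤ ENNReal.ofReal (V r - V s)) :
    augmentedVar d e u 0 t ≤ ENNReal.ofReal (V t - V 0) := by
  classical
  rcases ht.eq_or_lt with rfl | ht0
  · rw [augmentedVar_self d_self e_self]; exact bot_le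
  unfold augmentedVar jumpVar
  rw [ENNReal.tsum_eq_iSup_sum, ENNReal.add_iSup, ENNReal.add_iSup]
  refine iSup_le fun P => ?_
  let Q : Finset ℝ := P.image Subtype.val
  have hQ : ∀ p ∈ Q, 0 < p ∧ p < t := fun p hp => by
    obtain ⟨q, -, rfl⟩ := Finset.mem_image.1 hp
    exact q.2.2
  refine le_trans ?_ (pointwiseVar_add_sum_le d_self d_triangle (isLeast_Icc ht) (isGreatest_Icc ht)
    hV (w₁ := fun p => e p (leftLimit 0 u p) (u p) - d (leftLimit 0 u p) (u p))
    (w₂ := fun p => e p (u p) (rightLimit t u p) - d (u p) (rightLimit t u p)) h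
    (P := insert 0 (insert t Q)) ?_)
  · refine add_le_add_right ?_ _
    have h1 : t ∉ Q := fun h => lt_irrefl _ (hQ t h).2
    have h2 : (0 : ℝ) ∉ insert t Q := fun h => by
      rcases Finset.mem_insert.1 h with h | h
      · exact ht0.ne h
      · exact lt_irrefl _ (hQ 0 h).1
    rw [Finset.sum_insert h2, Finset.sum_insert h1,
      Finset.sum_image fun _ _ _ _ h => Subtype.ext h]
    simp only [ht0, if_true, lt_irrefl, if_false, add_zero, zero_add]
    rw [← add_assoc]
    refine add_le_add_right (Finset.sum_le_sum fun p _ => ?_) _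
    rw [if_pos p.2.2.1, if_pos p.2.2.2, add_comm]
  · intro p hp
    rcases Finset.mem_insert.1 hp with rfl | hp
    · exact ⟨le_rfl, ht⟩
    rcases Finset.mem_insert.1 hp with rfl | hp
    · exact ⟨ht, le_rfl⟩
    exact ⟨(hQ p hp).1.le, (hQ p hp).2.le⟩

end OneSided

namespace RateIndependentSystem

variable {X : Type*} [TopologicalSpace X] {S : RateIndependentSystem X}

/-! ### The curve traced by a parametrized evolution -/

namespace IsProfile

variable {C : ℝ} {K : Set ℝ} {ϑ : ℝ → X} {Θ G : ℝ → ℝ}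

theorem mem_sublevel (h : IsProfile S C K ϑ Θ G) {b : ℝ} (hb : b ∈ K) :
    (Θ b, ϑ b) ∈ S.sublevel C := ⟨h.time_mem b hb, h.F_le b hb _ (h.time_mem b hb)⟩

theorem d_le (h : IsProfile S C K ϑ Θ G) {b b' : ℝ} (hb : b ∈ K) (hb' : b' ∈ K) (hbb' : b ≤ b') :
    S.d (ϑ b) (ϑ b') ≤ ENNReal.ofReal (G b' - G b) := by
  rcases hbb'.eq_or_lt with rfl | hlt
  · simp [S.d_self]
  · exact le_self_add.trans (h.cost_le b hb b' hb' hlt)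

theorem abs_time_sub_le (h : IsProfile S C K ϑ Θ G) {b b' : ℝ} (hb : b ∈ K) (hb' : b' ∈ K) :
    |Θ b' - Θ b| ≤ |b' - b| := by
  rcases le_total b b' with hle | hle
  · rw [abs_of_nonneg (sub_nonneg.2 (h.time_mono hb hb' hle)), abs_of_nonneg (sub_nonneg.2 hle)]
    exact h.time_sub_le b hb b' hb' hle
  · rw [abs_of_nonpos (sub_nonpos.2 (h.time_mono hb' hb hle)), abs_of_nonpos (sub_nonpos.2 hle)]
    linarith [h.time_sub_le b' hb' b hb hle]

theorem abs_G_sub_le (h : IsProfile S C K ϑ Θ G) {b b' : ℝ} (hb : b ∈ K) (hb' : b' ∈ K) :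
    |G b' - G b| ≤ |b' - b| := by
  rcases le_total b b' with hle | hle
  · rw [abs_of_nonneg (sub_nonneg.2 (h.G_mono hb hb' hle)), abs_of_nonneg (sub_nonneg.2 hle)]
    exact h.G_sub_le b hb b' hb' hle
  · rw [abs_of_nonpos (sub_nonpos.2 (h.G_mono hb' hb hle)), abs_of_nonpos (sub_nonpos.2 hle)]
    linarith [h.G_sub_le b' hb' b hb hle]

theorem continuousOn_time (h : IsProfile S C K ϑ Θ G) : ContinuousOn Θ K :=
  (LipschitzOnWith.of_dist_le_mul (K := 1) fun b hb b' hb' => by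
    rw [Real.dist_eq, Real.dist_eq, NNReal.coe_one, one_mul]
    exact h.abs_time_sub_le hb' hb).continuousOn

theorem continuousOn_G (h : IsProfile S C K ϑ Θ G) : ContinuousOn G K :=
  (LipschitzOnWith.of_dist_le_mul (K := 1) fun b hb b' hb' => by
    rw [Real.dist_eq, Real.dist_eq, NNReal.coe_one, one_mul]
    exact h.abs_G_sub_le hb' hb).continuousOn

/-- States at accumulated parameters are stable. -/
theorem stable_of_tendsto (h : IsProfile S C K ϑ Θ G) {b : ℝ} (hb : b ∈ K) {ι : Type*}
    {l : Filter ι} [l.NeBot] {β : ι → ℝ} (hβ : ∀ᶠ i in l, β i ∈ K ∧ β i ≠ b)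
    (hlim : Tendsto β l (𝓝 b)) : S.Stable (Θ b) (ϑ b) := by
  rw [stable_iff_residual_eq_zero, ← nonpos_iff_eq_zero]
  have h0 : Tendsto (fun i => ENNReal.ofReal |β i - b|) l (𝓝 0) := by
    simpa using ENNReal.tendsto_ofReal (hlim.sub_const b).abs
  refine ge_of_tendsto h0 ?_
  filter_upwards [hβ] with i hi using h.residual_le b hb _ hi.1 hi.2.symm

/-- The state depends continuously on the parameter: at an isolated parameter there is nothing to
show, and at an accumulated one any limit state is stable and at distance zero. -/
theorem continuousOn [T2Space X] (hA : S.AssumptionA) (hC : S.AssumptionC)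
    (h : IsProfile S C K ϑ Θ G) : ContinuousOn ϑ K := by
  intro b hb
  refine tendsto_of_seq_tendsto fun β hβ => ?_
  have hβK : ∀ᶠ n in atTop, β n ∈ K := hβ.eventually self_mem_nhdsWithin
  have hβb : Tendsto β atTop (𝓝 b) := hβ.mono_right nhdsWithin_le_nhds
  have hpair : Tendsto (fun n => (Θ (β n), ϑ (β n))) atTop (𝓝 (Θ b, ϑ b)) := by
    refine (hA.sublevel_compact C).tendsto_of_unique
      (hβK.mono fun n hn => h.mem_sublevel hn) fun ψ hψ w hw => ?_
    obtain ⟨θ, z⟩ := w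
    have hψt := hψ.tendsto_atTop
    have hwx : Tendsto (fun n => ϑ (β (ψ n))) atTop (𝓝 z) := (continuous_snd.tendsto _).comp hw
    have hθ : θ = Θ b := tendsto_nhds_unique ((continuous_fst.tendsto _).comp hw)
      ((h.continuousOn_time b hb).tendsto.comp (hβ.comp hψt))
    subst hθ
    congr 1
    have hK' := hψt.eventually hβK
    by_cases hne : ∃ᶠ n in atTop, β (ψ n) = b
    · obtain ⟨χ, hχ, he⟩ := extraction_of_frequently_atTop hne
      have := hwx.comp hχ.tendsto_atTop
      exact tendsto_nhds_unique this (tendsto_const_nhds.congr fun n => by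
        simp only [Function.comp_apply, he n])
    have hne' : ∀ᶠ n in atTop, β (ψ n) ∈ K ∧ β (ψ n) ≠ b := hK'.and (not_frequently.1 hne)
    have hlim := hβb.comp hψt
    have hst := h.stable_of_tendsto hb hne' hlim
    have hsub : (Θ b, z) ∈ S.sublevel C :=
      (isClosed_sublevel hC hA C).mem_of_tendsto hw (hK'.mono fun n hn => h.mem_sublevel hn)
    have hst' : S.Stable (Θ b) z := by
      rw [stable_iff_residual_eq_zero, ← nonpos_iff_eq_zero]
      have h0 : Tendsto (fun n => ENNReal.ofReal |b - β (ψ n)|) atTop (𝓝 0) := by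
        simpa using ENNReal.tendsto_ofReal (tendsto_const_nhds (x := b) |>.sub hlim).abs
      refine LowerSemicontinuousWithinAt.le_of_tendsto_of_le
        (lowerSemicontinuousOn_residual hC C _ hsub) hw
        (hK'.mono fun n hn => h.mem_sublevel hn) h0 ?_
      filter_upwards [hne'] with n hn using h.residual_le _ hn.1 b hb hn.2
    have hG : Tendsto (fun n => G (β (ψ n))) atTop (𝓝 (G b)) :=
      (h.continuousOn_G b hb).tendsto.comp (hβ.comp hψt)
    by_cases hlt : ∃ᶠ n in atTop, β (ψ n) ≤ b
    · have hlt' : ∃ᶠ n in atTop, β (ψ n) ≤ b ∧ β (ψ n) ∈ K := hlt.and_eventually hK'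
      obtain ⟨χ, hχ, he⟩ := extraction_of_frequently_atTop hlt'
      have hχt := hχ.tendsto_atTop
      have : S.d z (ϑ b) ≤ ENNReal.ofReal (G b - G b) :=
        S.d_lsc.le_of_tendsto_of_le ((hwx.comp hχt).prodMk_nhds tendsto_const_nhds)
          (ENNReal.tendsto_ofReal (tendsto_const_nhds.sub (hG.comp hχt)))
          (Eventually.of_forall fun n => h.d_le (he n).2 hb (he n).1)
      rw [sub_self, ENNReal.ofReal_zero, nonpos_iff_eq_zero] at this
      exact hC.separated _ (h.time_mem b hb) _ _ hst' hst this
    · have : S.d (ϑ b) z ≤ ENNReal.ofReal (G b - G b) := by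
        refine S.d_lsc.le_of_tendsto_of_le (tendsto_const_nhds.prodMk_nhds hwx)
          (ENNReal.tendsto_ofReal (hG.sub tendsto_const_nhds)) ?_
        filter_upwards [not_frequently.1 hlt, hK'] with n hn hnK
        exact h.d_le hb hnK (not_le.1 hn).le
      rw [sub_self, ENNReal.ofReal_zero, nonpos_iff_eq_zero] at this
      exact (hC.separated _ (h.time_mem b hb) _ _ hst hst' this).symm
  exact (continuous_snd.tendsto _).comp hpair

/-- The part of the evolution spent at a fixed time is a transition, with dissipation `G`. -/
theorem isTransition [T2Space X] (hA : S.AssumptionA) (hC : S.AssumptionC)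
    (h : IsProfile S C K ϑ Θ G) {b b' t : ℝ} (hb : b ∈ K) (hb' : b' ∈ K) (hbb' : b ≤ b')
    (ht : Θ b = t) (ht' : Θ b' = t) :
    sInf (K ∩ Icc b b') = b ∧ sSup (K ∩ Icc b b') = b' ∧
    S.IsTransition t (K ∩ Icc b b') ϑ (ϑ b) (ϑ b') ∧ IsDissipation S t (K ∩ Icc b b') ϑ G := by
  have hmin : sInf (K ∩ Icc b b') = b :=
    IsLeast.csInf_eq ⟨⟨hb, le_rfl, hbb'⟩, fun z hz => hz.2.1⟩
  have hmax : sSup (K ∩ Icc b b') = b' :=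
    IsGreatest.csSup_eq ⟨⟨hb', hbb', le_rfl⟩, fun z hz => hz.2.2⟩
  have htime : ∀ s ∈ K ∩ Icc b b', Θ s = t := fun s hs =>
    le_antisymm (ht' ▸ h.time_mono hs.1 hb' hs.2.2) (ht ▸ h.time_mono hb hs.1 hs.2.1)
  have htT : t ∈ Icc 0 S.T := ht ▸ h.time_mem b hb
  refine ⟨hmin, hmax,
    { compact := h.compact.inter_right isClosed_Icc
      nonempty := ⟨b, hb, le_rfl, hbb'⟩
      continuousOn := (h.continuousOn hA hC).mono inter_subset_left
      dist_continuous := fun ε hε => ⟨ε, hε, fun s hs r hr hsr hrs => ?_⟩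
      left_end := by rw [hmin]
      right_end := by rw [hmax]
      energy_bdd := ⟨C, ?_⟩ },
    fun s hs r hr hsr => h.G_mono hs.1 hr.1 hsr, fun s hs r hr hsr => ?_, fun s r hsr => ?_⟩
  · refine (h.d_le hs.1 hr.1 hsr).trans (ENNReal.ofReal_le_ofReal ?_)
    linarith [h.G_sub_le s hs.1 r hr.1 hsr]
  · rintro _ ⟨s, hs, rfl⟩
    exact (energy_le_F _ _).trans (h.F_le s hs.1 t htT)
  · rw [← htime s hs]; exact h.cost_le s hs.1 r hr.1 hsr
  · rw [← htime s hsr.1]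
    refine h.hole_le s r ⟨hsr.1.1, hsr.2.1.1, hsr.2.2.1, disjoint_left.2 fun z hz hzK => ?_⟩
    exact disjoint_left.1 hsr.2.2.2 hz
      ⟨hzK, hsr.1.2.1.trans hz.1.le, hz.2.le.trans hsr.2.1.2.2⟩

theorem jumpCost_le [T2Space X] (hA : S.AssumptionA) (hC : S.AssumptionC)
    (h : IsProfile S C K ϑ Θ G) {b b' t : ℝ} (hb : b ∈ K) (hb' : b' ∈ K) (hbb' : b ≤ b')
    (ht : Θ b = t) (ht' : Θ b' = t) :
    S.jumpCost t (ϑ b) (ϑ b') ≤ ENNReal.ofReal (G b' - G b) := by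
  obtain ⟨h1, h2, h3, h4⟩ := h.isTransition hA hC hb hb' hbb' ht ht'
  have := h4.jumpCost_le h3
  rwa [h1, h2] at this

theorem energy_le [T2Space X] (hA : S.AssumptionA) (hB : S.AssumptionB) (hC : S.AssumptionC)
    (h : IsProfile S C K ϑ Θ G) {b b' t : ℝ} (hb : b ∈ K) (hb' : b' ∈ K) (hbb' : b ≤ b')
    (ht : Θ b = t) (ht' : Θ b' = t) :
    S.energy t (ϑ b) ≤ S.energy t (ϑ b') + (G b' - G b) := by
  obtain ⟨h1, h2, h3, h4⟩ := h.isTransition hA hC hb hb' hbb' ht ht'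
  have := h4.energy_le hA hB hC (ht ▸ h.time_mem b hb) h3
  rwa [h1, h2] at this

end IsProfile

/-- A parameter `α t` at which a parametrized evolution passes through time `t`, monotone in `t`.
(Outside `[0, T]` only monotonicity and membership in `K` matter.) -/
structure IsClock (S : RateIndependentSystem X) (K : Set ℝ) (Θ α : ℝ → ℝ) : Prop where
  mono : Monotone α
  mem : ∀ t, α t ∈ K
  time : ∀ t ∈ Icc 0 S.T, Θ (α t) = t

section Curve

variable {C : ℝ} {K : Set ℝ} {ϑ : ℝ → X} {Θ G α : ℝ → ℝ}

theorem IsClock.leftLim_mem (hα : IsClock S K Θ α) (h : IsProfile S C K ϑ Θ G) (t : ℝ) :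
    Function.leftLim α t ∈ K :=
  h.compact.isClosed.mem_of_tendsto (hα.mono.tendsto_leftLim t) (Eventually.of_forall hα.mem)

theorem IsClock.rightLim_mem (hα : IsClock S K Θ α) (h : IsProfile S C K ϑ Θ G) (t : ℝ) :
    Function.rightLim α t ∈ K :=
  h.compact.isClosed.mem_of_tendsto (hα.mono.tendsto_rightLim t) (Eventually.of_forall hα.mem)

theorem IsClock.tendsto_left (hα : IsClock S K Θ α) (t : ℝ) :
    Tendsto α (𝓝[<] t) (𝓝[K] (Function.leftLim α t)) :=
  tendsto_nhdsWithin_iff.2 ⟨hα.mono.tendsto_leftLim t, Eventually.of_forall hα.mem⟩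

theorem IsClock.tendsto_right (hα : IsClock S K Θ α) (t : ℝ) :
    Tendsto α (𝓝[>] t) (𝓝[K] (Function.rightLim α t)) :=
  tendsto_nhdsWithin_iff.2 ⟨hα.mono.tendsto_rightLim t, Eventually.of_forall hα.mem⟩

theorem eventually_mem_Icc_left {t T : ℝ} (ht : t ∈ Ioc 0 T) :
    ∀ᶠ s in 𝓝[<] t, s ∈ Icc 0 T ∧ s < t := by
  filter_upwards [self_mem_nhdsWithin, nhdsWithin_le_nhds (lt_mem_nhds ht.1)] with s hs hs0
  exact ⟨⟨hs0.le, (le_of_lt hs).trans ht.2⟩, hs⟩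

theorem eventually_mem_Icc_right {t T : ℝ} (ht : t ∈ Ico 0 T) :
    ∀ᶠ s in 𝓝[>] t, s ∈ Icc 0 T ∧ t < s := by
  filter_upwards [self_mem_nhdsWithin, nhdsWithin_le_nhds (gt_mem_nhds ht.2)] with s hs hs0
  exact ⟨⟨ht.1.trans (le_of_lt hs), hs0.le⟩, hs⟩

theorem IsClock.time_leftLim (hα : IsClock S K Θ α) (h : IsProfile S C K ϑ Θ G) {t : ℝ}
    (ht : t ∈ Ioc 0 S.T) : Θ (Function.leftLim α t) = t := by
  have h1 := (h.continuousOn_time _ (hα.leftLim_mem h t)).tendsto.comp (hα.tendsto_left t)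
  refine tendsto_nhds_unique (h1.congr' ?_) (tendsto_id.mono_left nhdsWithin_le_nhds)
  filter_upwards [eventually_mem_Icc_left ht] with s hs using hα.time s hs.1

theorem IsClock.time_rightLim (hα : IsClock S K Θ α) (h : IsProfile S C K ϑ Θ G) {t : ℝ}
    (ht : t ∈ Ico 0 S.T) : Θ (Function.rightLim α t) = t := by
  have h1 := (h.continuousOn_time _ (hα.rightLim_mem h t)).tendsto.comp (hα.tendsto_right t)
  refine tendsto_nhds_unique (h1.congr' ?_) (tendsto_id.mono_left nhdsWithin_le_nhds)
  filter_upwards [eventually_mem_Icc_right ht] with s hs using hα.time s hs.1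

theorem IsClock.stable_leftLim (hα : IsClock S K Θ α) (h : IsProfile S C K ϑ Θ G) {t : ℝ}
    (ht : t ∈ Ioc 0 S.T) : S.Stable t (ϑ (Function.leftLim α t)) := by
  have := h.stable_of_tendsto (hα.leftLim_mem h t) (l := 𝓝[<] t) (β := α) ?_
    (hα.mono.tendsto_leftLim t)
  · rwa [hα.time_leftLim h ht] at this
  filter_upwards [eventually_mem_Icc_left ht] with s hs
  refine ⟨hα.mem s, fun he => ?_⟩
  have h1 := hα.time_leftLim h ht
  rw [← he, hα.time s hs.1] at h1
  exact hs.2.ne h1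

theorem IsClock.stable_rightLim (hα : IsClock S K Θ α) (h : IsProfile S C K ϑ Θ G) {t : ℝ}
    (ht : t ∈ Ico 0 S.T) : S.Stable t (ϑ (Function.rightLim α t)) := by
  have := h.stable_of_tendsto (hα.rightLim_mem h t) (l := 𝓝[>] t) (β := α) ?_
    (hα.mono.tendsto_rightLim t)
  · rwa [hα.time_rightLim h ht] at this
  filter_upwards [eventually_mem_Icc_right ht] with s hs
  refine ⟨hα.mem s, fun he => ?_⟩
  have h1 := hα.time_rightLim h ht
  rw [← he, hα.time s hs.1] at h1
  exact hs.2.ne h1.symm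

theorem IsClock.leftLim_le (hα : IsClock S K Θ α) (t : ℝ) : Function.leftLim α t ≤ α t :=
  hα.mono.leftLim_le le_rfl

theorem IsClock.le_rightLim (hα : IsClock S K Θ α) (t : ℝ) : α t ≤ Function.rightLim α t :=
  hα.mono.le_rightLim le_rfl

theorem IsClock.tendsto_G_left (hα : IsClock S K Θ α) (h : IsProfile S C K ϑ Θ G) (t : ℝ) :
    Tendsto (fun s => G (α s)) (𝓝[<] t) (𝓝 (G (Function.leftLim α t))) :=
  (h.continuousOn_G _ (hα.leftLim_mem h t)).tendsto.comp (hα.tendsto_left t)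

theorem IsClock.tendsto_G_right (hα : IsClock S K Θ α) (h : IsProfile S C K ϑ Θ G) (t : ℝ) :
    Tendsto (fun s => G (α s)) (𝓝[>] t) (𝓝 (G (Function.rightLim α t))) :=
  (h.continuousOn_G _ (hα.rightLim_mem h t)).tendsto.comp (hα.tendsto_right t)

theorem IsClock.tendsto_d_left (hα : IsClock S K Θ α) (h : IsProfile S C K ϑ Θ G) (t : ℝ) :
    Tendsto (fun s => S.d (ϑ (α s)) (ϑ (Function.leftLim α t))) (𝓝[<] t) (𝓝 0) := by
  have h0 := ENNReal.tendsto_ofReal ((hα.tendsto_G_left h t).const_sub (G (Function.leftLim α t)))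
  rw [sub_self, ENNReal.ofReal_zero] at h0
  refine tendsto_of_tendsto_of_tendsto_of_le_of_le' tendsto_const_nhds h0
    (Eventually.of_forall fun _ => bot_le) ?_
  filter_upwards [self_mem_nhdsWithin] with s hs
  exact h.d_le (hα.mem s) (hα.leftLim_mem h t) (hα.mono.le_leftLim hs)

theorem IsClock.tendsto_d_right (hα : IsClock S K Θ α) (h : IsProfile S C K ϑ Θ G) (t : ℝ) :
    Tendsto (fun s => S.d (ϑ (Function.rightLim α t)) (ϑ (α s))) (𝓝[>] t) (𝓝 0) := by
  have h0 := ENNReal.tendsto_ofReal ((hα.tendsto_G_right h t).sub_const (G (Function.rightLim α t)))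
  rw [sub_self, ENNReal.ofReal_zero] at h0
  refine tendsto_of_tendsto_of_tendsto_of_le_of_le' tendsto_const_nhds h0
    (Eventually.of_forall fun _ => bot_le) ?_
  filter_upwards [self_mem_nhdsWithin] with s hs
  exact h.d_le (hα.rightLim_mem h t) (hα.mem s) (hα.mono.rightLim_le hs)

theorem IsClock.continuousAt_of_notMem (hα : IsClock S K Θ α) {t : ℝ}
    (ht : t ∉ {t | ¬ ContinuousAt α t}) :
    Function.leftLim α t = α t ∧ Function.rightLim α t = α t := by
  have hc : ContinuousAt α t := by simpa using ht
  have h1 := hα.mono.continuousAt_iff_leftLim_eq_rightLim.1 hc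
  have h2 := hα.leftLim_le t
  have h3 := hα.le_rightLim t
  constructor <;> linarith

theorem IsClock.stable_of_notMem (hα : IsClock S K Θ α) (h : IsProfile S C K ϑ Θ G) {t : ℝ}
    (ht : t ∈ Ioc 0 S.T) (hc : t ∉ {t | ¬ ContinuousAt α t}) : S.Stable t (ϑ (α t)) := by
  have := hα.stable_leftLim h ht
  rwa [(hα.continuousAt_of_notMem hc).1] at this

variable [T2Space X]

theorem IsClock.tendsto_curve_left (hA : S.AssumptionA) (hC : S.AssumptionC)
    (hα : IsClock S K Θ α) (h : IsProfile S C K ϑ Θ G) (t : ℝ) :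
    Tendsto (fun s => ϑ (α s)) (𝓝[<] t) (𝓝 (ϑ (Function.leftLim α t))) :=
  (h.continuousOn hA hC _ (hα.leftLim_mem h t)).tendsto.comp (hα.tendsto_left t)

theorem IsClock.tendsto_curve_right (hA : S.AssumptionA) (hC : S.AssumptionC)
    (hα : IsClock S K Θ α) (h : IsProfile S C K ϑ Θ G) (t : ℝ) :
    Tendsto (fun s => ϑ (α s)) (𝓝[>] t) (𝓝 (ϑ (Function.rightLim α t))) :=
  (h.continuousOn hA hC _ (hα.rightLim_mem h t)).tendsto.comp (hα.tendsto_right t)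

theorem IsClock.leftLimit_curve (hA : S.AssumptionA) (hC : S.AssumptionC)
    (hα : IsClock S K Θ α) (h : IsProfile S C K ϑ Θ G) {t : ℝ} (ht : 0 < t) :
    leftLimit 0 (fun s => ϑ (α s)) t = ϑ (Function.leftLim α t) :=
  leftLimit_eq_of_tendsto ht (hα.tendsto_curve_left hA hC h t)

theorem IsClock.rightLimit_curve (hA : S.AssumptionA) (hC : S.AssumptionC)
    (hα : IsClock S K Θ α) (h : IsProfile S C K ϑ Θ G) {t r : ℝ} (ht : t < r) :
    rightLimit r (fun s => ϑ (α s)) t = ϑ (Function.rightLim α t) :=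
  rightLimit_eq_of_tendsto ht (hα.tendsto_curve_right hA hC h t)

theorem IsClock.stable (hA : S.AssumptionA) (hC : S.AssumptionC)
    (hα : IsClock S K Θ α) (h : IsProfile S C K ϑ Θ G) {t : ℝ} (ht : t ∈ Icc 0 S.T)
    (hJ : t ∉ jumpSet 0 S.T fun s => ϑ (α s)) : S.Stable t (ϑ (α t)) := by
  have h2 : leftLimit 0 (fun s => ϑ (α s)) t = ϑ (α t) ∧
      ϑ (α t) = rightLimit S.T (fun s => ϑ (α s)) t := by
    by_contra hne
    exact hJ ⟨ht, by simp only; tauto⟩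
  rcases ht.1.eq_or_lt with h0 | h0
  · have hlt : t < S.T := h0 ▸ S.T_pos
    rw [h2.2, hα.rightLimit_curve hA hC h hlt]
    exact hα.stable_rightLim h ⟨ht.1, hlt⟩
  · rw [← h2.1, hα.leftLimit_curve hA hC h h0]
    exact hα.stable_leftLim h ⟨h0, ht.2⟩

/-- The augmented variation of the curve is at most the dissipation of the evolution. -/
theorem IsClock.augmentedVar_le (hA : S.AssumptionA) (hC : S.AssumptionC)
    (hα : IsClock S K Θ α) (h : IsProfile S C K ϑ Θ G) {t : ℝ} (ht : t ∈ Icc 0 S.T) :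
    augmentedVar S.d S.jumpCost (fun s => ϑ (α s)) 0 t ≤ ENNReal.ofReal (G (α t) - G (α 0)) := by
  refine _root_.augmentedVar_le (V := fun s => G (α s)) S.d_self S.d_triangle jumpCost_self ht.1
    (fun s _ r _ hsr => h.G_mono (hα.mem s) (hα.mem r) (hα.mono hsr)) fun s hs r hr hsr => ?_
  have hst : s < t := hsr.trans_le hr.2
  have h0r : 0 < r := hs.1.trans_lt hsr
  simp only [hα.rightLimit_curve hA hC h hst, hα.leftLimit_curve hA hC h h0r]
  set sr := Function.rightLim α s
  set rl := Function.leftLim α r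
  have hsrK : sr ∈ K := hα.rightLim_mem h s
  have hrlK : rl ∈ K := hα.leftLim_mem h r
  have hle : sr ≤ rl := hα.mono.rightLim_le_leftLim hsr
  have hc1 : S.jumpCost s (ϑ (α s)) (ϑ sr) ≤ ENNReal.ofReal (G sr - G (α s)) :=
    h.jumpCost_le hA hC (hα.mem s) hsrK (hα.le_rightLim s) (hα.time s ⟨hs.1, hs.2.trans ht.2⟩)
      (hα.time_rightLim h ⟨hs.1, hst.trans_le ht.2⟩)
  have hc2 : S.jumpCost r (ϑ rl) (ϑ (α r)) ≤ ENNReal.ofReal (G (α r) - G rl) :=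
    h.jumpCost_le hA hC hrlK (hα.mem r) (hα.leftLim_le r) (hα.time_leftLim h
      ⟨h0r, hr.2.trans ht.2⟩) (hα.time r ⟨hr.1, hr.2.trans ht.2⟩)
  have hd := h.d_le hsrK hrlK hle
  have e : G (α r) - G (α s) = (G sr - G (α s)) + (G rl - G sr) + (G (α r) - G rl) := by ring
  have g1 := h.G_mono (hα.mem s) hsrK (hα.le_rightLim s)
  have g2 := h.G_mono hsrK hrlK hle
  have g3 := h.G_mono hrlK (hα.mem r) (hα.leftLim_le r)
  rw [e, ENNReal.ofReal_add (by linarith) (by linarith), ENNReal.ofReal_add (by linarith)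
    (by linarith)]
  refine le_trans ?_ (add_le_add (add_le_add hc1 hd) hc2)
  have htri : S.d (ϑ (α s)) (ϑ (α r)) ≤ S.d (ϑ (α s)) (ϑ sr) + S.d (ϑ sr) (ϑ rl) +
      S.d (ϑ rl) (ϑ (α r)) :=
    (S.d_triangle _ _ _).trans (add_le_add_left (S.d_triangle _ _ _) _)
  have e1 := add_tsub_cancel_of_le (d_le_jumpCost (S := S) s (ϑ (α s)) (ϑ sr))
  have e2 := add_tsub_cancel_of_le (d_le_jumpCost (S := S) r (ϑ rl) (ϑ (α r)))
  calc _ ≤ (S.d (ϑ (α s)) (ϑ sr) + S.d (ϑ sr) (ϑ rl) + S.d (ϑ rl) (ϑ (α r))) +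
        (S.jumpCost s (ϑ (α s)) (ϑ sr) - S.d (ϑ (α s)) (ϑ sr)) +
        (S.jumpCost r (ϑ rl) (ϑ (α r)) - S.d (ϑ rl) (ϑ (α r))) := by gcongr
    _ = (S.d (ϑ (α s)) (ϑ sr) + (S.jumpCost s (ϑ (α s)) (ϑ sr) - S.d (ϑ (α s)) (ϑ sr))) +
        S.d (ϑ sr) (ϑ rl) + (S.d (ϑ rl) (ϑ (α r)) +
          (S.jumpCost r (ϑ rl) (ϑ (α r)) - S.d (ϑ rl) (ϑ (α r)))) := by ring
    _ = _ := by rw [e1, e2]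

end Curve

/-! ### The lower energy estimate -/

section Curve

variable {C : ℝ} {K : Set ℝ} {ϑ : ℝ → X} {Θ G α : ℝ → ℝ}

theorem exists_abs_power_le (hA : S.AssumptionA) (C : ℝ) : ∃ L : ℝ, 0 ≤ L ∧
    ∀ t ∈ Icc 0 S.T, ∀ x, S.F t x ≤ C → |S.power t x| ≤ L := by
  obtain ⟨c, hc, h⟩ := hA.power_bound
  refine ⟨c * max C 0, by positivity, fun t ht x hx => (h t ht x).trans ?_⟩
  exact mul_le_mul_of_nonneg_left (hx.trans (le_max_left _ _)) hc.le

theorem IsClock.mem_sublevel (hα : IsClock S K Θ α) (h : IsProfile S C K ϑ Θ G) {t : ℝ}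
    (ht : t ∈ Icc 0 S.T) (r : ℝ) : (t, ϑ (α r)) ∈ S.sublevel C :=
  ⟨ht, h.F_le _ (hα.mem r) t ht⟩

variable [T2Space X]

theorem IsClock.continuousAt_curve (hA : S.AssumptionA) (hC : S.AssumptionC)
    (hα : IsClock S K Θ α) (h : IsProfile S C K ϑ Θ G) {t : ℝ} (ht : ContinuousAt α t) :
    ContinuousAt (fun s => ϑ (α s)) t :=
  (h.continuousOn hA hC _ (hα.mem t)).tendsto.comp
    (tendsto_nhdsWithin_iff.2 ⟨ht, Eventually.of_forall hα.mem⟩)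

/-- Off the countably many discontinuities of the curve, the power along it is upper
semicontinuous, hence measurable. -/
theorem IsClock.intervalIntegrable_power (hA : S.AssumptionA) (hC : S.AssumptionC)
    (hα : IsClock S K Θ α) (h : IsProfile S C K ϑ Θ G) :
    IntervalIntegrable (fun s => S.power s (ϑ (α s))) volume 0 S.T := by
  obtain ⟨L, -, hL⟩ := exists_abs_power_le hA C
  set N : Set ℝ := {t | ¬ ContinuousAt α t}
  have hN : N.Countable := hα.mono.countable_not_continuousAt
  have hmeas : MeasurableSet (Icc 0 S.T \ N) := measurableSet_Icc.diff hN.measurableSet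
  rw [intervalIntegrable_iff_integrableOn_Icc_of_le S.T_pos.le]
  refine IntegrableOn.congr_set_ae ?_ (sdiff_null_ae_eq_self (hN.measure_zero volume)).symm
  have : IsFiniteMeasure (volume.restrict (Icc 0 S.T \ N)) :=
    isFiniteMeasure_restrict.2 ((measure_mono sdiff_subset).trans_lt measure_Icc_lt_top).ne
  refine Integrable.of_bound ?_ L ?_
  · suffices hf : UpperSemicontinuous fun s : ↥(Icc 0 S.T \ N) => S.power s (ϑ (α s)) from
      (aemeasurable_restrict_of_measurable_subtype hmeas hf.measurable).aestronglyMeasurable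
    intro p y hy
    have hc : ContinuousAt α p := by simpa [N] using p.2.2
    have h1 : Tendsto (fun q : ↥(Icc 0 S.T \ N) => ((q : ℝ), ϑ (α q))) (𝓝 p)
        (𝓝[S.sublevel C] ((p : ℝ), ϑ (α p))) :=
      tendsto_nhdsWithin_iff.2 ⟨(continuous_subtype_val.tendsto p).prodMk_nhds
        ((hα.continuousAt_curve hA hC h hc).tendsto.comp (continuous_subtype_val.tendsto p)),
        Eventually.of_forall fun q => hα.mem_sublevel h q.2.1 _⟩
    exact h1.eventually (hA.power_usc C _ (hα.mem_sublevel h p.2.1 _) y hy)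
  · refine (ae_restrict_mem hmeas).mono fun s hs => ?_
    exact hL s hs.1 _ (hα.mem_sublevel h hs.1 s).2

/-- The energy lost along the curve is at most what is dissipated. By continuous induction on
`[0, t]`: to the right of a point the jump cost bounds the energy drop, and to the left of a point
`r` the local stability condition compares the stable states `u s` with the stable state `u (r-)`,
at the price of a factor `M > 1`. -/
theorem IsClock.energy_add_integral_le (hA : S.AssumptionA) (hB : S.AssumptionB)
    (hC : S.AssumptionC) (hα : IsClock S K Θ α) (h : IsProfile S C K ϑ Θ G) {t : ℝ}
    (ht : t ∈ Icc 0 S.T) :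
    S.energy 0 (ϑ (α 0)) + ∫ s in (0 : ℝ)..t, S.power s (ϑ (α s)) ≤
      S.energy t (ϑ (α t)) + (augmentedVar S.d S.jumpCost (fun s => ϑ (α s)) 0 t).toReal := by
  obtain ⟨L, hL0, hL⟩ := exists_abs_power_le hA C
  set u : ℝ → X := fun s => ϑ (α s) with hu
  set I : ℝ → ℝ := fun s => ∫ r in (0 : ℝ)..s, S.power r (u r) with hI
  set A : ℝ → ℝ := fun s => (augmentedVar S.d S.jumpCost u 0 s).toReal with hAdef
  have hint := hα.intervalIntegrable_power hA hC h
  have hintsub : ∀ s ∈ Icc 0 t, ∀ r ∈ Icc 0 t, IntervalIntegrable (fun s => S.power s (u s))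
      volume s r := fun s hs r hr => by
    refine hint.mono_set ?_
    rw [uIcc_of_le S.T_pos.le]
    exact uIcc_subset_Icc ⟨hs.1, hs.2.trans ht.2⟩ ⟨hr.1, hr.2.trans ht.2⟩
  have hIsub : ∀ s ∈ Icc 0 t, ∀ r ∈ Icc 0 t, I r - I s = ∫ p in s..r, S.power p (u p) :=
    fun s hs r hr => intervalIntegral.integral_interval_sub_left
      (hintsub 0 ⟨le_rfl, ht.1⟩ r hr) (hintsub 0 ⟨le_rfl, ht.1⟩ s hs)
  have hfin : ∀ s ∈ Icc 0 t, augmentedVar S.d S.jumpCost u 0 s ≠ ⊤ := fun s hs =>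
    ((hα.augmentedVar_le hA hC h ⟨hs.1, hs.2.trans ht.2⟩).trans_lt ENNReal.ofReal_lt_top).ne
  have hstep : ∀ s ∈ Icc 0 t, ∀ r ∈ Icc 0 t, s < r → ∀ v : ℝ, ENNReal.ofReal v ≤
      pointwiseVar S.d u (Icc s r) +
        (S.jumpCost s (u s) (rightLimit r u s) - S.d (u s) (rightLimit r u s)) +
        (S.jumpCost r (leftLimit 0 u r) (u r) - S.d (leftLimit 0 u r) (u r)) →
      A s + v ≤ A r := by
    intro s hs r hr hsr v hv
    have hadd := augmentedVar_add_le (u := u) S.d_self (jumpCost_self (S := S)) hs.1 hsr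
    set W := pointwiseVar S.d u (Icc s r) +
        (S.jumpCost s (u s) (rightLimit r u s) - S.d (u s) (rightLimit r u s)) +
        (S.jumpCost r (leftLimit 0 u r) (u r) - S.d (leftLimit 0 u r) (u r))
    have hW : W ≠ ⊤ := ne_top_of_le_ne_top (hfin r hr) (le_add_self.trans hadd)
    have h1 : v ≤ W.toReal := (ENNReal.ofReal_le_iff_le_toReal hW).1 hv
    have h2 : A s + W.toReal ≤ A r := by
      rw [hAdef, ← ENNReal.toReal_add (hfin s hs) hW]
      exact ENNReal.toReal_mono (hfin r hr) hadd
    linarith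
  have hAmono : ∀ s ∈ Icc 0 t, ∀ r ∈ Icc 0 t, s < r → A s ≤ A r := fun s hs r hr hsr => by
    simpa using hstep s hs r hr hsr 0 (by simp)
  -- The factor is `M = 1 + e`; the errors in the power on the left of `r` cost `2 * e` per time.
  have main : ∀ e : ℝ, 0 < e →
      S.energy 0 (u 0) + I t ≤ S.energy t (u t) + A t + e * (A t + 2 * t) := by
    intro e he
    have hCI := le_of_forall_exists_lt_le (K := Icc 0 t)
      (φ := fun s => S.energy s (u s) + (1 + e) * A s + 2 * e * s - I s) isCompact_Icc
      (isLeast_Icc ht.1) (right_mem_Icc.2 ht.1) ?_ ?_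
    · have h1 : A 0 = 0 := by
        rw [hAdef]
        simp [augmentedVar_self S.d_self (jumpCost_self (S := S))]
      have h2 : I 0 = 0 := by simp [hI]
      simp only [h1, h2] at hCI
      linarith
    · intro s hs ε hε
      rcases hs.2.eq_or_lt with hst | hst
      · have : Icc 0 t ∩ Ioi s = ∅ := by
          ext r
          simp only [mem_inter_iff, mem_Icc, mem_Ioi, mem_empty_iff_false, iff_false, not_and,
            not_lt]
          exact fun hr => hst ▸ hr.2
        rw [this, nhdsWithin_empty]
        exact eventually_bot
      set w := ϑ (Function.rightLim α s)
      have hsT : s ∈ Icc 0 S.T := ⟨hs.1, hs.2.trans ht.2⟩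
      have hwlim : Tendsto u (𝓝[>] s) (𝓝 w) := hα.tendsto_curve_right hA hC h s
      have hwmem : (s, w) ∈ S.sublevel C := ⟨hsT, h.F_le _ (hα.rightLim_mem h s) s hsT⟩
      have hev : ∀ᶠ r in 𝓝[>] s, S.energy s w ≤ S.energy r (u r) + ε / 2 :=
        tendsto_energy_lsc hA hwmem (p := fun r => (r, u r))
          ((tendsto_id.mono_left nhdsWithin_le_nhds).prodMk_nhds hwlim)
          (by
            filter_upwards [eventually_mem_Icc_right ⟨hs.1, hst.trans_le ht.2⟩] with r hr
            exact hα.mem_sublevel h hr.1 r) (half_pos hε)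
      have hev2 : ∀ᶠ r in 𝓝[>] s, L * (r - s) < ε / 2 := by
        have : Tendsto (fun r => L * (r - s)) (𝓝[>] s) (𝓝 (L * (s - s))) :=
          ((tendsto_id.sub_const s).const_mul L).mono_left nhdsWithin_le_nhds
        rw [sub_self, mul_zero] at this
        exact this.eventually (gt_mem_nhds (half_pos hε))
      filter_upwards [nhdsWithin_mono s inter_subset_right hev,
        nhdsWithin_mono s inter_subset_right hev2, self_mem_nhdsWithin] with r h1 h2 hr
      have hsr : s < r := hr.2
      -- The jump from `u s` to `u (s+)` is paid for by the augmented variation on `[s, r]`.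
      have hcost : A s + (S.energy s (u s) - S.energy s w) ≤ A r := by
        refine hstep s hs r hr.1 hsr _ ?_
        refine le_trans ?_ le_self_add
        rw [hα.rightLimit_curve hA hC h hsr]
        have hd : S.d (u s) w ≤ pointwiseVar S.d u (Icc s r) := by
          refine S.d_lsc.le_of_tendsto_of_le (tendsto_const_nhds.prodMk_nhds hwlim)
            tendsto_const_nhds ?_
          filter_upwards [Ioo_mem_nhdsGT hsr] with p hp
          exact le_pointwiseVar ⟨le_rfl, hsr.le⟩ ⟨hp.1.le, hp.2.le⟩ hp.1.le
        refine (ofReal_energy_sub_le_jumpCost hA hB hC hsT _ _).trans ?_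
        exact (add_tsub_cancel_of_le (d_le_jumpCost (S := S) s (u s) w)).ge.trans
          (add_le_add_left hd _)
      have hAm := hAmono s hs r hr.1 hsr
      have hIle : I r - I s ≤ L * (r - s) := by
        rw [hIsub s hs r hr.1]
        have := intervalIntegral.norm_integral_le_of_norm_le_const (a := s) (b := r) (C := L)
          (f := fun p => S.power p (u p)) fun p hp => by
            rw [uIoc_of_le hsr.le] at hp
            have hpT : p ∈ Icc 0 S.T := ⟨hs.1.trans hp.1.le, hp.2.trans (hr.1.2.trans ht.2)⟩
            exact hL p hpT _ (hα.mem_sublevel h hpT p).2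
        rw [abs_of_pos (sub_pos.2 hsr)] at this
        exact (le_abs_self _).trans this
      nlinarith [mul_nonneg he.le (sub_nonneg.2 hAm), mul_pos he (sub_pos.2 hsr)]
    · intro r hr h0r
      have hrT : r ∈ Ioc 0 S.T := ⟨h0r, hr.2.trans ht.2⟩
      have hrT' : r ∈ Icc 0 S.T := ⟨h0r.le, hr.2.trans ht.2⟩
      set x := ϑ (Function.leftLim α r)
      have hxst : S.Stable r x := hα.stable_leftLim h hrT
      have hxlim : Tendsto u (𝓝[<] r) (𝓝 x) := hα.tendsto_curve_left hA hC h r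
      have hxmem : (r, x) ∈ S.sublevel C := ⟨hrT', h.F_le _ (hα.leftLim_mem h r) r hrT'⟩
      obtain ⟨η, hη, U, hU, hloc⟩ := hB.local_stable r hrT' x hxst (1 + e) (by linarith)
      have ev1 : ∀ᶠ s in 𝓝[<] r, u s ∈ U := hxlim.eventually_mem hU
      have ev2 : ∀ᶠ s in 𝓝[<] r, S.d (u s) x < ENNReal.ofReal η :=
        (hα.tendsto_d_left h r).eventually (gt_mem_nhds (ENNReal.ofReal_pos.2 hη))
      have ev3 : ∀ᶠ s in 𝓝[<] r, r - η < s ∧ 0 < s :=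
        nhdsWithin_le_nhds ((lt_mem_nhds (by linarith)).and (lt_mem_nhds h0r))
      have ev4 : ∀ᶠ s in 𝓝[<] r, (S.power r x - e) * (r - s) ≤ S.energy r x - S.energy s x := by
        have := eventually_le_energy_sub hA hrT' (x := x) (c := S.power r x - e) (by linarith)
        rwa [nhdsWithin_Ico_eq_nhdsLT h0r] at this
      have ev5 : ∀ᶠ s in 𝓝[<] r, S.power s (u s) < S.power r x + e := by
        have : Tendsto (fun s => (s, u s)) (𝓝[<] r) (𝓝[S.sublevel C] (r, x)) :=
          tendsto_nhdsWithin_iff.2 ⟨(tendsto_id.mono_left nhdsWithin_le_nhds).prodMk_nhds hxlim, by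
            filter_upwards [eventually_mem_Icc_left hrT] with s hs
            exact hα.mem_sublevel h hs.1 s⟩
        exact this.eventually (hA.power_usc C _ hxmem _ (by simp [he]))
      -- Compare with a continuity point `s` of the curve to the left of `r`, where `u s` is stable.
      obtain ⟨l, hl, hlr⟩ := (mem_nhdsLT_iff_exists_Ioo_subset).1
        (ev1.and (ev2.and (ev3.and (ev4.and ev5))))
      obtain ⟨s, hsN, hs⟩ := ((hα.mono.countable_not_continuousAt).dense_compl ℝ).exists_mem_open
        isOpen_Ioo (nonempty_Ioo.2 hl)
      have hsr : s < r := hs.2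
      obtain ⟨g1, g2, ⟨g3, g3'⟩, g4, -⟩ := hlr hs
      have hst : s ∈ Icc 0 t := ⟨g3'.le, hsr.le.trans hr.2⟩
      have hsT : s ∈ Icc 0 S.T := ⟨g3'.le, hst.2.trans ht.2⟩
      refine ⟨s, hst, hsr, ?_⟩
      have k1 := hloc s hsT g3 hsr.le (u s) g1
        (hα.stable_of_notMem h ⟨g3', hsT.2⟩ hsN) g2.le
      have hdfin : S.d (u s) x ≠ ⊤ := (g2.trans ENNReal.ofReal_lt_top).ne
      -- The variation on `[s, r]` pays for reaching `x = u (r-)` as well as for the jump to `u r`.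
      have k2 : A s + (max (S.energy r x - S.energy r (u r)) 0 + (S.d (u s) x).toReal) ≤ A r := by
        refine hstep s hst r hr hsr _ ?_
        rw [hα.leftLimit_curve hA hC h h0r, ENNReal.ofReal_add (le_max_right _ _)
          ENNReal.toReal_nonneg, ENNReal.ofReal_toReal hdfin, ENNReal.ofReal_max,
          ENNReal.ofReal_zero, max_eq_left zero_le]
        have hd : S.d (u s) x + S.d x (u r) ≤ pointwiseVar S.d u (Icc s r) := by
          have hlsc : LowerSemicontinuous fun y => S.d (u s) y + S.d y (u r) :=
            LowerSemicontinuous.add (f := fun y => S.d (u s) y) (g := fun y => S.d y (u r))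
              (fun y m hm => ((by fun_prop : Continuous fun y => (u s, y)).tendsto y).eventually
                (S.d_lsc _ m hm))
              (fun y m hm => ((by fun_prop : Continuous fun y => (y, u r)).tendsto y).eventually
                (S.d_lsc _ m hm))
          refine hlsc.le_of_tendsto_of_le hxlim tendsto_const_nhds ?_
          filter_upwards [Ioo_mem_nhdsLT hsr] with p hp
          refine le_trans (add_le_add (le_pointwiseVar (left_mem_Icc.2 hp.1.le)
            (right_mem_Icc.2 hp.1.le) hp.1.le) (le_pointwiseVar (left_mem_Icc.2 hp.2.le)
            (right_mem_Icc.2 hp.2.le) hp.2.le)) (pointwiseVar_add_le (Icc_subset_Icc le_rfl hp.2.le)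
              (Icc_subset_Icc hp.1.le le_rfl) fun a ha b hb => ha.2.trans hb.1)
        have hj := ofReal_energy_sub_le_jumpCost hA hB hC hrT' x (u r)
        rw [← add_tsub_cancel_of_le (d_le_jumpCost (S := S) r x (u r))] at hj
        calc _ ≤ S.d x (u r) + (S.jumpCost r x (u r) - S.d x (u r)) + S.d (u s) x := by gcongr
          _ = (S.d (u s) x + S.d x (u r)) + (S.jumpCost r x (u r) - S.d x (u r)) := by ring
          _ ≤ _ := add_le_add (hd.trans le_self_add) le_rfl
      have k3 : I r - I s ≤ (S.power r x + e) * (r - s) := by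
        rw [hIsub s hst r hr]
        have := intervalIntegral.integral_mono_on_of_le_Ioo hsr.le (hintsub s hst r hr)
          (intervalIntegrable_const (c := S.power r x + e)) fun p hp =>
            (hlr ⟨hs.1.trans hp.1, hp.2⟩).2.2.2.2.le
        rw [intervalIntegral.integral_const, smul_eq_mul] at this
        linarith
      have k4 : S.energy r x - S.energy r (u r) ≤
          (1 + e) * max (S.energy r x - S.energy r (u r)) 0 := by
        have m1 := le_max_left (S.energy r x - S.energy r (u r)) 0
        have m2 := le_max_right (S.energy r x - S.energy r (u r)) 0
        nlinarith
      have k5 := mul_le_mul_of_nonneg_left k2 (by linarith : (0 : ℝ) ≤ 1 + e)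
      show S.energy s (u s) + (1 + e) * A s + 2 * e * s - I s ≤
        S.energy r (u r) + (1 + e) * A r + 2 * e * r - I r
      linarith
  refine le_of_forall_pos_le_add fun ε hε => ?_
  have hA0 : 0 ≤ A t := ENNReal.toReal_nonneg
  have ht0 := ht.1
  have hpos : 0 < A t + 2 * t + 1 := by linarith
  have h1 := main (ε / (A t + 2 * t + 1)) (div_pos hε hpos)
  have h2 : ε / (A t + 2 * t + 1) * (A t + 2 * t) ≤ ε := by
    rw [div_mul_eq_mul_div, div_le_iff₀ hpos]
    nlinarith
  exact h1.trans (by linarith)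

end Curve

end RateIndependentSystem

/-! ### The interpolant of the scheme -/

namespace TimePartition

variable {T : ℝ} (τ : TimePartition T)

/-- The index of the value taken by the interpolant at time `t`. -/
noncomputable def index (t : ℝ) : ℕ := sInf {n : ℕ | t ≤ τ.t n}

theorem index_le {t : ℝ} {n : ℕ} (h : t ≤ τ.t n) : τ.index t ≤ n := Nat.sInf_le h

theorem index_le_N {t : ℝ} (ht : t ≤ T) : τ.index t ≤ τ.N :=
  τ.index_le (ht.trans τ.t_last.ge)

theorem le_t_index {t : ℝ} (ht : t ≤ T) : t ≤ τ.t (τ.index t) :=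
  Nat.sInf_mem (s := {n : ℕ | t ≤ τ.t n}) ⟨τ.N, ht.trans τ.t_last.ge⟩

theorem t_lt_of_lt_index {t : ℝ} {n : ℕ} (h : n < τ.index t) : τ.t n < t :=
  not_le.1 (Nat.notMem_of_lt_sInf h)

theorem index_zero : τ.index 0 = 0 := Nat.le_zero.1 (τ.index_le τ.t_zero.ge)

theorem index_pos {t : ℝ} (h0 : 0 < t) (ht : t ≤ T) : 0 < τ.index t := by
  rcases Nat.eq_zero_or_pos (τ.index t) with h | h
  · have := τ.le_t_index ht
    rw [h, τ.t_zero] at this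
    exact absurd this (not_le.2 h0)
  · exact h

theorem index_mono {s t : ℝ} (hst : s ≤ t) (ht : t ≤ T) : τ.index s ≤ τ.index t :=
  τ.index_le (hst.trans (τ.le_t_index ht))

theorem index_eq {t : ℝ} {n : ℕ} (hn : n < τ.N) (ht : t ∈ Ioc (τ.t n) (τ.t (n + 1))) :
    τ.index t = n + 1 := by
  refine le_antisymm (τ.index_le ht.2) (not_lt.1 fun h => ?_)
  have h1 := τ.le_t_index (ht.2.trans (τ.t_mem hn).2)
  have h2 := τ.t_le (Nat.lt_succ_iff.1 h) hn.le
  exact absurd (h1.trans h2) (not_le.2 ht.1)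

theorem t_index_sub_le {μ : ℝ} (hμ : ∀ n < τ.N, τ.t (n + 1) - τ.t n ≤ μ) {t : ℝ}
    (ht : t ∈ Icc 0 T) (hμ0 : 0 ≤ μ) : τ.t (τ.index t) - t ≤ μ := by
  rcases ht.1.eq_or_lt with rfl | h0
  · rwa [index_zero, τ.t_zero, sub_zero]
  have h1 := τ.index_pos h0 ht.2
  obtain ⟨n, hn⟩ : ∃ n, τ.index t = n + 1 := ⟨τ.index t - 1, by omega⟩
  have h2 := τ.index_le_N ht.2
  have h3 := τ.t_lt_of_lt_index (t := t) (n := n) (by omega)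
  have h4 := hμ n (by omega)
  rw [hn]
  linarith

theorem sub_t_index_le {μ : ℝ} (hμ : ∀ n < τ.N, τ.t (n + 1) - τ.t n ≤ μ) {t : ℝ} (h0 : 0 < t)
    (ht : t ≤ T) : t - τ.t (τ.index t - 1) ≤ μ := by
  have h1 := τ.index_pos h0 ht
  obtain ⟨n, hn⟩ : ∃ n, τ.index t = n + 1 := ⟨τ.index t - 1, by omega⟩
  have h2 := τ.index_le_N ht
  have h3 := τ.le_t_index ht
  have h4 := hμ n (by omega)
  rw [hn] at h3 ⊢
  simp only [Nat.add_sub_cancel]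
  linarith

end TimePartition

/-! ### The upper energy estimate -/

/-- Reverse Fatou lemma on a bounded interval, in additive form. -/
theorem eventually_intervalIntegral_le {f : ℕ → ℝ → ℝ} {g : ℝ → ℝ} {a b L : ℝ} (hab : a ≤ b)
    (hf : ∀ k, IntervalIntegrable (f k) volume a b) (hg : IntervalIntegrable g volume a b)
    (hfL : ∀ k, ∀ r ∈ Ioc a b, |f k r| ≤ L) (hgL : ∀ r ∈ Ioc a b, |g r| ≤ L)
    (h : ∀ᵐ r, r ∈ Ioc a b → ∀ ε : ℝ, 0 < ε → ∀ᶠ k in atTop, f k r ≤ g r + ε) {ε : ℝ}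
    (hε : 0 < ε) : ∀ᶠ k in atTop, ∫ r in a..b, f k r ≤ (∫ r in a..b, g r) + ε := by
  have hF : ∀ k, IntervalIntegrable (fun r => max (f k r - g r) 0) volume a b := fun k =>
    ⟨((hf k).sub hg).1.pos_part, ((hf k).sub hg).2.pos_part⟩
  have hlim : Tendsto (fun k => ∫ r in a..b, max (f k r - g r) 0) atTop
      (𝓝 (∫ r in a..b, (0 : ℝ))) := by
    refine intervalIntegral.tendsto_integral_filter_of_dominated_convergence (fun _ => 2 * L)
      (Eventually.of_forall fun k => (uIoc_of_le hab).symm ▸ (hF k).1.aestronglyMeasurable)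
      (Eventually.of_forall fun k => Eventually.of_forall fun r hr => ?_)
      intervalIntegrable_const (h.mono fun r hr hrI => ?_)
    · rw [uIoc_of_le hab] at hr
      have h1 := abs_le.1 (hfL k r hr)
      have h2 := abs_le.1 (hgL r hr)
      rw [Real.norm_of_nonneg (le_max_right _ _)]
      exact max_le (by linarith) (by linarith)
    · rw [uIoc_of_le hab] at hrI
      refine tendsto_order.2 ⟨fun c hc => Eventually.of_forall fun k =>
        hc.trans_le (le_max_right _ _), fun c hc => ?_⟩
      filter_upwards [hr hrI (c / 2) (half_pos hc)] with k hk
      exact max_lt (by linarith) hc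
  rw [intervalIntegral.integral_zero] at hlim
  filter_upwards [hlim.eventually (gt_mem_nhds hε)] with k hk
  have h1 : ∫ r in a..b, (f k r - g r) ≤ ∫ r in a..b, max (f k r - g r) 0 :=
    intervalIntegral.integral_mono_on hab ((hf k).sub hg) (hF k) fun r _ => le_max_left _ _
  rw [intervalIntegral.integral_sub (hf k) hg] at h1
  linarith

namespace RateIndependentSystem

variable {X : Type*} [TopologicalSpace X] {S : RateIndependentSystem X}

/-- The discrete energy identity, with the work of the external forces as an integral along the
interpolant delayed by one step. -/
theorem energy_add_dissipated_eq_integral (hA : S.AssumptionA) (τ : TimePartition S.T) {U : ℕ → X}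
    {L : ℝ} (hL : ∀ n ≤ τ.N, ∀ r ∈ Icc 0 S.T, |S.power r (U n)| ≤ L) {j : ℕ} (hj : j ≤ τ.N) :
    IntervalIntegrable (fun r => S.power r (U (τ.index r - 1))) volume 0 (τ.t j) ∧
    S.energy (τ.t j) (U j) + S.dissipated τ.t U j =
      S.energy 0 (U 0) + ∫ r in (0 : ℝ)..τ.t j, S.power r (U (τ.index r - 1)) := by
  have hstep : ∀ i < j, IntervalIntegrable (fun r => S.power r (U (τ.index r - 1))) volume
      (τ.t i) (τ.t (i + 1)) ∧ ∫ r in τ.t i..τ.t (i + 1), S.power r (U (τ.index r - 1)) =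
        S.energy (τ.t (i + 1)) (U i) - S.energy (τ.t i) (U i) := fun i hi => by
    have hle : τ.t i ≤ τ.t (i + 1) := (τ.t_lt i (by omega)).le
    obtain ⟨h1, h2⟩ := energy_sub_eq_integral hA (hL i (by omega)) (τ.t_mem (by omega))
      (τ.t_mem (by omega)) hle
    have he : ∀ r ∈ Ioc (τ.t i) (τ.t (i + 1)), S.power r (U i) = S.power r (U (τ.index r - 1)) :=
      fun r hr => by rw [τ.index_eq (by omega) hr, Nat.add_sub_cancel]
    refine ⟨h1.congr fun r hr => he r (by rwa [uIoc_of_le hle] at hr), ?_⟩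
    rw [← h2]
    refine intervalIntegral.integral_congr_ae (Eventually.of_forall fun r hr => ?_)
    rw [uIoc_of_le hle] at hr
    exact (he r hr).symm
  have h1 := IntervalIntegrable.trans_iterate fun i hi => (hstep i hi).1
  have h2 := intervalIntegral.sum_integral_adjacent_intervals fun i hi => (hstep i hi).1
  rw [τ.t_zero] at h1 h2
  refine ⟨h1, ?_⟩
  rw [energy_add_dissipated, τ.t_zero, ← h2]
  congr 1
  exact Finset.sum_congr rfl fun i hi => ((hstep i (Finset.mem_range.1 hi)).2).symm

/-- Convergence of discrete solutions of the scheme: as chains, they converge to a parametrized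
evolution, and at every time `t` the arclength of the interpolant converges to the clock `α t`.
The mesh sizes are bounded by a sequence `μ` tending to zero, and all but countably many times are
reached at a single parameter. -/
structure SchemeTendsto (τ : ℕ → TimePartition S.T) (U : ℕ → ℕ → X) {C R : ℝ}
    (c : ℕ → S.Chain C R) (K : Set ℝ) (ϑ : ℝ → X) (Θ G α : ℝ → ℝ) : Prop where
  chains : ChainsTendsto c K ϑ Θ G
  profile : IsProfile S C K ϑ Θ G
  clock : IsClock S K Θ α
  N_eq : ∀ k, (c k).N = (τ k).N
  t_eq : ∀ k, (c k).t = (τ k).t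
  x_eq : ∀ k, (c k).x = U k
  σ_eq : ∀ k, (c k).σ = S.dissipated (τ k).t (U k)
  mesh : ∃ μ : ℕ → ℝ, Tendsto μ atTop (𝓝 0) ∧ (∀ k, 0 ≤ μ k) ∧
    ∀ k, ∀ n < (τ k).N, (τ k).t (n + 1) - (τ k).t n ≤ μ k
  arc : ∀ t ∈ Icc 0 S.T, Tendsto (fun k => (c k).a ((τ k).index t)) atTop (𝓝 (α t))
  plateaus : ∃ D : Set ℝ, D.Countable ∧ ∀ b ∈ K, ∀ b' ∈ K, Θ b = Θ b' → Θ b ∉ D → b = b'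

namespace SchemeTendsto

variable {τ : ℕ → TimePartition S.T} {U : ℕ → ℕ → X} {C R : ℝ} {c : ℕ → S.Chain C R} {K : Set ℝ}
  {ϑ : ℝ → X} {Θ G α : ℝ → ℝ}

theorem tendsto (h : SchemeTendsto τ U c K ϑ Θ G α) {t : ℝ} (ht : t ∈ Icc 0 S.T) :
    Tendsto (fun k => U k ((τ k).index t)) atTop (𝓝 (ϑ (α t))) ∧
    Tendsto (fun k => (τ k).t ((τ k).index t)) atTop (𝓝 t) ∧
    Tendsto (fun k => S.dissipated (τ k).t (U k) ((τ k).index t)) atTop (𝓝 (G (α t))) := by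
  have := (h.chains.tendsto id strictMono_id (fun k => (τ k).index t)
    (fun k => (h.N_eq k).symm ▸ (τ k).index_le_N ht.2) _ (h.arc t ht)).2
  simpa only [id, h.t_eq, h.x_eq, h.σ_eq, h.clock.time t ht] using this

theorem mem_sublevel (h : SchemeTendsto τ U c K ϑ Θ G α) {k n : ℕ} (hn : n ≤ (τ k).N) {s : ℝ}
    (hs : s ∈ Icc 0 S.T) : (s, U k n) ∈ S.sublevel C := by
  have := (c k).mem_sublevel (h.N_eq k ▸ hn) hs
  rwa [h.x_eq] at this

/-- Outside the countably many plateaus of the time, the delayed interpolant converges as well. -/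
theorem tendsto_delayed (h : SchemeTendsto τ U c K ϑ Θ G α) {D : Set ℝ}
    (hD : ∀ b ∈ K, ∀ b' ∈ K, Θ b = Θ b' → Θ b ∉ D → b = b') {t : ℝ} (ht : t ∈ Ioc 0 S.T)
    (htD : t ∉ D) : Tendsto (fun k => U k ((τ k).index t - 1)) atTop (𝓝 (ϑ (α t))) := by
  obtain ⟨μ, hμ, -, hmesh⟩ := h.mesh
  have hN : ∀ k, (τ k).index t - 1 ≤ (c k).N := fun k => by
    rw [h.N_eq]; exact (Nat.sub_le _ _).trans ((τ k).index_le_N ht.2)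
  have htime : Tendsto (fun k => (τ k).t ((τ k).index t - 1)) atTop (𝓝 t) := by
    refine tendsto_of_tendsto_of_tendsto_of_le_of_le (by simpa using hμ.const_sub t)
      tendsto_const_nhds (fun k => ?_) fun k => ?_
    · have := (τ k).sub_t_index_le (hmesh k) ht.1 ht.2
      linarith
    · have := (τ k).index_pos ht.1 ht.2
      exact ((τ k).t_lt_of_lt_index (by omega)).le
  have harc : Tendsto (fun k => (c k).a ((τ k).index t - 1)) atTop (𝓝 (α t)) := by
    refine (isCompact_Icc (a := (0 : ℝ)) (b := R)).isSeqCompact.tendsto_of_unique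
      (Eventually.of_forall fun k => (c k).a_mem (hN k)) fun ψ hψ b hb => ?_
    obtain ⟨hbK, -, hbt, -⟩ := h.chains.tendsto ψ hψ _ (fun k => hN (ψ k)) b hb
    have hΘ : Θ b = t := by
      refine tendsto_nhds_unique hbt ?_
      simpa only [h.t_eq, Function.comp_def] using htime.comp hψ.tendsto_atTop
    exact hD b hbK _ (h.clock.mem t) (by rw [hΘ, h.clock.time t ⟨ht.1.le, ht.2⟩]) (by rwa [hΘ])
  have := (h.chains.tendsto id strictMono_id _ hN _ harc).2.1
  simpa only [id, h.x_eq] using this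

variable [T2Space X]

/-- The discrete energies and dissipations at time `t` are asymptotically controlled by the initial
energy and the work along the limit curve. -/
theorem eventually_energy_add_dissipated_le (hA : S.AssumptionA) (hC : S.AssumptionC)
    (h : SchemeTendsto τ U c K ϑ Θ G α) {t : ℝ} (ht : t ∈ Icc 0 S.T) {ε : ℝ} (hε : 0 < ε) :
    ∀ᶠ k in atTop, S.energy t (U k ((τ k).index t)) +
      S.dissipated (τ k).t (U k) ((τ k).index t) ≤
      S.energy 0 (U k 0) + (∫ s in (0 : ℝ)..t, S.power s (ϑ (α s))) + ε := by
  obtain ⟨L, hL0, hL⟩ := exists_abs_power_le hA C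
  obtain ⟨D, hDc, hD⟩ := h.plateaus
  have hPU : ∀ k, ∀ n ≤ (τ k).N, ∀ r ∈ Icc 0 S.T, |S.power r (U k n)| ≤ L := fun k n hn r hr =>
    hL r hr _ (h.mem_sublevel hn hr).2
  have hPd : ∀ k, ∀ r ∈ Icc 0 S.T, |S.power r (U k ((τ k).index r - 1))| ≤ L := fun k r hr =>
    hPU k _ ((Nat.sub_le _ _).trans ((τ k).index_le_N hr.2)) r hr
  have hintT : ∀ k, IntervalIntegrable (fun r => S.power r (U k ((τ k).index r - 1))) volume
      0 S.T := fun k => by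
    have := (energy_add_dissipated_eq_integral hA (τ k) (hPU k) le_rfl).1
    rwa [(τ k).t_last] at this
  have hsub : ∀ s ∈ Icc 0 S.T, uIcc 0 s ⊆ uIcc 0 S.T := fun s hs => by
    rw [uIcc_of_le hs.1, uIcc_of_le S.T_pos.le]
    exact Icc_subset_Icc le_rfl hs.2
  have hae : ∀ᵐ r : ℝ, r ∉ D := hDc.ae_notMem volume
  have hint := eventually_intervalIntegral_le (L := L) ht.1
    (fun k => (hintT k).mono_set (hsub t ht))
    ((h.clock.intervalIntegrable_power hA hC h.profile).mono_set (hsub t ht))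
    (fun k r hr => hPd k r ⟨hr.1.le, hr.2.trans ht.2⟩)
    (fun r hr => hL r ⟨hr.1.le, hr.2.trans ht.2⟩ _
      (h.clock.mem_sublevel h.profile ⟨hr.1.le, hr.2.trans ht.2⟩ r).2)
    (hae.mono fun r hrD hr ε hε => by
      have hrT : r ∈ Icc 0 S.T := ⟨hr.1.le, hr.2.trans ht.2⟩
      have h1 : Tendsto (fun k => (r, U k ((τ k).index r - 1))) atTop
          (𝓝[S.sublevel C] (r, ϑ (α r))) :=
        tendsto_nhdsWithin_iff.2 ⟨tendsto_const_nhds.prodMk_nhds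
          (h.tendsto_delayed hD ⟨hr.1, hrT.2⟩ hrD), Eventually.of_forall fun k =>
            h.mem_sublevel ((Nat.sub_le _ _).trans ((τ k).index_le_N hrT.2)) hrT⟩
      exact (h1.eventually (hA.power_usc C _ (h.clock.mem_sublevel h.profile hrT r) _
        (by simp [hε]))).mono fun k hk => le_of_lt hk) (half_pos hε)
  have htlim := (h.tendsto ht).2.1
  -- The work between `t` and the next time of the partition is negligible, twice: along the
  -- interpolant, and for the final state.
  have hsmall : ∀ᶠ k in atTop, 2 * L * ((τ k).t ((τ k).index t) - t) < ε / 2 := by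
    have : Tendsto (fun k => 2 * L * ((τ k).t ((τ k).index t) - t)) atTop (𝓝 (2 * L * (t - t))) :=
      (htlim.sub_const t).const_mul _
    rw [sub_self, mul_zero] at this
    exact this.eventually (gt_mem_nhds (half_pos hε))
  filter_upwards [hint, hsmall] with k h1 h2
  have hN := (τ k).index_le_N ht.2
  set j := (τ k).index t
  have hjT := (τ k).t_mem hN
  have htj : t ≤ (τ k).t j := (τ k).le_t_index ht.2
  have h3 := (energy_add_dissipated_eq_integral hA (τ k) (hPU k) hN).2
  have h4 := energy_sub_le hA (hPU k j hN) hjT ht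
  rw [abs_sub_comm, abs_of_nonneg (sub_nonneg.2 htj)] at h4
  have h5 := intervalIntegral.integral_interval_sub_left ((hintT k).mono_set (hsub _ hjT))
    ((hintT k).mono_set (hsub t ht))
  have h6 := intervalIntegral.norm_integral_le_of_norm_le_const (a := t) (b := (τ k).t j) (C := L)
    (f := fun r => S.power r (U k ((τ k).index r - 1))) fun r hr => by
      rw [uIoc_of_le htj] at hr
      exact hPd k r ⟨ht.1.trans hr.1.le, hr.2.trans hjT.2⟩
  rw [abs_of_nonneg (sub_nonneg.2 htj)] at h6
  have h7 := (le_abs_self _).trans h6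
  linarith

end SchemeTendsto

/-! ### Limits of the scheme are Visco-Energetic solutions -/

namespace SchemeTendsto

variable {τ : ℕ → TimePartition S.T} {U : ℕ → ℕ → X} {C R : ℝ} {c : ℕ → S.Chain C R}
  {K : Set ℝ} {ϑ : ℝ → X} {Θ G α : ℝ → ℝ}

theorem G_zero (h : SchemeTendsto τ U c K ϑ Θ G α) : G (α 0) = 0 := by
  refine tendsto_nhds_unique (h.tendsto ⟨le_rfl, S.T_pos.le⟩).2.2 ?_
  simp [TimePartition.index_zero, dissipated]

theorem eventually_energy_le (hA : S.AssumptionA) (h : SchemeTendsto τ U c K ϑ Θ G α) {t : ℝ}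
    (ht : t ∈ Icc 0 S.T) {ε : ℝ} (hε : 0 < ε) :
    ∀ᶠ k in atTop, S.energy t (ϑ (α t)) ≤ S.energy t (U k ((τ k).index t)) + ε :=
  tendsto_energy_lsc hA (h.clock.mem_sublevel h.profile ht t)
    (tendsto_const_nhds.prodMk_nhds (h.tendsto ht).1)
    (Eventually.of_forall fun k => h.mem_sublevel ((τ k).index_le_N ht.2) ht) hε

variable [T2Space X]

theorem intervalIntegrable (hA : S.AssumptionA) (hC : S.AssumptionC)
    (h : SchemeTendsto τ U c K ϑ Θ G α) {s t : ℝ} (hs : s ∈ Icc 0 S.T) (ht : t ∈ Icc 0 S.T) :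
    IntervalIntegrable (fun r => S.power r (ϑ (α r))) volume s t := by
  refine (h.clock.intervalIntegrable_power hA hC h.profile).mono_set ?_
  rw [uIcc_of_le S.T_pos.le]
  exact uIcc_subset_Icc hs ht

/-- The energy balance in terms of the dissipation `G`, and the identification of the augmented
variation: the chain of upper and lower estimates closes up. -/
theorem energy_eq (hA : S.AssumptionA) (hB : S.AssumptionB) (hC : S.AssumptionC)
    (h : SchemeTendsto τ U c K ϑ Θ G α)
    (hE : Tendsto (fun k => S.energy 0 (U k 0)) atTop (𝓝 (S.energy 0 (ϑ (α 0))))) {t : ℝ}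
    (ht : t ∈ Icc 0 S.T) :
    S.energy t (ϑ (α t)) + G (α t) =
      S.energy 0 (ϑ (α 0)) + ∫ s in (0 : ℝ)..t, S.power s (ϑ (α s)) ∧
    (augmentedVar S.d S.jumpCost (fun s => ϑ (α s)) 0 t).toReal = G (α t) := by
  have h1 : S.energy t (ϑ (α t)) + G (α t) ≤
      S.energy 0 (ϑ (α 0)) + ∫ s in (0 : ℝ)..t, S.power s (ϑ (α s)) := by
    refine le_of_forall_pos_le_add fun ε hε => ?_
    have hε' : 0 < ε / 4 := by linarith
    obtain ⟨k, k1, k2, k3, k4⟩ := ((h.eventually_energy_le hA ht hε').and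
      ((h.eventually_energy_add_dissipated_le hA hC ht hε').and
      (((h.tendsto ht).2.2.eventually (lt_mem_nhds (sub_lt_self _ hε'))).and
      (hE.eventually (gt_mem_nhds (lt_add_of_pos_right _ hε')))))).exists
    linarith
  have h2 := h.clock.energy_add_integral_le hA hB hC h.profile ht
  have h3 := h.clock.augmentedVar_le hA hC h.profile ht
  rw [h.G_zero, sub_zero] at h3
  have h4 : 0 ≤ G (α t) := h.G_zero ▸ h.profile.G_mono (h.clock.mem 0) (h.clock.mem t)
    (h.clock.mono ht.1)
  have h5 := ENNReal.toReal_le_of_le_ofReal h4 h3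
  constructor <;> linarith

theorem tendsto_energy (hA : S.AssumptionA) (hB : S.AssumptionB) (hC : S.AssumptionC)
    (h : SchemeTendsto τ U c K ϑ Θ G α)
    (hE : Tendsto (fun k => S.energy 0 (U k 0)) atTop (𝓝 (S.energy 0 (ϑ (α 0))))) {t : ℝ}
    (ht : t ∈ Icc 0 S.T) : Tendsto (fun k => S.energy t (U k ((τ k).index t))) atTop
      (𝓝 (S.energy t (ϑ (α t)))) := by
  have heq := (h.energy_eq hA hB hC hE ht).1
  refine tendsto_order.2 ⟨fun a ha => ?_, fun a ha => ?_⟩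
  · filter_upwards [h.eventually_energy_le hA ht (half_pos (sub_pos.2 ha))] with k hk
    linarith
  · have hε' : 0 < (a - S.energy t (ϑ (α t))) / 4 := by linarith
    filter_upwards [h.eventually_energy_add_dissipated_le hA hC ht hε',
      (h.tendsto ht).2.2.eventually (lt_mem_nhds (sub_lt_self _ hε')),
      hE.eventually (gt_mem_nhds (lt_add_of_pos_right _ hε'))] with k k1 k2 k3
    linarith

/-- The energy balance between two times, with a bound for the work. -/
theorem abs_energy_sub_le (hA : S.AssumptionA) (hB : S.AssumptionB) (hC : S.AssumptionC)
    (h : SchemeTendsto τ U c K ϑ Θ G α)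
    (hE : Tendsto (fun k => S.energy 0 (U k 0)) atTop (𝓝 (S.energy 0 (ϑ (α 0))))) {L : ℝ}
    (hL : ∀ t ∈ Icc 0 S.T, ∀ x, S.F t x ≤ C → |S.power t x| ≤ L) {s t : ℝ}
    (hs : s ∈ Icc 0 S.T) (ht : t ∈ Icc 0 S.T) :
    |S.energy t (ϑ (α t)) + G (α t) - (S.energy s (ϑ (α s)) + G (α s))| ≤ L * |t - s| := by
  have h0 : (0 : ℝ) ∈ Icc 0 S.T := ⟨le_rfl, S.T_pos.le⟩
  rw [(h.energy_eq hA hB hC hE hs).1, (h.energy_eq hA hB hC hE ht).1, add_sub_add_left_eq_sub,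
    intervalIntegral.integral_interval_sub_left (h.intervalIntegrable hA hC h0 ht)
      (h.intervalIntegrable hA hC h0 hs)]
  rw [← Real.norm_eq_abs]
  refine intervalIntegral.norm_integral_le_of_norm_le_const fun r hr => ?_
  have hrT : r ∈ Icc 0 S.T := uIcc_subset_Icc hs ht (uIoc_subset_uIcc hr)
  exact hL r hrT _ (h.clock.mem_sublevel h.profile hrT r).2

/-- The jump from `u (t-)` to `u t` dissipates no more than the energy drop. Approximate from the
left by stable states `u s`: stability bounds `ℰ (s, u s)` by `ℰ (s, u (t-)) + D (u s) (u (t-))`,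
and the last term tends to zero by the left continuity of `δ`. -/
theorem energy_left_jump (hA : S.AssumptionA) (hB : S.AssumptionB) (hC : S.AssumptionC)
    (h : SchemeTendsto τ U c K ϑ Θ G α)
    (hE : Tendsto (fun k => S.energy 0 (U k 0)) atTop (𝓝 (S.energy 0 (ϑ (α 0))))) {t : ℝ}
    (ht : t ∈ Ioc 0 S.T) :
    S.energy t (ϑ (α t)) + (G (α t) - G (Function.leftLim α t)) ≤
      S.energy t (ϑ (Function.leftLim α t)) := by
  obtain ⟨L, hL0, hL⟩ := exists_abs_power_le hA C
  have htT : t ∈ Icc 0 S.T := ⟨ht.1.le, ht.2⟩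
  have h0T : (0 : ℝ) ∈ Icc 0 S.T := ⟨le_rfl, S.T_pos.le⟩
  set x := ϑ (Function.leftLim α t)
  set N : Set ℝ := {t | ¬ ContinuousAt α t}
  have hN : N.Countable := h.clock.mono.countable_not_continuousAt
  have hcl : t ∈ closure (Iio t ∩ Nᶜ) :=
    closure_minimal ((hN.dense_compl ℝ).open_subset_closure_inter isOpen_Iio) isClosed_closure
      (by rw [closure_Iio]; exact mem_Iic.2 le_rfl)
  obtain ⟨s, hs, hlim⟩ := mem_closure_iff_seq_limit.1 hcl
  have hlim' : Tendsto s atTop (𝓝[<] t) :=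
    tendsto_nhdsWithin_iff.2 ⟨hlim, Eventually.of_forall fun n => (hs n).1⟩
  have hsT : ∀ᶠ n in atTop, s n ∈ Ioc 0 S.T := by
    filter_upwards [hlim.eventually (lt_mem_nhds ht.1)] with n hn
    exact ⟨hn, (le_of_lt (hs n).1).trans ht.2⟩
  have hd : Tendsto (fun n => S.d (ϑ (α (s n))) x) atTop (𝓝 0) :=
    (h.clock.tendsto_d_left h.profile t).comp hlim'
  have hδ : Tendsto (fun n => S.δ (ϑ (α (s n))) x) atTop (𝓝 0) :=
    hB.left_continuous _ _ ⟨C, fun n => h.profile.F_le _ (h.clock.mem _) 0 h0T⟩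
      ((h.clock.tendsto_curve_left hA hC h.profile t).comp hlim') hd
  have hD : Tendsto (fun n => S.D (ϑ (α (s n))) x) atTop (𝓝 0) := by simpa [D] using hd.add hδ
  have hDr : Tendsto (fun n => (S.D (ϑ (α (s n))) x).toReal) atTop (𝓝 0) := by
    simpa [Function.comp_def] using (ENNReal.tendsto_toReal ENNReal.zero_ne_top).comp hD
  have hEx : Tendsto (fun n => S.energy (s n) x) atTop (𝓝 (S.energy t x)) :=
    (continuousOn_energy hA x t htT).tendsto.comp
      (tendsto_nhdsWithin_iff.2 ⟨hlim, hsT.mono fun n hn => ⟨hn.1.le, hn.2⟩⟩)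
  have hGs : Tendsto (fun n => G (α (s n))) atTop (𝓝 (G (Function.leftLim α t))) :=
    (h.clock.tendsto_G_left h.profile t).comp hlim'
  have hLs : Tendsto (fun n => L * |t - s n|) atTop (𝓝 (L * |t - t|)) :=
    ((tendsto_const_nhds.sub hlim).abs).const_mul L
  have hsum := ((hEx.add hDr).add hGs).add hLs
  have key : S.energy t (ϑ (α t)) + G (α t) ≤
      S.energy t x + 0 + G (Function.leftLim α t) + L * |t - t| := by
    refine ge_of_tendsto hsum ?_
    filter_upwards [hsT, hD.eventually (gt_mem_nhds ENNReal.zero_lt_top)] with n hn hDn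
    have h1 := (h.clock.stable_of_notMem h.profile hn (hs n).2).energy_le hDn.ne
    have h2 := (le_abs_self _).trans
      (h.abs_energy_sub_le hA hB hC hE hL (s := s n) ⟨hn.1.le, hn.2⟩ htT)
    linarith
  rw [sub_self, abs_zero, mul_zero] at key
  linarith

/-- The jump from `u t` to `u (t+)` dissipates no more than the energy drop. -/
theorem energy_right_jump (hA : S.AssumptionA) (hB : S.AssumptionB) (hC : S.AssumptionC)
    (h : SchemeTendsto τ U c K ϑ Θ G α)
    (hE : Tendsto (fun k => S.energy 0 (U k 0)) atTop (𝓝 (S.energy 0 (ϑ (α 0))))) {t : ℝ}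
    (ht : t ∈ Ico 0 S.T) :
    S.energy t (ϑ (Function.rightLim α t)) + (G (Function.rightLim α t) - G (α t)) ≤
      S.energy t (ϑ (α t)) := by
  obtain ⟨L, hL0, hL⟩ := exists_abs_power_le hA C
  have htT : t ∈ Icc 0 S.T := ⟨ht.1, ht.2.le⟩
  have hs := eventually_mem_Icc_right ht
  refine le_of_forall_pos_le_add fun ε hε => ?_
  have hlsc : ∀ᶠ s in 𝓝[>] t, S.energy t (ϑ (Function.rightLim α t)) ≤
      S.energy s (ϑ (α s)) + ε / 2 :=
    tendsto_energy_lsc hA (p := fun s => (s, ϑ (α s)))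
      ⟨htT, h.profile.F_le _ (h.clock.rightLim_mem h.profile t) t htT⟩
      ((tendsto_id.mono_left nhdsWithin_le_nhds).prodMk_nhds
        (h.clock.tendsto_curve_right hA hC h.profile t))
      (hs.mono fun s hs => h.clock.mem_sublevel h.profile hs.1 s) (half_pos hε)
  have hsmall : ∀ᶠ s in 𝓝[>] t, L * |s - t| < ε / 2 := by
    have : Tendsto (fun s => L * |s - t|) (𝓝[>] t) (𝓝 (L * |t - t|)) :=
      (((tendsto_id.sub_const t).abs).const_mul L).mono_left nhdsWithin_le_nhds
    rw [sub_self, abs_zero, mul_zero] at this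
    exact this.eventually (gt_mem_nhds (half_pos hε))
  obtain ⟨s, ⟨hsT, hts⟩, h1, h2⟩ := (hs.and (hlsc.and hsmall)).exists
  have h3 := (le_abs_self _).trans (h.abs_energy_sub_le hA hB hC hE hL htT hsT)
  have h4 := h.profile.G_mono (h.clock.rightLim_mem h.profile t) (h.clock.mem s)
    (h.clock.mono.rightLim_le hts)
  linarith

theorem eq_of_d_left_eq_zero (hA : S.AssumptionA) (hB : S.AssumptionB) (hC : S.AssumptionC)
    (h : SchemeTendsto τ U c K ϑ Θ G α)
    (hE : Tendsto (fun k => S.energy 0 (U k 0)) atTop (𝓝 (S.energy 0 (ϑ (α 0))))) {t : ℝ}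
    (ht : t ∈ Ioc 0 S.T) (hd : S.d (ϑ (Function.leftLim α t)) (ϑ (α t)) = 0) :
    ϑ (Function.leftLim α t) = ϑ (α t) := by
  have hst := h.clock.stable_leftLim h.profile ht
  refine hC.separated t ⟨ht.1.le, ht.2⟩ _ _ hst (hst.of_d_eq_zero hB hd ?_) hd
  have h1 := h.energy_left_jump hA hB hC hE ht
  have h2 := h.profile.G_mono (h.clock.leftLim_mem h.profile t) (h.clock.mem t)
    (h.clock.leftLim_le t)
  linarith

/-- If `u t ≠ u (t+)` were at distance zero, then `u t` would be unstable, hence preceded by a hole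
of the parametrized evolution, starting at some state `q`. As `D q (u (t+)) ≤ D q (u t)`, the cost
of the hole shows that `u (t+)` has at least the energy of `u t`; but leaving the unstable state
`u t` has strictly decreased the energy. -/
theorem eq_of_d_right_eq_zero (hA : S.AssumptionA) (hB : S.AssumptionB) (hC : S.AssumptionC)
    (h : SchemeTendsto τ U c K ϑ Θ G α)
    (hE : Tendsto (fun k => S.energy 0 (U k 0)) atTop (𝓝 (S.energy 0 (ϑ (α 0))))) {t : ℝ}
    (ht : t ∈ Ioo 0 S.T) (hd : S.d (ϑ (α t)) (ϑ (Function.rightLim α t)) = 0) :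
    ϑ (α t) = ϑ (Function.rightLim α t) := by
  by_contra hne
  have htT : t ∈ Icc 0 S.T := ⟨ht.1.le, ht.2.le⟩
  have hp := h.profile
  have hlK := h.clock.leftLim_mem hp t
  have hrK := h.clock.rightLim_mem hp t
  have hK := h.clock.mem t
  have htime := h.clock.time t htT
  have htl := h.clock.time_leftLim hp ⟨ht.1, ht.2.le⟩
  have hunst : ¬ S.Stable t (ϑ (α t)) := fun hst =>
    hne (hC.separated t htT _ _ hst (h.clock.stable_rightLim hp ⟨ht.1.le, ht.2⟩) hd)
  have hacc : α t ∉ closure (K ∩ Iio (α t)) := fun hcl => by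
    have := mem_closure_iff_nhdsWithin_neBot.1 hcl
    have hst := hp.stable_of_tendsto hK (l := 𝓝[K ∩ Iio (α t)] (α t)) (β := id)
      (by filter_upwards [self_mem_nhdsWithin] with b hb using ⟨hb.1, ne_of_lt hb.2⟩)
      (tendsto_id.mono_left nhdsWithin_le_nhds)
    rw [htime] at hst
    exact hunst hst
  have hlt : Function.leftLim α t < α t := by
    refine lt_of_le_of_ne (h.clock.leftLim_le t) fun he => hunst ?_
    have := h.clock.stable_leftLim hp ⟨ht.1, ht.2.le⟩
    rwa [he] at this
  obtain ⟨q, hq⟩ := exists_mem_holes_left hp.compact hK ⟨_, hlK, hlt⟩ hacc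
  have hqK : q ∈ K := hq.1
  have hqlt : q < α t := hq.2.2.1
  have hlq : Function.leftLim α t ≤ q := not_lt.1 fun hql =>
    disjoint_left.1 hq.2.2.2 ⟨hql, hlt⟩ hlK
  have hqt : Θ q = t := le_antisymm (htime ▸ hp.time_mono hqK hK hqlt.le)
    (htl ▸ hp.time_mono hlK hqK hlq)
  -- The hole `(q, α t)` costs at most `ℰ q - ℰ (u t)`, by `h1` and `h2` below.
  have hhole := hp.hole_le q (α t) hq
  rw [hqt] at hhole
  have h1 := h.energy_left_jump hA hB hC hE ⟨ht.1, ht.2.le⟩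
  have h2 := hp.energy_le hA hB hC hlK hqK hlq htl hqt
  have h3 : S.energy t (ϑ q) - S.energy t (ϑ (Function.rightLim α t)) ≤ G (α t) - G q :=
    energy_sub_le_of_le_ofReal (sub_nonneg.2 (hp.G_mono hqK hK hqlt.le))
      ((add_le_add_left (D_le_of_d_eq_zero hB hd (ϑ q)) _).trans hhole)
  have h4 := h.energy_right_jump hA hB hC hE ⟨ht.1.le, ht.2⟩
  have h5 : 0 < G (Function.rightLim α t) - G (α t) := by
    have hlt' : α t < Function.rightLim α t :=
      lt_of_le_of_ne (h.clock.le_rightLim t) fun he => hne (by rw [← he])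
    have hcost := hp.cost_le _ hK _ hrK hlt'
    rw [htime] at hcost
    by_contra hle
    rw [ENNReal.ofReal_of_nonpos (not_lt.1 hle)] at hcost
    exact hunst (stable_iff_residual_eq_zero.2
      (nonpos_iff_eq_zero.1 (le_add_self.trans hcost)))
  linarith

/-- The limit curve is a regulated curve of bounded variation and a Visco-Energetic solution. -/
theorem isViscoEnergetic (hA : S.AssumptionA) (hB : S.AssumptionB) (hC : S.AssumptionC)
    (h : SchemeTendsto τ U c K ϑ Θ G α)
    (hE : Tendsto (fun k => S.energy 0 (U k 0)) atTop (𝓝 (S.energy 0 (ϑ (α 0)))))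
    (hu₀ : ∀ v, S.Stable 0 v → S.d (ϑ (α 0)) v = 0 → v = ϑ (α 0)) :
    IsRegulatedBV S.d 0 S.T (fun s => ϑ (α s)) ∧ S.IsViscoEnergetic fun s => ϑ (α s) := by
  have hp := h.profile
  have hfin : ∀ t ∈ Icc 0 S.T, augmentedVar S.d S.jumpCost (fun s => ϑ (α s)) 0 t ≠ ⊤ :=
    fun t ht => ((h.clock.augmentedVar_le hA hC hp ht).trans_lt ENNReal.ofReal_lt_top).ne
  have hreg : IsRegulated S.d 0 S.T fun s => ϑ (α s) :=
    { tendsto_left := fun t ht => by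
        rw [h.clock.leftLimit_curve hA hC hp ht.1]
        exact h.clock.tendsto_curve_left hA hC hp t
      dist_left := fun t ht => by
        rw [h.clock.leftLimit_curve hA hC hp ht.1]
        exact h.clock.tendsto_d_left hp t
      tendsto_right := fun t ht => by
        rw [h.clock.rightLimit_curve hA hC hp ht.2]
        exact h.clock.tendsto_curve_right hA hC hp t
      dist_right := fun t ht => by
        rw [h.clock.rightLimit_curve hA hC hp ht.2]
        exact h.clock.tendsto_d_right hp t
      eq_left := fun t ht hd => by
        rcases ht.1.eq_or_lt with rfl | h0
        · exact leftLimit_self (u := fun s => ϑ (α s)) 0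
        · rw [h.clock.leftLimit_curve hA hC hp h0] at hd ⊢
          exact h.eq_of_d_left_eq_zero hA hB hC hE ⟨h0, ht.2⟩ hd
      eq_right := fun t ht hd => by
        rcases ht.2.eq_or_lt with rfl | hT
        · exact (rightLimit_self (u := fun s => ϑ (α s)) _).symm
        rw [h.clock.rightLimit_curve hA hC hp hT] at hd ⊢
        rcases ht.1.eq_or_lt with rfl | h0
        · exact (hu₀ _ (h.clock.stable_rightLim hp ⟨le_rfl, hT⟩) hd).symm
        · exact h.eq_of_d_right_eq_zero hA hB hC hE ⟨h0, hT⟩ hd }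
  refine ⟨⟨hreg, ne_top_of_le_ne_top (hfin S.T ⟨S.T_pos.le, le_rfl⟩) le_self_add⟩,
    { regulated := hreg
      stable := fun t ht hJ => h.clock.stable hA hC hp ht hJ
      var_finite := hfin
      power_integrable := h.clock.intervalIntegrable_power hA hC hp
      balance := fun t ht => ?_ }⟩
  obtain ⟨h1, h2⟩ := h.energy_eq hA hB hC hE ht
  rw [h2, h1]

end SchemeTendsto

end RateIndependentSystem

/-! ### Mesh sizes -/

namespace TimePartition

variable {T : ℝ} (τ : TimePartition T)

theorem sub_le_mesh {n : ℕ} (hn : n < τ.N) : τ.t (n + 1) - τ.t n ≤ τ.mesh :=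
  le_ciSup (f := fun n : Fin τ.N => τ.t (n + 1) - τ.t n) (Set.finite_range _).bddAbove ⟨n, hn⟩

theorem mesh_nonneg : 0 ≤ τ.mesh :=
  Real.iSup_nonneg fun n => sub_nonneg.2 (τ.t_lt n n.2).le

/-- The uniform partition into `k + 1` intervals. -/
noncomputable def uniform (hT : 0 < T) (k : ℕ) : TimePartition T where
  N := k + 1
  t n := n * (T / (k + 1))
  t_zero := by simp
  t_last := by
    push_cast
    field_simp
  t_lt n _ := by
    have : 0 < T / (k + 1) := by positivity
    push_cast
    linarith

theorem mesh_uniform (hT : 0 < T) (k : ℕ) : (uniform hT k).mesh = T / (k + 1) := by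
  have h : ∀ n : Fin (uniform hT k).N,
      (uniform hT k).t (n + 1) - (uniform hT k).t n = T / (k + 1) := fun n => by
    simp only [uniform]
    push_cast
    ring
  have : Nonempty (Fin (uniform hT k).N) := ⟨⟨0, Nat.succ_pos k⟩⟩
  rw [mesh, iSup_congr h, ciSup_const]

end TimePartition

namespace RateIndependentSystem

variable {X : Type*} [TopologicalSpace X] {S : RateIndependentSystem X}

/-! ### Compactness and existence -/

/-- The scheme is solvable, by the direct method. -/
theorem exists_minimizer (hA : S.AssumptionA) {t : ℝ} (ht : t ∈ Icc 0 S.T) (x : X) :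
    ∃ y, ∀ V, (S.D x y : EReal) + (S.energy t y : EReal) ≤ S.D x V + S.energy t V := by
  set f : X → ℝ := fun V => (S.D x V).toReal + S.energy t V with hf
  set c : ℝ := (S.d S.xo x).toReal + S.Fo with hc
  have hFf : ∀ V, S.D x V ≠ ⊤ → S.F t V ≤ f V + c := fun V hV => by
    have hd : S.d x V ≠ ⊤ := ne_top_of_le_ne_top hV le_self_add
    have h1 := toReal_d_triangle hd
    have h2 : (S.d x V).toReal ≤ (S.D x V).toReal := ENNReal.toReal_mono hV le_self_add
    simp only [F, hf, hc]
    linarith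
  set A : Set ℝ := f '' {V | S.D x V ≠ ⊤}
  have hne : A.Nonempty := ⟨f x, x, by simp [D, S.d_self, S.δ_self], rfl⟩
  have hbdd : BddBelow A := ⟨-c, by
    rintro _ ⟨V, hV, rfl⟩
    linarith [hFf V hV, F_nonneg hA ht V]⟩
  obtain ⟨s, -, hs, hsA⟩ := exists_seq_tendsto_sInf hne hbdd
  choose V hVD hV using hsA
  obtain ⟨M, hM⟩ := hs.bddAbove_range
  obtain ⟨⟨t', y⟩, hy, φ, hφ, hlim⟩ := hA.sublevel_compact (M + c) (x := fun n => (t, V n))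
    fun n => ⟨ht, (hFf _ (hVD n)).trans (by
      have := hM (mem_range_self n)
      rw [hV n]; linarith)⟩
  have hVy : Tendsto (fun n => V (φ n)) atTop (𝓝 y) := (continuous_snd.tendsto _).comp hlim
  obtain rfl : t' = t :=
    tendsto_nhds_unique ((continuous_fst.tendsto _).comp hlim) tendsto_const_nhds
  have hsφ := hs.comp hφ.tendsto_atTop
  have hEy : ∀ ε : ℝ, 0 < ε → ∀ᶠ n in atTop,
      (S.D x (V (φ n))).toReal ≤ s (φ n) - S.energy t' y + ε := fun ε hε => by
    filter_upwards [tendsto_energy_lsc hA hy hlim (Eventually.of_forall fun n => by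
      refine ⟨ht, (hFf _ (hVD _)).trans ?_⟩
      have := hM (mem_range_self (φ n))
      rw [hV]; linarith) hε] with n hn
    have h1 := hV (φ n)
    simp only [hf] at h1
    simp only [Function.comp_apply] at hn
    linarith
  have hm : S.energy t' y ≤ sInf A := le_of_forall_pos_le_add fun ε hε => by
    have h1 : Tendsto (fun n => s (φ n) - S.energy t' y + ε) atTop
        (𝓝 (sInf A - S.energy t' y + ε)) := (hsφ.sub_const _).add_const _
    have := ge_of_tendsto h1 ((hEy ε hε).mono fun n hn => ENNReal.toReal_nonneg.trans hn)
    linarith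
  have hDlsc : LowerSemicontinuous fun p : X × X => S.D p.1 p.2 := S.d_lsc.add S.δ_lsc
  have hD : S.D x y ≤ ENNReal.ofReal (sInf A - S.energy t' y) := by
    refine ENNReal.le_of_forall_pos_le_add fun ε hε _ => ?_
    rw [← ENNReal.ofReal_coe_nnreal, ← ENNReal.ofReal_add (sub_nonneg.2 hm) ε.coe_nonneg]
    refine hDlsc.le_of_tendsto_of_le (tendsto_const_nhds.prodMk_nhds hVy)
      (ENNReal.tendsto_ofReal ((hsφ.sub_const (S.energy t' y)).add_const (ε : ℝ))) ?_
    filter_upwards [hEy ε (by exact_mod_cast hε)] with n hn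
    exact (ENNReal.le_ofReal_iff_toReal_le (hVD _) (ENNReal.toReal_nonneg.trans hn)).2 hn
  have hDy : S.D x y ≠ ⊤ := ne_top_of_le_ne_top ENNReal.ofReal_ne_top hD
  have hDr : (S.D x y).toReal ≤ sInf A - S.energy t' y :=
    ENNReal.toReal_le_of_le_ofReal (by linarith) hD
  refine ⟨y, fun W => ?_⟩
  by_cases hW : S.D x W = ⊤
  · simp [hW]
  have h1 : sInf A ≤ f W := csInf_le hbdd ⟨W, hW, rfl⟩
  have h2 : (S.D x y).toReal + S.energy t' y ≤ (S.D x W).toReal + S.energy t' W := by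
    simp only [hf] at h1
    linarith
  rw [← ENNReal.ofReal_toReal hDy, ← ENNReal.ofReal_toReal hW, EReal.coe_ennreal_ofReal,
    EReal.coe_ennreal_ofReal, max_eq_left ENNReal.toReal_nonneg,
    max_eq_left ENNReal.toReal_nonneg]
  exact_mod_cast h2

theorem exists_isDiscreteSolution (hA : S.AssumptionA) (τ : TimePartition S.T) (x : X) :
    ∃ U : ℕ → X, U 0 = x ∧ S.IsDiscreteSolution τ U := by
  have : Nonempty X := ⟨x⟩
  choose! m hm using fun t ht => exists_minimizer hA (t := t) ht
  exact ⟨fun n => Nat.rec x (fun n y => m (τ.t (n + 1)) y) n, rfl,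
    fun n hn V => hm _ (τ.t_mem hn) _ V⟩

/-- Compactness of the scheme: discrete solutions of vanishing mesh and bounded initial energy
converge, along a subsequence, at all times. -/
theorem exists_schemeTendsto [T2Space X] (hA : S.AssumptionA) (hC : S.AssumptionC)
    {τ : ℕ → TimePartition S.T} {U : ℕ → ℕ → X} (hU : ∀ k, S.IsDiscreteSolution (τ k) (U k))
    (hτ : Tendsto (fun k => (τ k).mesh) atTop (𝓝 0)) {B : ℝ} (hB : ∀ k, S.F 0 (U k 0) ≤ B) :
    ∃ φ : ℕ → ℕ, StrictMono φ ∧ ∃ (C R : ℝ) (c : ℕ → S.Chain C R) (K : Set ℝ) (ϑ : ℝ → X)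
      (Θ G α : ℝ → ℝ),
      SchemeTendsto (fun k => τ (φ k)) (fun k => U (φ k)) c K ϑ Θ G α := by
  obtain ⟨C, R, hchain⟩ := exists_chain hA B
  choose c hcN hct hcx hcσ using fun k => hchain (τ k) (U k) (hU k) (hB k)
  have hmesh : ∀ k, ∀ j < (c k).N, (c k).t (j + 1) - (c k).t j ≤ (τ k).mesh := fun k j hj => by
    rw [hct]
    exact (τ k).sub_le_mesh (hcN k ▸ hj)
  obtain ⟨φ, hφ, K, ϑ, Θ, G, hlim⟩ := exists_chainsTendsto hA hC hτ hmesh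
  have hτφ := hτ.comp hφ.tendsto_atTop
  have hprof := hlim.isProfile hA hC hτφ fun k => hmesh (φ k)
  have htime : ∀ t ∈ Icc 0 S.T, Tendsto (fun k => (τ (φ k)).t ((τ (φ k)).index t)) atTop (𝓝 t) :=
    fun t ht => by
      refine tendsto_of_tendsto_of_tendsto_of_le_of_le tendsto_const_nhds
        (by simpa using hτφ.const_add t) (fun k => (τ (φ k)).le_t_index ht.2) fun k => ?_
      have := (τ (φ k)).t_index_sub_le (fun n hn => (τ (φ k)).sub_le_mesh hn) ht
        (τ (φ k)).mesh_nonneg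
      linarith
  obtain ⟨D, hDc, hD, χ, hχ, hl⟩ := hlim.exists_subseq_time hprof
    (i := fun k t => (τ (φ k)).index t) (fun k t ht => hcN (φ k) ▸ (τ (φ k)).index_le_N ht.2)
    (fun t ht => by simpa only [hct] using htime t ht)
  choose! l hl using hl
  have hlχ := hlim.subseq hχ
  have hl2 : ∀ t ∈ Icc 0 S.T, l t ∈ K ∧ Θ (l t) = t := fun t ht => by
    obtain ⟨h1, -, h2, -⟩ := hlχ.tendsto id strictMono_id
      (fun k => (τ (φ (χ k))).index t) (fun k => hcN (φ (χ k)) ▸ (τ (φ (χ k))).index_le_N ht.2)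
      (l t) (hl t ht)
    refine ⟨h1, tendsto_nhds_unique h2 ?_⟩
    simpa only [id, hct, Function.comp_def] using (htime t ht).comp hχ.tendsto_atTop
  -- The clock is extended by constants outside `[0, T]`.
  have hT := S.T_pos.le
  have hproj : ∀ t, (projIcc 0 S.T hT t : ℝ) ∈ Icc 0 S.T := fun t => Subtype.coe_prop _
  have hα : ∀ t ∈ Icc 0 S.T, l (projIcc 0 S.T hT t) = l t := fun t ht => by
    rw [projIcc_of_mem hT ht]
  refine ⟨φ ∘ χ, hφ.comp hχ, C, R, fun k => c (φ (χ k)), K, ϑ, Θ, G,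
    fun t => l (projIcc 0 S.T hT t),
    { chains := hlχ
      profile := hprof
      clock := ⟨fun s t hst => ?_, fun t => (hl2 _ (hproj t)).1, fun t ht => ?_⟩
      N_eq := fun k => hcN _
      t_eq := fun k => hct _
      x_eq := fun k => hcx _
      σ_eq := fun k => hcσ _
      mesh := ⟨_, hτφ.comp hχ.tendsto_atTop, fun k => (τ (φ (χ k))).mesh_nonneg,
        fun k n hn => (τ (φ (χ k))).sub_le_mesh hn⟩
      arc := fun t ht => by
        rw [hα t ht]
        exact hl t ht
      plateaus := ⟨D, hDc, hD⟩ }⟩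
  · refine le_of_tendsto_of_tendsto' (hl _ (hproj s)) (hl _ (hproj t)) fun k => ?_
    exact (c _).a_mono ((τ _).index_mono (monotone_projIcc hT hst) (hproj t).2)
      (hcN (φ (χ k)) ▸ (τ _).index_le_N (hproj t).2)
  · rw [hα t ht]
    exact (hl2 t ht).2

/-- Convergence of the scheme to a Visco-Energetic solution. -/
theorem exists_tendsto_isViscoEnergetic [T2Space X] (hA : S.AssumptionA) (hB : S.AssumptionB)
    (hC : S.AssumptionC) {u₀ : X} (hu₀ : ∀ v, S.Stable 0 v → S.d u₀ v = 0 → v = u₀)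
    {τ : ℕ → TimePartition S.T} {U : ℕ → ℕ → X} (hU : ∀ k, S.IsDiscreteSolution (τ k) (U k))
    (hτ : Tendsto (fun k => (τ k).mesh) atTop (𝓝 0))
    (hd : ∃ C : ℝ, ∀ k, S.d S.xo (U k 0) ≤ ENNReal.ofReal C)
    (hlim : Tendsto (fun k => U k 0) atTop (𝓝 u₀))
    (hE : Tendsto (fun k => S.energy 0 (U k 0)) atTop (𝓝 (S.energy 0 u₀))) :
    ∃ (φ : ℕ → ℕ) (u : ℝ → X), StrictMono φ ∧
      u 0 = u₀ ∧ IsRegulatedBV S.d 0 S.T u ∧ S.IsViscoEnergetic u ∧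
      ∀ t ∈ Icc 0 S.T,
        Tendsto (fun k => (τ (φ k)).interpolant (U (φ k)) t) atTop (𝓝 (u t)) ∧
        Tendsto (fun k => S.energy t ((τ (φ k)).interpolant (U (φ k)) t)) atTop
          (𝓝 (S.energy t (u t))) := by
  obtain ⟨C₀, hC₀⟩ := hd
  obtain ⟨M, hM⟩ := hE.bddAbove_range
  have hF : ∀ k, S.F 0 (U k 0) ≤ M + max C₀ 0 + S.Fo := fun k => by
    have h1 := hM (mem_range_self k)
    have h2 : (S.d S.xo (U k 0)).toReal ≤ max C₀ 0 :=
      ENNReal.toReal_le_of_le_ofReal (le_max_right _ _)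
        ((hC₀ k).trans (ENNReal.ofReal_le_ofReal (le_max_left _ _)))
    simp only [F]
    linarith
  obtain ⟨φ, hφ, C, R, c, K, ϑ, Θ, G, α, h⟩ := exists_schemeTendsto hA hC hU hτ hF
  have h0 : ϑ (α 0) = u₀ := by
    refine tendsto_nhds_unique (h.tendsto ⟨le_rfl, S.T_pos.le⟩).1 ?_
    simpa only [TimePartition.index_zero, Function.comp_def] using hlim.comp hφ.tendsto_atTop
  have hE' : Tendsto (fun k => S.energy 0 (U (φ k) 0)) atTop (𝓝 (S.energy 0 (ϑ (α 0)))) := by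
    rw [h0]
    exact hE.comp hφ.tendsto_atTop
  obtain ⟨h1, h2⟩ := h.isViscoEnergetic hA hB hC hE' (h0.symm ▸ hu₀)
  exact ⟨φ, fun s => ϑ (α s), hφ, h0, h1, h2, fun t ht =>
    ⟨(h.tendsto ht).1, h.tendsto_energy hA hB hC hE' ht⟩⟩

end RateIndependentSystem

theorem theorem3p8 {X : Type*} [TopologicalSpace X] [T2Space X] [FirstCountableTopology X]
    (S : RateIndependentSystem X) (hA : S.AssumptionA) (hB : S.AssumptionB) (hC : S.AssumptionC)
    (u₀ : X) (hu₀ : ∀ v, S.Stable 0 v → S.d u₀ v = 0 → v = u₀) :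
    (∀ (τ : ℕ → TimePartition S.T) (U : ℕ → ℕ → X),
      (∀ k, S.IsDiscreteSolution (τ k) (U k)) →
      Tendsto (fun k => (τ k).mesh) atTop (𝓝 0) →
      (∃ C : ℝ, ∀ k, S.d S.xo (U k 0) ≤ ENNReal.ofReal C) →
      Tendsto (fun k => U k 0) atTop (𝓝 u₀) →
      Tendsto (fun k => S.energy 0 (U k 0)) atTop (𝓝 (S.energy 0 u₀)) →
      ∃ (φ : ℕ → ℕ) (u : ℝ → X), StrictMono φ ∧
        u 0 = u₀ ∧ IsRegulatedBV S.d 0 S.T u ∧ S.IsViscoEnergetic u ∧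
        ∀ t ∈ Icc 0 S.T,
          Tendsto (fun k => (τ (φ k)).interpolant (U (φ k)) t) atTop (𝓝 (u t)) ∧
          Tendsto (fun k => S.energy t ((τ (φ k)).interpolant (U (φ k)) t)) atTop
            (𝓝 (S.energy t (u t)))) ∧
    (∃ u : ℝ → X, u 0 = u₀ ∧ IsRegulatedBV S.d 0 S.T u ∧ S.IsViscoEnergetic u) := by
  refine ⟨fun τ U hU hτ hd hlim hE =>
    RateIndependentSystem.exists_tendsto_isViscoEnergetic hA hB hC hu₀ hU hτ hd hlim hE, ?_⟩
  choose U hU0 hU using fun k =>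
    RateIndependentSystem.exists_isDiscreteSolution hA (TimePartition.uniform S.T_pos k) u₀
  obtain ⟨-, u, -, h0, h1, h2, -⟩ :=
    RateIndependentSystem.exists_tendsto_isViscoEnergetic hA hB hC hu₀ hU
      (by simpa [TimePartition.mesh_uniform, Function.comp_def] using
        (tendsto_const_div_atTop_nhds_zero_nat S.T).comp (tendsto_add_atTop_nat 1))
      ⟨(S.d S.xo u₀).toReal, fun k => by rw [hU0, ENNReal.ofReal_toReal (S.d_finite u₀)]⟩
      (by simp only [hU0]; exact tendsto_const_nhds)
      (by simp only [hU0]; exact tendsto_const_nhds)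
  exact ⟨u, h0, h1, h2⟩
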